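/- Let $\mathcal K=\mathbb R$ or $\mathcal K=\mathbb C$, let $p$ be a prime number, and let $\phi:E\to E'$ be an isogeny of degree $p$ of elliptic curves over $\mathcal K$ (defined over $\mathcal K$). Let $\omega,\omega'$ be non-zero invariant differentials on $E$ and $E'$, and put $$\Omega(E,\omega)=\int_{E(\mathbb R)}|\omega|\quad(\mathcal K=\mathbb R),\qquad \Omega(E,\omega)=2\int_{E(\mathbb C)}|\omega\wedge\bar\omega|\quad(\mathcal K=\mathbb C),$$ and similarly for $\Omega(E',\omega')$. Let $|x|_{\mathbb R}=|x|$ and $|x|_{\mathbb C}=|x|^2$ be the normalised absolute values, and write $\frac{\omega}{\phi^*\omega'}$ for the scalar $\alpha\in\mathcal K^\times$ with $\omega=\alpha\,\phi^*\omega'$. Then $$\frac{\Omega(E,\omega)}{\Omega(E',\omega')}=\lambda\,\Bigl|\frac{\omega}{\phi^*\omega'}\Bigr|_{\mathcal K},$$ where $\lambda$ is * $p$ if $\mathcal K=\mathbb C$; * $p$ if $\mathcal K=\mathbb R$, $p\neq2$ and $\ker\phi\subset E(\mathbb R)$; * $1$ if $\mathcal K=\mathbb R$, $p\neq2$ and $\ker\phi\not\subset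 E(\mathbb R)$. (Here $\ker\phi$ is the kernel of $\phi$ on $E(\mathbb C)$.) If $\mathcal K=\mathbb R$ and $p=2$, then $E$ can be written over $\mathbb R$ in the form $y^2=x^3+ax^2+bx$ with $(0,0)\in\ker\phi$, and for every such form $\lambda$ is * $1$ if $b>0$ and either $a<0$ or $4b>a^2$; * $2$ otherwise. -/

import Mathlib

open Polynomial
open scoped Polynomial.Bivariate

noncomputable section

namespace WeierstrassCurve

variable {K : Type*} [Field K]

/-- The function field `K(E)` of a Weierstrass curve `E` over `K`. -/
abbrev RatFun (E : WeierstrassCurve K) : Type _ := E.toAffine.FunctionField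

/-- The `K(E)`-module `Ω_{K(E)/K}` of differentials. -/
abbrev Differentials (E : WeierstrassCurve K) : Type _ := KaehlerDifferential K E.RatFun

/-- The class in `K(E)` of a polynomial in the affine coordinates. -/
def ofPoly (E : WeierstrassCurve K) (q : K[X][Y]) : E.RatFun :=
  algebraMap E.toAffine.CoordinateRing E.RatFun (Affine.CoordinateRing.mk E.toAffine q)

/-- The coordinate function `x` on `E`. -/
def xFun (E : WeierstrassCurve K) : E.RatFun := E.ofPoly (C X)

/-- The coordinate function `y` on `E`. -/
def yFun (E : WeierstrassCurve K) : E.RatFun := E.ofPoly Y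

/-- For a point `(x, y)` of the affine curve `E` with coordinates in a field `L ⊇ K`: the rational
function `f ∈ K(E)` is regular at `(x, y)`, that is `f = u / v` for polynomials `u`, `v` with
`v(x, y) ≠ 0`, and its value `u(x, y) / v(x, y)` is `c`. -/
def HasValueAt {L : Type*} [Field L] [Algebra K L] (E : WeierstrassCurve K) (f : E.RatFun)
    (x y c : L) : Prop :=
  ∃ u v : K[X][Y], aevalAeval x y v ≠ 0 ∧ f * E.ofPoly v = E.ofPoly u ∧
    aevalAeval x y u = c * aevalAeval x y v

/-- The group `E(ℂ)` of complex points of `E`, where `K` is a field with an embedding in `ℂ`. -/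
abbrev ComplexPoints [Algebra K ℂ] (E : WeierstrassCurve K) : Type :=
  (Affine.baseChange E.toAffine ℂ).Point

/-- An isogeny `φ : E → E'` of elliptic curves over a field `K ⊆ ℂ`: a non-constant morphism of
curves over `K` that is a homomorphism of groups.  A non-constant morphism is given by an embedding
`φ^* : K(E') → K(E)` of the function fields over `K`; the induced map on complex points sends a
point `P` to the affine point `(x', y')` exactly when `φ^* x` and `φ^* y` are regular at `P` with
values `x'` and `y'`, and to the point at infinity when this holds for no `(x', y')`. -/
structure Isogeny [Algebra K ℂ] (E E' : WeierstrassCurve K) where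
  /-- The embedding `φ^*` of function fields. -/
  comap : E'.RatFun →ₐ[K] E.RatFun
  /-- The homomorphism on complex points. -/
  toHom : E.ComplexPoints →+ E'.ComplexPoints
  /-- The homomorphism on points is the one that `φ^*` induces. -/
  toHom_eq_some_iff : ∀ (x y : ℂ) (h : (Affine.baseChange E.toAffine ℂ).Nonsingular x y)
    (x' y' : ℂ) (h' : (Affine.baseChange E'.toAffine ℂ).Nonsingular x' y'),
    toHom (.some x y h) = .some x' y' h' ↔
      E.HasValueAt (comap E'.xFun) x y x' ∧ E.HasValueAt (comap E'.yFun) x y y'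

/-- The degree `[K(E) : φ^* K(E')]` of an isogeny. -/
def Isogeny.degree [Algebra K ℂ] {E E' : WeierstrassCurve K} (φ : Isogeny E E') : ℕ :=
  Module.finrank φ.comap.fieldRange E.RatFun

/-- The pull-back `φ^* : Ω_{K(E')/K} → Ω_{K(E)/K}` of differentials along an isogeny, which sends
`f dg` to `φ^*(f) d(φ^* g)`. -/
def Isogeny.pullback [Algebra K ℂ] {E E' : WeierstrassCurve K} (φ : Isogeny E E') :
    E'.Differentials → E.Differentials :=
  letI : Algebra E'.RatFun E.RatFun := φ.comap.toRingHom.toAlgebra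
  haveI : IsScalarTower K E'.RatFun E.RatFun :=
    IsScalarTower.of_algebraMap_eq fun c => (φ.comap.commutes c).symm
  KaehlerDifferential.map K K E'.RatFun E.RatFun

/-- The affine point `(x, y)` is a complex point of `E` in the kernel of `φ`. -/
def Isogeny.KerContains [Algebra K ℂ] {E E' : WeierstrassCurve K} (φ : Isogeny E E')
    (x y : ℂ) : Prop :=
  ∃ h : (Affine.baseChange E.toAffine ℂ).Nonsingular x y, φ.toHom (.some x y h) = 0

/-- The differential `dx / (2y + a₁x + a₃)` on `E`. -/
def stdDifferential (E : WeierstrassCurve K) : E.Differentials :=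
  (2 * E.yFun + algebraMap K E.RatFun E.a₁ * E.xFun + algebraMap K E.RatFun E.a₃)⁻¹ •
    KaehlerDifferential.D K E.RatFun E.xFun

/-- A (non-zero) invariant differential on `E/K`: a multiple `c dx / (2y + a₁x + a₃)` with
`c ∈ Kˣ`. -/
structure InvariantDifferential (E : WeierstrassCurve K) where
  /-- The factor `c`. -/
  coeff : Kˣ

/-- The invariant differential as an element of the module of differentials of `K(E)/K`. -/
def InvariantDifferential.toKaehler {E : WeierstrassCurve K} (ω : E.InvariantDifferential) :
    E.Differentials :=
  algebraMap K E.RatFun (ω.coeff : K) • E.stdDifferential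

/-- The function `g` with `ω = g dx`, namely `c / (2y + a₁x + a₃)`, at the point `(x, y)`. -/
def InvariantDifferential.density {E : WeierstrassCurve K} (ω : E.InvariantDifferential)
    (x y : K) : K :=
  (ω.coeff : K) / (2 * y + E.a₁ * x + E.a₃)

/-- The period `∫_{E(ℝ)} |ω|` of an elliptic curve over `ℝ`.  The integral is computed in the
coordinate `x`, which is a local coordinate on `E(ℝ)` away from finitely many points: with
`ω = g dx` it is the integral over `x ∈ ℝ` of the sum of `|g|` over the points of `E(ℝ)` above
`x`. -/
def realPeriod (E : WeierstrassCurve ℝ) (ω : E.InvariantDifferential) : ℝ :=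
  (∫⁻ x : ℝ, ∑' y : {y : ℝ // E.toAffine.Equation x y},
    ENNReal.ofReal |ω.density x y|).toReal

/-- The period `2 ∫_{E(ℂ)} |ω ∧ ω̄|` of an elliptic curve over `ℂ`, computed in the coordinate `x`
as for `realPeriod`.  With `ω = g dx` one has `|ω ∧ ω̄| = |g|² |dx ∧ dx̄|`, and `|dx ∧ dx̄|` is twice
the Lebesgue measure on `ℂ`. -/
def complexPeriod (E : WeierstrassCurve ℂ) (ω : E.InvariantDifferential) : ℝ :=
  2 * (∫⁻ x : ℂ, ∑' y : {y : ℂ // E.toAffine.Equation x y},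
    ENNReal.ofReal (2 * ‖ω.density x y‖ ^ 2)).toReal

/-- For `φ : E → E'` over `ℝ`: the change of coordinates `V`, given by
`(X, Y) ↦ (u²X + r, u³Y + u²sX + t)`, puts `E` in the form `Y² = X³ + aX² + bX`, and the point
`(X, Y) = (0, 0)`, which is the point `(r, t)` of `E`, lies in `ker φ`. -/
def Isogeny.IsTwoTorsionForm {E E' : WeierstrassCurve ℝ} (φ : Isogeny E E')
    (V : VariableChange ℝ) (a b : ℝ) : Prop :=
  V • E = { a₁ := 0, a₂ := a, a₃ := 0, a₄ := b, a₆ := 0 } ∧ φ.KerContains V.r V.t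

end WeierstrassCurve

end

/-! Put η = 2y + a₁x + a₃, so that η² = Ψ₂(x) with Ψ₂ = 4x³ + b₂x² + 2b₄x + b₆ (`Ψ₂Sq`), and the
standard differential is dx/η. An isogeny commutes with negation, hence φ^*x = A(x)/B(x) in lowest
terms and φ^*η = (w(x)/B(x)²) η. The equation of E' becomes Ψ₂ w² = B · Ψ₂'(A, B), where Ψ₂'(A, B)
is the homogenised cubic. The right side is a binary quartic form without repeated factor, evaluated
at (A, B). This forces w to divide the Wronskian A'B − AB', and a degree count shows that the
quotient is a constant β (`exists_wronskian_eq_of_mul_sq_eq`). By the quotient rule φ^*(dx/η) = β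
dx/η, so the scalar for ω = c dx/η and ω' = c' dx/η is α = c/(c'β). All of this is gathered in
`exists_hasRationalForm`.

Summing over ±η turns the periods into constants times ∫ |Ψ₂|⁻¹ over ℂ, or ∫ Ψ₂^(-1/2) over the
reals where Ψ₂ > 0. Substitute t = A(x)/B(x): dt/dx = βw/B² and Ψ₂'(t) = Ψ₂(x)(w/B²)², so the
integrand for E' pulls back to the one for E up to a power of |β|. The factor that remains is the
number of solutions x of A(x) = tB(x) (`mul_complexIntegral_eq`, `mul_realIntegral_eq`).

Over ℂ a generic fibre has max(deg A, deg B) points, and this number is the degree p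
(`max_natDegree_eq_degree`, `ncard_fiber`). Over ℝ a non-empty fibre is a coset of the group of real
points of ker φ. For odd p complex conjugation fixes a point of every generic fibre over a real
point, so no such fibre is empty, and the count is p or 1 because the kernel has prime order.

For p = 2 the kernel is {0, T} with T real, so non-empty fibres have two points, but φ need not be
onto real points. With T = (x₀, y₀), z = x − x₀ and Ψ₂ = 4z(z² + az + b), the isogeny is φ^*x =
β⁻²(z + b/z) + σ. In the coordinate τ = z + b/z the cubic of E' is a positive multiple of (τ + a)(τ²
− 4b), and the image is the part where τ² > 4b. Either this is everything, and λ = 2, or it is the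
unbounded one of two components. The two components have equal periods
(`lintegral_Ioo_eq_lintegral_Ioi_of_cubic`), so then λ = 2 · 1/2 = 1. -/

namespace Polynomial

variable {K : Type*} [Field K]

/-! ### Polynomial solutions of F w² = B G(A, B) and their Wronskian. -/

/-- The binary cubic form with coefficients `a, b, c, d`. -/
noncomputable def cubicForm (a b c d : K) (A B : K[X]) : K[X] :=
  C a * A ^ 3 + C b * A ^ 2 * B + C c * A * B ^ 2 + C d * B ^ 3

/-- The discriminant of a cubic lies in the ideal generated by the cubic and its derivative. -/
lemma cubic_discr_bezout {R : Type*} [CommRing R] (a b c d A B : R) :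
    (-6 * a * (b ^ 2 - 3 * a * c) * A + (-4 * b ^ 3 + 15 * a * b * c - 27 * a ^ 2 * d) * B) *
      (a * A ^ 3 + b * A ^ 2 * B + c * A * B ^ 2 + d * B ^ 3) +
    (2 * a * (b ^ 2 - 3 * a * c) * A ^ 2 + (2 * b ^ 3 - 7 * a * b * c + 9 * a ^ 2 * d) * A * B +
      (b ^ 2 * c - 4 * a * c ^ 2 + 3 * a * b * d) * B ^ 2) *
      (3 * a * A ^ 2 + 2 * b * A * B + c * B ^ 2) =
    (b ^ 2 * c ^ 2 - 4 * a * c ^ 3 - 4 * b ^ 3 * d - 27 * a ^ 2 * d ^ 2 + 18 * a * b * c * d) *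
      B ^ 4 := by
  ring

lemma exists_coprime_mul {p d : K[X]} (hd : d ≠ 0) :
    ∃ g A B : K[X], g ≠ 0 ∧ IsCoprime A B ∧ p = g * A ∧ d = g * B := by
  classical
  have hg : EuclideanDomain.gcd p d ≠ 0 := fun h0 => hd (EuclideanDomain.gcd_eq_zero_iff.mp h0).2
  obtain ⟨A, hA⟩ := EuclideanDomain.gcd_dvd_left p d
  obtain ⟨B, hB⟩ := EuclideanDomain.gcd_dvd_right p d
  refine ⟨_, A, B, hg, ?_, hA, hB⟩
  have hb := EuclideanDomain.gcd_eq_gcd_ab p d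
  refine ⟨EuclideanDomain.gcdA p d, EuclideanDomain.gcdB p d, ?_⟩
  apply mul_left_cancel₀ hg
  generalize EuclideanDomain.gcd p d = g at *
  generalize EuclideanDomain.gcdA p d = x at *
  generalize EuclideanDomain.gcdB p d = y at *
  linear_combination -hb - x * hA - y * hB

/-- After division by the gcd of d and m, the square of what is left of d divides F, so it is a
unit. -/
lemma dvd_of_sq_dvd_squarefree_mul_sq {F d m : K[X]} (hF : Squarefree F)
    (h : d ^ 2 ∣ F * m ^ 2) : d ∣ m := by
  by_cases hd : d = 0
  · subst hd
    have : F * m ^ 2 = 0 := by simpa using h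
    rcases mul_eq_zero.mp this with h0 | h0
    · exact absurd h0 hF.ne_zero
    · simp [pow_eq_zero_iff] at h0; simp [h0]
  obtain ⟨g, m', d', hg, hc, hm', hd'⟩ := exists_coprime_mul (p := m) hd
  have h1 : d' ^ 2 ∣ F * m' ^ 2 := by
    have : g ^ 2 * d' ^ 2 ∣ g ^ 2 * (F * m' ^ 2) := by
      rw [hd', hm'] at h; convert h using 1 <;> ring
    exact (mul_dvd_mul_iff_left (pow_ne_zero 2 hg)).mp this
  have h2 : d' ^ 2 ∣ F := (hc.symm.pow (m := 2) (n := 2)).dvd_of_dvd_mul_right h1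
  have h3 : IsUnit d' := hF d' (by rwa [← sq])
  rw [hd', hm']
  exact mul_dvd_mul_left g h3.dvd

section

variable {a b c d : K} {A B F w : K[X]}

/-- Let Q = B G be the quartic form and H its value at (A, B). As w² divides H, w divides H and H'.
Euler's relation for Q gives Q_A W = B H' − 4B' H and Q_B W = 4A' H − A H', with W the Wronskian.
The partial derivatives Q_A and Q_B are coprime because Q has no repeated factor, so w divides W. -/
lemma dvd_wronskian_of_mul_sq_eq [CharZero K] (ha : a ≠ 0)
    (hD : b ^ 2 * c ^ 2 - 4 * a * c ^ 3 - 4 * b ^ 3 * d - 27 * a ^ 2 * d ^ 2 + 18 * a * b * c * d ≠ 0)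
    (hAB : IsCoprime A B) (h : F * w ^ 2 = B * cubicForm a b c d A B) :
    w ∣ wronskian B A := by
  set G := cubicForm a b c d A B with hG
  set GA := 3 * C a * A ^ 2 + 2 * C b * A * B + C c * B ^ 2 with hGA
  have hBG : IsCoprime B G := by
    have h1 : IsCoprime B (C a * A ^ 3) := by
      exact (isCoprime_mul_unit_left_right (isUnit_C.mpr ha.isUnit) _ _).mpr hAB.symm.pow_right
    have : G = C a * A ^ 3 + B * (C b * A ^ 2 + C c * A * B + C d * B ^ 2) := by
      simp only [hG, cubicForm]; ring
    rw [this]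
    exact h1.add_mul_left_right _
  have hGAG : IsCoprime GA G := by
    obtain ⟨s, t, hst⟩ := hBG.pow_left (m := 4)
    have hbz := cubic_discr_bezout (C a) (C b) (C c) (C d) A B
    set D := b ^ 2 * c ^ 2 - 4 * a * c ^ 3 - 4 * b ^ 3 * d - 27 * a ^ 2 * d ^ 2 +
      18 * a * b * c * d with hDdef
    have hCD : C D = (C b : K[X]) ^ 2 * C c ^ 2 - 4 * C a * C c ^ 3 - 4 * C b ^ 3 * C d -
        27 * C a ^ 2 * C d ^ 2 + 18 * C a * C b * C c * C d := by
      simp [hDdef, map_ofNat C]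
    have hCDi : (C D⁻¹ : K[X]) * C D = 1 := by rw [← C_mul, inv_mul_cancel₀ hD, C_1]
    rw [← hCD] at hbz
    have hG' : C a * A ^ 3 + C b * A ^ 2 * B + C c * A * B ^ 2 + C d * B ^ 3 = G := rfl
    rw [hG', ← hGA] at hbz
    refine ⟨s * C D⁻¹ * (2 * C a * (C b ^ 2 - 3 * C a * C c) * A ^ 2 + (2 * C b ^ 3 -
      7 * C a * C b * C c + 9 * C a ^ 2 * C d) * A * B +
      (C b ^ 2 * C c - 4 * C a * C c ^ 2 + 3 * C a * C b * C d) * B ^ 2),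
      t + s * C D⁻¹ * (-6 * C a * (C b ^ 2 - 3 * C a * C c) * A + (-4 * C b ^ 3 +
      15 * C a * C b * C c - 27 * C a ^ 2 * C d) * B), ?_⟩
    linear_combination s * C D⁻¹ * hbz + hst + s * B ^ 4 * hCDi
  -- The partial derivatives of the quartic B G; Euler's relation for G puts the second in the form
  -- 4G − A G_A.
  set QA := B * GA with hQA
  set QB := 4 * G - A * GA with hQB
  have h4 : IsUnit (4 : K[X]) := by
    have : (4 : K[X]) = C 4 := (map_ofNat C 4).symm
    rw [this]; exact isUnit_C.mpr (by norm_num)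
  have hco : IsCoprime QA QB := by
    refine IsCoprime.mul_left ?_ ?_
    · have : QB = C a * A ^ 3 + B * (2 * C b * A ^ 2 + 3 * C c * A * B + 4 * C d * B ^ 2) := by
        simp only [hQB, hG, hGA, cubicForm]; ring
      rw [this]
      refine IsCoprime.add_mul_left_right ?_ _
      exact (isCoprime_mul_unit_left_right (isUnit_C.mpr ha.isUnit) _ _).mpr hAB.symm.pow_right
    · have : QB = 4 * G + GA * (-A) := by simp only [hQB]; ring
      rw [this]
      refine IsCoprime.add_mul_left_right ?_ _
      exact (isCoprime_mul_unit_left_right h4 _ _).mpr hGAG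
  set H := B * G with hH
  have hwH : w ∣ H := ⟨F * w, by rw [← h]; ring⟩
  have hwH' : w ∣ derivative H := by
    rw [← h]
    simp only [derivative_mul, derivative_pow]
    refine ⟨derivative F * w + F * (C (2 : K) * derivative w), ?_⟩
    simp; ring
  have hder : derivative H = QA * derivative A + QB * derivative B := by
    simp only [hH, hQA, hQB, hG, hGA, cubicForm, derivative_mul, derivative_add, derivative_pow,
      derivative_C]
    simp [map_ofNat C]
    ring
  have h1 : w ∣ QA * wronskian B A := by
    have : QA * wronskian B A = B * derivative H - 4 * derivative B * H := by
      rw [hder]; simp only [wronskian, hH, hQA, hQB]; ring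
    rw [this]
    exact dvd_sub (hwH'.mul_left _) (hwH.mul_left _)
  have h2 : w ∣ QB * wronskian B A := by
    have : QB * wronskian B A = 4 * derivative A * H - A * derivative H := by
      rw [hder]; simp only [wronskian, hH, hQA, hQB]; ring
    rw [this]
    exact dvd_sub (hwH.mul_left _) (hwH'.mul_left _)
  obtain ⟨s, t, hst⟩ := hco
  have : wronskian B A = s * (QA * wronskian B A) + t * (QB * wronskian B A) := by
    linear_combination -wronskian B A * hst
  rw [this]
  exact dvd_add (h1.mul_left _) (h2.mul_left _)

lemma natDegree_cubicForm_of_lt (ha : a ≠ 0) (hAB : B.natDegree < A.natDegree) :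
    (cubicForm a b c d A B).natDegree = 3 * A.natDegree := by
  have h0 : (C a * A ^ 3).natDegree = 3 * A.natDegree := by
    rw [natDegree_C_mul ha, natDegree_pow]
  have h1 : (C b * A ^ 2 * B).natDegree ≤ 2 * A.natDegree + B.natDegree :=
    natDegree_mul_le.trans (by gcongr; exact (natDegree_C_mul_le _ _).trans natDegree_pow_le)
  have h2 : (C c * A * B ^ 2).natDegree ≤ A.natDegree + 2 * B.natDegree :=
    natDegree_mul_le.trans (by gcongr; exacts [natDegree_C_mul_le _ _, natDegree_pow_le])
  have h3 : (C d * B ^ 3).natDegree ≤ 3 * B.natDegree :=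
    (natDegree_C_mul_le _ _).trans natDegree_pow_le
  rw [cubicForm, add_assoc, add_assoc, natDegree_add_eq_left_of_natDegree_lt, h0]
  rw [h0]
  refine (natDegree_add_le _ _).trans_lt (max_lt (by omega) ?_)
  exact (natDegree_add_le _ _).trans_lt (max_lt (by omega) (by omega))

/-- The quotient of W by w is constant because deg W ≤ deg w: deg w is read off from 3 + 2 deg w =
deg(B G(A, B)), and deg W < deg A + deg B. When A/B is finite at infinity, A is first translated by
a multiple of B, which leaves W unchanged and lowers its degree bound. -/
lemma exists_wronskian_eq_of_mul_sq_eq [CharZero K] (ha : a ≠ 0)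
    (hD : b ^ 2 * c ^ 2 - 4 * a * c ^ 3 - 4 * b ^ 3 * d - 27 * a ^ 2 * d ^ 2 + 18 * a * b * c * d ≠ 0)
    (hAB : IsCoprime A B) (hF : F.natDegree = 3) (hw : w ≠ 0) (hB : B ≠ 0)
    (h : F * w ^ 2 = B * cubicForm a b c d A B) :
    ∃ β : K, wronskian B A = C β * w := by
  obtain ⟨q, hq⟩ := dvd_wronskian_of_mul_sq_eq ha hD hAB h
  by_cases hW : wronskian B A = 0
  · exact ⟨0, by simp [hW]⟩
  have hF0 : F ≠ 0 := by rintro rfl; simp at hF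
  have hdeg : (B * cubicForm a b c d A B).natDegree = 3 + 2 * w.natDegree := by
    rw [← h, natDegree_mul hF0 (pow_ne_zero 2 hw), natDegree_pow, hF]
  have hH0 : B * cubicForm a b c d A B ≠ 0 := by rw [← h]; exact mul_ne_zero hF0 (pow_ne_zero 2 hw)
  have hG0 := right_ne_zero_of_mul hH0
  rw [natDegree_mul hB hG0] at hdeg
  have hq0 : q ≠ 0 := by rintro rfl; simp at hq; exact hW hq
  have hWdeg : (wronskian B A).natDegree = w.natDegree + q.natDegree := by
    rw [hq, natDegree_mul hw hq0]
  suffices hle : 2 * (wronskian B A).natDegree ≤ 2 * w.natDegree by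
    have : q.natDegree = 0 := by omega
    rw [natDegree_eq_zero] at this
    obtain ⟨β, rfl⟩ := this
    exact ⟨β, by rw [hq, mul_comm]⟩
  rcases lt_or_ge B.natDegree A.natDegree with hlt | hge
  · rw [natDegree_cubicForm_of_lt ha hlt] at hdeg
    have := natDegree_wronskian_lt_add hW
    omega
  · have hn : 0 < B.natDegree := by
      have := natDegree_wronskian_lt_add hW
      omega
    -- The value of A/B at x = ∞.
    set e := A.coeff B.natDegree / B.leadingCoeff with he
    set A₁ := A - C e * B with hA₁
    have hlB : B.leadingCoeff ≠ 0 := leadingCoeff_ne_zero.mpr hB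
    have hA₁deg : A₁.natDegree < B.natDegree := by
      have hle : A₁.natDegree ≤ B.natDegree :=
        (natDegree_sub_le _ _).trans (max_le hge (natDegree_C_mul_le _ _))
      refine lt_of_le_of_ne hle fun h0 => ?_
      have hc : A₁.coeff B.natDegree = 0 := by
        rw [hA₁, coeff_sub, coeff_C_mul, coeff_natDegree, he, div_mul_cancel₀ _ hlB, sub_self]
      rw [← h0, coeff_natDegree, leadingCoeff_eq_zero] at hc
      rw [hc] at h0
      simp at h0
      omega
    have hW₁ : wronskian B A₁ = wronskian B A := by
      simp only [wronskian, hA₁, derivative_sub, derivative_mul, derivative_C]; ring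
    have hform : cubicForm a b c d A B = cubicForm (a * e ^ 3 + b * e ^ 2 + c * e + d)
        (3 * a * e ^ 2 + 2 * b * e + c) (3 * a * e + b) a B A₁ := by
      have : A = A₁ + C e * B := by rw [hA₁]; ring
      simp only [cubicForm]
      rw [this]
      simp only [C_add, C_mul, C_pow]
      have h3 : (C (3 : K) : K[X]) = 3 := map_ofNat C 3
      have h2 : (C (2 : K) : K[X]) = 2 := map_ofNat C 2
      rw [h3, h2]
      ring
    by_cases hd1 : a * e ^ 3 + b * e ^ 2 + c * e + d = 0
    -- A root e of the cubic is simple because the discriminant is non-zero.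
    · have hc1 : 3 * a * e ^ 2 + 2 * b * e + c ≠ 0 := by
        intro hc1
        apply hD
        have := cubic_discr_bezout a b c d e 1
        simp only [mul_one, one_pow] at this
        rw [← this, hd1, hc1]; ring
      have hA₁0 : A₁ ≠ 0 := by
        intro h0
        rw [← hW₁, h0] at hW
        simp at hW
      have hdeg2 : (cubicForm a b c d A B).natDegree = A₁.natDegree + 2 * B.natDegree := by
        rw [hform, hd1, cubicForm, C_0, zero_mul, zero_add, add_assoc]
        have h0 : (C (3 * a * e ^ 2 + 2 * b * e + c) * B ^ 2 * A₁).natDegree =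
            A₁.natDegree + 2 * B.natDegree := by
          rw [mul_assoc, natDegree_C_mul hc1, natDegree_mul (pow_ne_zero 2 hB) hA₁0, natDegree_pow]
          ring
        have h1 : (C (3 * a * e + b) * B * A₁ ^ 2).natDegree ≤ B.natDegree + 2 * A₁.natDegree :=
          natDegree_mul_le.trans (by gcongr; exacts [natDegree_C_mul_le _ _, natDegree_pow_le])
        have h2 : (C a * A₁ ^ 3).natDegree ≤ 3 * A₁.natDegree :=
          (natDegree_C_mul_le _ _).trans natDegree_pow_le
        rw [natDegree_add_eq_left_of_natDegree_lt, h0]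
        rw [h0]
        exact (natDegree_add_le _ _).trans_lt (max_lt (by omega) (by omega))
      have := natDegree_wronskian_lt_add (hW₁ ▸ hW : wronskian B A₁ ≠ 0)
      rw [hW₁] at this
      omega
    -- If e is not a root, deg(B G) = 4 deg B is even, whereas 3 + 2 deg w is odd.
    · rw [hform, natDegree_cubicForm_of_lt hd1 hA₁deg] at hdeg
      omega

end

end Polynomial

/-! ### The function field in terms of x and η, and values of functions at points. -/

noncomputable section

namespace WeierstrassCurve

variable {K : Type*} [Field K]

/-- The function `η = 2 y + a₁x + a₃` on `E`, which is odd and satisfies `η² = 4 x³ + b₂x² + 2 b₄x + b₆`. -/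
def etaFun (E : WeierstrassCurve K) : E.RatFun :=
  2 * E.yFun + algebraMap K E.RatFun E.a₁ * E.xFun + algebraMap K E.RatFun E.a₃

/-- The value of `η = 2 y + a₁x + a₃` at `(x, y)`. -/
def etaAt {L : Type*} [Field L] [Algebra K L] (E : WeierstrassCurve K) (x y : L) : L :=
  2 * y + algebraMap K L E.a₁ * x + algebraMap K L E.a₃

lemma ofPoly_add (E : WeierstrassCurve K) (u v : K[X][Y]) :
    E.ofPoly (u + v) = E.ofPoly u + E.ofPoly v := by simp [ofPoly]

lemma ofPoly_mul (E : WeierstrassCurve K) (u v : K[X][Y]) :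
    E.ofPoly (u * v) = E.ofPoly u * E.ofPoly v := by simp [ofPoly]

lemma ofPoly_C_C (E : WeierstrassCurve K) (c : K) :
    E.ofPoly (C (C c)) = algebraMap K E.RatFun c := by
  rw [IsScalarTower.algebraMap_apply K E.toAffine.CoordinateRing E.RatFun]
  rfl

/-- The map `q ↦ ofPoly q` as a homomorphism. -/
def ofPolyHom (E : WeierstrassCurve K) : K[X][Y] →ₐ[K] E.RatFun where
  toFun := E.ofPoly
  map_one' := by simp [ofPoly]
  map_mul' := E.ofPoly_mul
  map_zero' := by simp [ofPoly]
  map_add' := E.ofPoly_add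
  commutes' c := E.ofPoly_C_C c

lemma ofPoly_C (E : WeierstrassCurve K) (p : K[X]) : E.ofPoly (C p) = aeval E.xFun p := by
  have : E.ofPolyHom.comp (CAlgHom : K[X] →ₐ[K] K[X][Y]) = aeval E.xFun := by
    ext
    simp [xFun, ofPolyHom]
  exact congrArg (fun f => f p) this

lemma ofPoly_ψ₂ (E : WeierstrassCurve K) : E.ofPoly E.ψ₂ = E.etaFun := by
  rw [ψ₂, Affine.polynomialY, ofPoly_add, ofPoly_mul, ofPoly_C, ofPoly_C, etaFun, yFun]
  simp [add_assoc, map_ofNat]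

lemma etaFun_sq (E : WeierstrassCurve K) : E.etaFun ^ 2 = aeval E.xFun E.Ψ₂Sq := by
  rw [← ofPoly_ψ₂, ← ofPoly_C, ofPoly, ofPoly, ← map_pow, Affine.CoordinateRing.mk_ψ₂_sq]

lemma ofPoly_injOn (E : WeierstrassCurve K) {u v : K[X][Y]} (h : E.ofPoly u = E.ofPoly v) :
    E.toAffine.polynomial ∣ u - v := by
  have := IsFractionRing.injective E.toAffine.CoordinateRing E.RatFun h
  exact AdjoinRoot.mk_eq_mk.mp this

section Basis

variable [NeZero (2 : K)]

lemma yFun_eq (E : WeierstrassCurve K) : E.yFun = algebraMap K E.RatFun 2⁻¹ *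
    (E.etaFun - algebraMap K E.RatFun E.a₁ * E.xFun - algebraMap K E.RatFun E.a₃) := by
  have h : algebraMap K E.RatFun 2⁻¹ * 2 = 1 := by
    rw [← map_ofNat (algebraMap K E.RatFun) 2, ← map_mul, inv_mul_cancel₀ two_ne_zero, map_one]
  rw [etaFun]
  linear_combination -E.yFun * h

/-- Since 2 is invertible, 1 and η are as independent over K[x] as the basis 1, y of the coordinate
ring. -/
lemma eq_zero_of_aeval_add_mul_etaFun (E : WeierstrassCurve K) {p q : K[X]}
    (h : aeval E.xFun p + aeval E.xFun q * E.etaFun = 0) : p = 0 ∧ q = 0 := by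
  have h1 : E.ofPoly (C (p + q * (C E.a₁ * X + C E.a₃)) + C (C 2 * q) * Y) = 0 := by
    rw [ofPoly_add, ofPoly_mul, ofPoly_C, ofPoly_C, ← h, etaFun, yFun]
    simp [map_ofNat]
    ring
  have h2 : Affine.CoordinateRing.mk E.toAffine
      (C (p + q * (C E.a₁ * X + C E.a₃)) + C (C 2 * q) * Y) = 0 :=
    IsFractionRing.injective E.toAffine.CoordinateRing E.RatFun (by rw [map_zero]; exact h1)
  obtain ⟨h3, h4⟩ := Affine.CoordinateRing.smul_basis_eq_zero
    (p := p + q * (C E.a₁ * X + C E.a₃)) (q := C 2 * q) (W' := E.toAffine) (by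
      rw [Affine.CoordinateRing.smul, Affine.CoordinateRing.smul, ← h2, mul_one,
        ← map_mul, ← map_add])
  have hq : q = 0 := by
    rcases mul_eq_zero.mp h4 with h5 | h5
    · exact absurd (C_eq_zero.mp h5) two_ne_zero
    · exact h5
  subst hq
  simpa using h3

lemma aeval_xFun_injective (E : WeierstrassCurve K) :
    Function.Injective (aeval E.xFun : K[X] →ₐ[K] E.RatFun) := by
  rw [injective_iff_map_eq_zero]
  intro p hp
  exact (E.eq_zero_of_aeval_add_mul_etaFun (p := p) (q := 0) (by simpa using hp)).1

lemma aeval_xFun_ne_zero (E : WeierstrassCurve K) {p : K[X]} (hp : p ≠ 0) :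
    aeval E.xFun p ≠ 0 :=
  (map_ne_zero_iff _ E.aeval_xFun_injective).mpr hp

lemma exists_ofPoly_eq (E : WeierstrassCurve K) (u : E.toAffine.CoordinateRing) :
    ∃ p q : K[X], algebraMap _ E.RatFun u = aeval E.xFun p + aeval E.xFun q * E.etaFun := by
  obtain ⟨p, q, rfl⟩ := Affine.CoordinateRing.exists_smul_basis_eq u
  refine ⟨p - C 2⁻¹ * q * (C E.a₁ * X + C E.a₃), C 2⁻¹ * q, ?_⟩
  have h : algebraMap _ E.RatFun (p • (1 : E.toAffine.CoordinateRing) +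
      q • Affine.CoordinateRing.mk E.toAffine Y) =
      aeval E.xFun p + aeval E.xFun q * E.yFun := by
    rw [Affine.CoordinateRing.smul, Affine.CoordinateRing.smul, ← ofPoly_C, ← ofPoly_C]
    simp [ofPoly, yFun]
  rw [h, yFun_eq]
  simp only [map_sub, map_mul, map_add, aeval_C, aeval_X]
  ring

/-- Every rational function on `E` is of the form `(p(x) + q(x) η) / d(x)`. -/
lemma exists_mul_aeval_eq (E : WeierstrassCurve K) (f : E.RatFun) :
    ∃ p q d : K[X], d ≠ 0 ∧
      f * aeval E.xFun d = aeval E.xFun p + aeval E.xFun q * E.etaFun := by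
  obtain ⟨u, v, hv, rfl⟩ := IsFractionRing.div_surjective (A := E.toAffine.CoordinateRing) f
  have hv0 : algebraMap _ E.RatFun v ≠ 0 := by
    simpa using nonZeroDivisors.ne_zero hv
  obtain ⟨p, q, hp⟩ := E.exists_ofPoly_eq u
  obtain ⟨r, s, hr⟩ := E.exists_ofPoly_eq v
  rw [hr] at hv0
  -- The fraction (p + qη)/(r + sη) is expanded by the conjugate r − sη; the new denominator is the
  -- norm.
  refine ⟨p * r - q * s * E.Ψ₂Sq, q * r - p * s, r ^ 2 - s ^ 2 * E.Ψ₂Sq, ?_, ?_⟩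
  · intro h0
    have h1 : (aeval E.xFun r + aeval E.xFun s * E.etaFun) *
        (aeval E.xFun r + aeval E.xFun (-s) * E.etaFun) = 0 := by
      have := congrArg (aeval E.xFun) h0
      simp only [map_sub, map_mul, map_pow, ← etaFun_sq, map_zero] at this
      rw [← this, map_neg]; ring
    have h2 := E.eq_zero_of_aeval_add_mul_etaFun ((mul_eq_zero.mp h1).resolve_left hv0)
    apply hv0
    have hs : s = 0 := neg_eq_zero.mp h2.2
    rw [h2.1, hs]
    simp
  · rw [hp, hr]
    simp only [map_sub, map_mul, map_pow, ← etaFun_sq]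
    rw [div_mul_eq_mul_div, div_eq_iff hv0]
    ring

end Basis

section Values

variable {L : Type*} [Field L] [Algebra K L]

lemma aevalAeval_polynomial (E : WeierstrassCurve K) (x y : L) :
    aevalAeval x y E.toAffine.polynomial = y ^ 2 + algebraMap K L E.a₁ * x * y +
      algebraMap K L E.a₃ * y - (x ^ 3 + algebraMap K L E.a₂ * x ^ 2 + algebraMap K L E.a₄ * x +
      algebraMap K L E.a₆) := by
  rw [Affine.polynomial]
  simp only [map_add, map_sub, map_mul, map_pow, aevalAeval_C, aevalAeval_Y, aeval_X, aeval_C]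
  ring

lemma aevalAeval_ψ₂ (E : WeierstrassCurve K) (x y : L) :
    aevalAeval x y E.ψ₂ = E.etaAt x y := by
  rw [ψ₂, Affine.polynomialY, etaAt]
  simp only [map_add, map_mul, aevalAeval_C, aevalAeval_Y, aeval_X, aeval_C, map_ofNat]
  ring

lemma baseChange_equation_iff (E : WeierstrassCurve K) (x y : L) :
    (Affine.baseChange E.toAffine L).Equation x y ↔
      aevalAeval x y E.toAffine.polynomial = 0 := by
  rw [Affine.equation_iff', aevalAeval_polynomial]
  rfl

lemma baseChange_equation_iff_etaAt_sq [NeZero (2 : L)] (E : WeierstrassCurve K) (x y : L) :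
    (Affine.baseChange E.toAffine L).Equation x y ↔ E.etaAt x y ^ 2 = aeval x E.Ψ₂Sq := by
  have h4 : (4 : L) ≠ 0 := by
    have : (4 : L) = 2 * 2 := by norm_num
    rw [this]; exact mul_ne_zero two_ne_zero two_ne_zero
  rw [baseChange_equation_iff]
  have h := congrArg (aevalAeval x y) (C_Ψ₂Sq E)
  rw [aevalAeval_C, map_sub, map_pow, aevalAeval_ψ₂, map_mul, map_ofNat] at h
  rw [h]
  constructor
  · intro h0; rw [h0]; ring
  · intro h0
    have : 4 * aevalAeval x y E.toAffine.polynomial = 0 := by linear_combination h0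
    exact (mul_eq_zero.mp this).resolve_left h4

lemma aevalAeval_eq_of_ofPoly_eq (E : WeierstrassCurve K) {x y : L}
    (h : (Affine.baseChange E.toAffine L).Equation x y) {u v : K[X][Y]}
    (huv : E.ofPoly u = E.ofPoly v) : aevalAeval x y u = aevalAeval x y v := by
  obtain ⟨q, hq⟩ := E.ofPoly_injOn huv
  rw [← sub_eq_zero, ← map_sub, hq, map_mul, (E.baseChange_equation_iff x y).mp h, zero_mul]

lemma ofPoly_C_add_C_mul_ψ₂ (E : WeierstrassCurve K) (p q : K[X]) :
    E.ofPoly (C p + C q * E.ψ₂) = aeval E.xFun p + aeval E.xFun q * E.etaFun := by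
  rw [ofPoly_add, ofPoly_mul, ofPoly_C, ofPoly_C, ofPoly_ψ₂]

lemma hasValueAt_of_mul_aeval_eq (E : WeierstrassCurve K) {f : E.RatFun} {p q d : K[X]}
    (hf : f * aeval E.xFun d = aeval E.xFun p + aeval E.xFun q * E.etaFun) {x y c : L}
    (hd : aeval x d ≠ 0) (hc : c * aeval x d = aeval x p + aeval x q * E.etaAt x y) :
    E.HasValueAt f x y c := by
  refine ⟨C p + C q * E.ψ₂, C d, ?_, ?_, ?_⟩
  · rwa [aevalAeval_C]
  · rw [ofPoly_C_add_C_mul_ψ₂, ofPoly_C, hf]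
  · rw [map_add, map_mul, aevalAeval_C, aevalAeval_C, aevalAeval_C, aevalAeval_ψ₂, hc]

/-- Cross-multiplication of the two representations of f. No condition d(x) ≠ 0 is needed, so the
relation can be used to show that a denominator in lowest terms does not vanish where f is regular.
-/
lemma HasValueAt.mul_aeval_eq {E : WeierstrassCurve K} {f : E.RatFun} {x y c : L}
    (h : E.HasValueAt f x y c) (hE : (Affine.baseChange E.toAffine L).Equation x y) {p q d : K[X]}
    (hf : f * aeval E.xFun d = aeval E.xFun p + aeval E.xFun q * E.etaFun) :
    c * aeval x d = aeval x p + aeval x q * E.etaAt x y := by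
  obtain ⟨u, v, hv, huv, hu⟩ := h
  have h1 : E.ofPoly ((C p + C q * E.ψ₂) * v) = E.ofPoly (u * C d) := by
    rw [ofPoly_mul, ofPoly_mul, ofPoly_C_add_C_mul_ψ₂, ofPoly_C, ← hf, ← huv]; ring
  have h2 := E.aevalAeval_eq_of_ofPoly_eq hE h1
  rw [map_mul, map_mul, map_add, map_mul, aevalAeval_C, aevalAeval_C, aevalAeval_C,
    aevalAeval_ψ₂, hu] at h2
  apply mul_right_cancel₀ hv
  linear_combination -h2

end Values

end WeierstrassCurve

end

/-! ### Calculus of values, separability of Ψ₂, and points in the coordinates x and η. -/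

noncomputable section

namespace WeierstrassCurve

variable {K : Type*} [Field K]

section HasValueAt

variable {L : Type*} [Field L] [Algebra K L] {E : WeierstrassCurve K} {f g : E.RatFun} {x y c e : L}

lemma hasValueAt_algebraMap (E : WeierstrassCurve K) (x y : L) (k : K) :
    E.HasValueAt (algebraMap K E.RatFun k) x y (algebraMap K L k) := by
  refine ⟨C (C k), 1, by simp, ?_, by simp⟩
  rw [ofPoly_C_C]
  simp [ofPoly]

lemma HasValueAt.add (hf : E.HasValueAt f x y c) (hg : E.HasValueAt g x y e) :
    E.HasValueAt (f + g) x y (c + e) := by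
  obtain ⟨u, v, hv, huv, hu⟩ := hf
  obtain ⟨s, t, ht, hst, hs⟩ := hg
  refine ⟨u * t + s * v, v * t, ?_, ?_, ?_⟩
  · rw [map_mul]; exact mul_ne_zero hv ht
  · simp only [ofPoly_mul, ofPoly_add]
    linear_combination E.ofPoly t * huv + E.ofPoly v * hst
  · simp only [map_mul, map_add, hu, hs]; ring

lemma HasValueAt.mul (hf : E.HasValueAt f x y c) (hg : E.HasValueAt g x y e) :
    E.HasValueAt (f * g) x y (c * e) := by
  obtain ⟨u, v, hv, huv, hu⟩ := hf
  obtain ⟨s, t, ht, hst, hs⟩ := hg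
  refine ⟨u * s, v * t, ?_, ?_, ?_⟩
  · rw [map_mul]; exact mul_ne_zero hv ht
  · simp only [ofPoly_mul]
    rw [← huv, ← hst]; ring
  · simp only [map_mul, hu, hs]; ring

lemma HasValueAt.aeval (hf : E.HasValueAt f x y c) (p : K[X]) :
    E.HasValueAt (Polynomial.aeval f p) x y (Polynomial.aeval c p) := by
  induction p using Polynomial.induction_on' with
  | add p q hp hq => simpa using hp.add hq
  | monomial n k =>
    simp only [aeval_monomial]
    refine (E.hasValueAt_algebraMap x y k).mul ?_
    induction n with
    | zero => simpa using E.hasValueAt_algebraMap x y 1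
    | succ n ih => simpa [pow_succ] using ih.mul hf

lemma HasValueAt.unique (hE : (Affine.baseChange E.toAffine L).Equation x y)
    (hf : E.HasValueAt f x y c) (hg : E.HasValueAt f x y e) : c = e := by
  obtain ⟨u, v, hv, huv, hu⟩ := hf
  obtain ⟨s, t, ht, hst, hs⟩ := hg
  have h1 : E.ofPoly (u * t) = E.ofPoly (s * v) := by
    rw [ofPoly_mul, ofPoly_mul, ← huv, ← hst]; ring
  have h2 := E.aevalAeval_eq_of_ofPoly_eq hE h1
  rw [map_mul, map_mul, hu, hs] at h2
  apply mul_right_cancel₀ (mul_ne_zero hv ht)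
  linear_combination h2

end HasValueAt

lemma Ψ₂Sq_discr_ne_zero [NeZero (2 : K)] (E : WeierstrassCurve K) [E.IsElliptic] :
    E.b₂ ^ 2 * (2 * E.b₄) ^ 2 - 4 * 4 * (2 * E.b₄) ^ 3 - 4 * E.b₂ ^ 3 * E.b₆ -
      27 * 4 ^ 2 * E.b₆ ^ 2 + 18 * 4 * E.b₂ * (2 * E.b₄) * E.b₆ ≠ 0 :=
  E.twoTorsionPolynomial_discr_ne_zero_of_isElliptic (isUnit_iff_ne_zero.mpr two_ne_zero)

/-- The identity `cubic_discr_bezout` at A = X, B = 1 is a Bézout relation between Ψ₂ and its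
derivative. -/
lemma Ψ₂Sq_separable [NeZero (2 : K)] (E : WeierstrassCurve K) [E.IsElliptic] :
    E.Ψ₂Sq.Separable := by
  have h := E.Ψ₂Sq_discr_ne_zero
  set D := E.b₂ ^ 2 * (2 * E.b₄) ^ 2 - 4 * 4 * (2 * E.b₄) ^ 3 - 4 * E.b₂ ^ 3 * E.b₆ -
      27 * 4 ^ 2 * E.b₆ ^ 2 + 18 * 4 * E.b₂ * (2 * E.b₄) * E.b₆ with hD
  have hz := cubic_discr_bezout (C (4 : K)) (C E.b₂) (C (2 * E.b₄)) (C E.b₆) X 1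
  have hd : derivative E.Ψ₂Sq = 3 * C 4 * X ^ 2 + 2 * C E.b₂ * X * 1 + C (2 * E.b₄) * 1 ^ 2 := by
    simp only [Ψ₂Sq, derivative_add, derivative_mul, derivative_C, derivative_X_pow, derivative_X]
    simp [map_ofNat C]; ring
  have hs : E.Ψ₂Sq = C (4 : K) * X ^ 3 + C E.b₂ * X ^ 2 * 1 + C (2 * E.b₄) * X * 1 ^ 2 +
      C E.b₆ * 1 ^ 3 := by simp [Ψ₂Sq]
  have hCD : C D = C E.b₂ ^ 2 * C (2 * E.b₄) ^ 2 - 4 * C (4 : K) * C (2 * E.b₄) ^ 3 -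
      4 * C E.b₂ ^ 3 * C E.b₆ - 27 * C (4 : K) ^ 2 * C E.b₆ ^ 2 +
      18 * C (4 : K) * C E.b₂ * C (2 * E.b₄) * C E.b₆ := by
    simp [hD, map_ofNat C]
  rw [← hd, ← hs, ← hCD] at hz
  have hCDi : (C D⁻¹ : K[X]) * C D = 1 := by rw [← C_mul, inv_mul_cancel₀ h, C_1]
  refine ⟨C D⁻¹ * (-6 * C 4 * (C E.b₂ ^ 2 - 3 * C 4 * C (2 * E.b₄)) * X +
      (-4 * C E.b₂ ^ 3 + 15 * C 4 * C E.b₂ * C (2 * E.b₄) - 27 * C 4 ^ 2 * C E.b₆) * 1),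
    C D⁻¹ * (2 * C 4 * (C E.b₂ ^ 2 - 3 * C 4 * C (2 * E.b₄)) * X ^ 2 +
      (2 * C E.b₂ ^ 3 - 7 * C 4 * C E.b₂ * C (2 * E.b₄) + 9 * C 4 ^ 2 * C E.b₆) * X * 1 +
      (C E.b₂ ^ 2 * C (2 * E.b₄) - 4 * C 4 * C (2 * E.b₄) ^ 2 + 3 * C 4 * C E.b₂ * C E.b₆) * 1 ^ 2),
    ?_⟩
  linear_combination C D⁻¹ * hz + hCDi

lemma natDegree_Ψ₂Sq' [NeZero (2 : K)] (E : WeierstrassCurve K) : E.Ψ₂Sq.natDegree = 3 := by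
  have h4 : (4 : K) ≠ 0 := by
    have : (4 : K) = 2 * 2 := by norm_num
    rw [this]; exact mul_ne_zero two_ne_zero two_ne_zero
  exact natDegree_cubic h4

lemma Ψ₂Sq_ne_zero' [NeZero (2 : K)] (E : WeierstrassCurve K) : E.Ψ₂Sq ≠ 0 := by
  intro h
  have := E.natDegree_Ψ₂Sq'
  simp [h] at this

lemma aeval_Ψ₂Sq {A : Type*} [CommRing A] [Algebra K A] (E : WeierstrassCurve K) (t : A) :
    aeval t E.Ψ₂Sq = 4 * t ^ 3 + algebraMap K A E.b₂ * t ^ 2 +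
      algebraMap K A (2 * E.b₄) * t + algebraMap K A E.b₆ := by
  simp only [Ψ₂Sq, map_add, map_mul, aeval_C, aeval_X, map_pow, map_ofNat]

/-- The homogenisation `4 A³ + b₂A²B + 2 b₄AB² + b₆B³` of the polynomial `4 x³ + b₂x² + 2 b₄x + b₆`. -/
def Ψ₂Form (E : WeierstrassCurve K) (A B : K[X]) : K[X] :=
  cubicForm 4 E.b₂ (2 * E.b₄) E.b₆ A B

lemma aeval_Ψ₂Form {R : Type*} [CommRing R] [Algebra K R] (E : WeierstrassCurve K) (A B : K[X])
    (x t : R) (h : t * aeval x B = aeval x A) :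
    aeval x (E.Ψ₂Form A B) = aeval x B ^ 3 * aeval t E.Ψ₂Sq := by
  simp only [Ψ₂Form, cubicForm, map_add, map_mul, map_pow, aeval_C, aeval_Ψ₂Sq, ← h, map_ofNat]
  ring

end WeierstrassCurve

lemma Polynomial.eq_zero_of_forall_aeval_complex {K : Type*} [Field K] [Algebra K ℂ] {p : K[X]}
    (h : ∀ x : ℂ, aeval x p = 0) : p = 0 := by
  have : p.map (algebraMap K ℂ) = 0 := Polynomial.funext fun x => by
    rw [eval_map_algebraMap, h, eval_zero]
  exact (Polynomial.map_eq_zero _).mp this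

namespace WeierstrassCurve

variable {K : Type*} [Field K]

section Points

variable (E : WeierstrassCurve K)

lemma etaAt_negY {L : Type*} [Field L] [Algebra K L] (x y : L) :
    E.etaAt x ((Affine.baseChange E.toAffine L).negY x y) = -E.etaAt x y := by
  have h1 : (Affine.baseChange E.toAffine L).a₁ = algebraMap K L E.a₁ := rfl
  have h3 : (Affine.baseChange E.toAffine L).a₃ = algebraMap K L E.a₃ := rfl
  rw [etaAt, etaAt, Affine.negY, h1, h3]; ring

/-- The `y`-coordinate of the point with given `x` and `η = 2 y + a₁x + a₃`. -/
def yOfEta {L : Type*} [Field L] [Algebra K L] (x e : L) : L :=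
  (e - algebraMap K L E.a₁ * x - algebraMap K L E.a₃) / 2

variable {L : Type*} [Field L] [Algebra K L] [NeZero (2 : L)]

lemma etaAt_yOfEta (x e : L) : E.etaAt x (E.yOfEta x e) = e := by
  rw [etaAt, yOfEta, mul_div_cancel₀ _ two_ne_zero]; ring

lemma yOfEta_etaAt (x y : L) : E.yOfEta x (E.etaAt x y) = y := by
  rw [etaAt, yOfEta, div_eq_iff two_ne_zero]; ring

lemma etaAt_injective (x : L) : Function.Injective (E.etaAt x) :=
  Function.LeftInverse.injective (g := E.yOfEta x) fun y => E.yOfEta_etaAt x y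

lemma nonsingular_iff_etaAt_sq [E.IsElliptic] (x y : L) :
    (Affine.baseChange E.toAffine L).Nonsingular x y ↔ E.etaAt x y ^ 2 = aeval x E.Ψ₂Sq := by
  rw [← baseChange_equation_iff_etaAt_sq]
  have : (Affine.baseChange E.toAffine L).IsElliptic :=
    inferInstanceAs (E.map (algebraMap K L)).IsElliptic
  exact Affine.equation_iff_nonsingular.symm

lemma nonsingular_yOfEta [E.IsElliptic] {x e : L} (h : e ^ 2 = aeval x E.Ψ₂Sq) :
    (Affine.baseChange E.toAffine L).Nonsingular x (E.yOfEta x e) := by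
  rw [nonsingular_iff_etaAt_sq, etaAt_yOfEta, h]

end Points

variable [Algebra K ℂ]

/-! ### The rational form (A, B, w, β) of an isogeny. -/

namespace Isogeny

variable {E E' : WeierstrassCurve K} (φ : Isogeny E E')

lemma comap_yFun [NeZero (2 : K)] : φ.comap E'.yFun = algebraMap K E.RatFun 2⁻¹ *
    (φ.comap E'.etaFun + algebraMap K E.RatFun (-E'.a₁) * φ.comap E'.xFun +
      algebraMap K E.RatFun (-E'.a₃)) := by
  rw [yFun_eq]
  simp only [map_sub, map_mul, AlgHom.commutes, map_neg]
  ring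

lemma comap_etaFun : φ.comap E'.etaFun =
    algebraMap K E.RatFun 2 * φ.comap E'.yFun + algebraMap K E.RatFun E'.a₁ * φ.comap E'.xFun +
      algebraMap K E.RatFun E'.a₃ := by
  simp [etaFun, map_ofNat]

lemma comap_etaFun_sq : φ.comap E'.etaFun ^ 2 = aeval (φ.comap E'.xFun) E'.Ψ₂Sq := by
  rw [← map_pow, etaFun_sq, aeval_algHom_apply]

variable {φ} in
lemma hasValueAt_of_toHom_eq {x y x' y' : ℂ} {h} {h'}
    (hφ : φ.toHom (.some x y h) = .some x' y' h') :
    E.HasValueAt (φ.comap E'.xFun) x y x' ∧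
      E.HasValueAt (φ.comap E'.etaFun) x y (E'.etaAt x' y') := by
  obtain ⟨h1, h2⟩ := (φ.toHom_eq_some_iff x y h x' y' h').mp hφ
  refine ⟨h1, ?_⟩
  rw [comap_etaFun, etaAt, ← map_ofNat (algebraMap K ℂ) 2]
  exact (((E.hasValueAt_algebraMap x y _).mul h2).add
    ((E.hasValueAt_algebraMap x y _).mul h1)).add (E.hasValueAt_algebraMap x y _)

lemma etaAt_sq_of_hasValueAt {x y c e : ℂ} (h : (Affine.baseChange E.toAffine ℂ).Nonsingular x y)
    (hc : E.HasValueAt (φ.comap E'.xFun) x y c) (he : E.HasValueAt (φ.comap E'.etaFun) x y e) :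
    e ^ 2 = aeval c E'.Ψ₂Sq := by
  have h1 := he.mul he
  rw [← sq, ← sq, comap_etaFun_sq] at h1
  exact HasValueAt.unique h.1 h1 (hc.aeval _)

variable [E'.IsElliptic]

lemma toHom_some_eq [NeZero (2 : K)] {x y c e : ℂ}
    (h : (Affine.baseChange E.toAffine ℂ).Nonsingular x y)
    (hc : E.HasValueAt (φ.comap E'.xFun) x y c) (he : E.HasValueAt (φ.comap E'.etaFun) x y e) :
    φ.toHom (.some x y h) = .some c (E'.yOfEta c e)
      (E'.nonsingular_yOfEta (φ.etaAt_sq_of_hasValueAt h hc he)) := by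
  rw [toHom_eq_some_iff]
  refine ⟨hc, ?_⟩
  rw [comap_yFun]
  have : E'.yOfEta c e = algebraMap K ℂ 2⁻¹ * (e + algebraMap K ℂ (-E'.a₁) * c +
      algebraMap K ℂ (-E'.a₃)) := by
    rw [yOfEta, map_inv₀, map_ofNat, map_neg, map_neg]; ring
  rw [this]
  exact (E.hasValueAt_algebraMap x y _).mul ((he.add ((E.hasValueAt_algebraMap x y _).mul hc)).add
    (E.hasValueAt_algebraMap x y _))

/-- The isogeny `φ` in coordinates: `φ^* x = A(x) / B(x)` and `φ^* η = (w(x) / B(x)²) η` in lowest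
terms, where `A'B - AB' = β w`. -/
structure HasRationalForm (φ : Isogeny E E') (A B w : K[X]) (β : K) : Prop where
  coprime : IsCoprime A B
  B_ne_zero : B ≠ 0
  w_ne_zero : w ≠ 0
  β_ne_zero : β ≠ 0
  comap_xFun : φ.comap E'.xFun * aeval E.xFun B = aeval E.xFun A
  comap_etaFun : φ.comap E'.etaFun * aeval E.xFun B ^ 2 = aeval E.xFun w * E.etaFun
  Ψ₂Sq_mul_sq : E.Ψ₂Sq * w ^ 2 = B * E'.Ψ₂Form A B
  wronskian_eq : wronskian B A = C β * w

/-- An isogeny commutes with negation, so that `φ^* x` is even and `φ^* η` is odd. -/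
lemma exists_even_odd [CharZero K] [E.IsElliptic] : ∃ p d q s : K[X], d ≠ 0 ∧ s ≠ 0 ∧
    φ.comap E'.xFun * aeval E.xFun d = aeval E.xFun p ∧
    φ.comap E'.etaFun * aeval E.xFun s = aeval E.xFun q * E.etaFun := by
  obtain ⟨p, q, d, hd, hx⟩ := E.exists_mul_aeval_eq (φ.comap E'.xFun)
  obtain ⟨r, t, s, hs, hη⟩ := E.exists_mul_aeval_eq (φ.comap E'.etaFun)
  -- The images of the two points (x, ±e) are negatives of each other: equal x-coordinates kill the
  -- η-part of φ^*x, opposite η-values kill the even part of φ^*η.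
  have key : ∀ x : ℂ, aeval x d ≠ 0 → aeval x s ≠ 0 →
      aeval x (q * E.Ψ₂Sq) = 0 ∧ aeval x r = 0 := by
    intro x hxd hxs
    obtain ⟨e, he⟩ := IsAlgClosed.exists_pow_nat_eq (aeval x E.Ψ₂Sq) (n := 2) two_pos
    have val : ∀ y : ℂ, ∀ h : (Affine.baseChange E.toAffine ℂ).Nonsingular x y,
        E.HasValueAt (φ.comap E'.xFun) x y ((aeval x p + aeval x q * E.etaAt x y) / aeval x d) ∧
        E.HasValueAt (φ.comap E'.etaFun) x y
          ((aeval x r + aeval x t * E.etaAt x y) / aeval x s) := fun y h =>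
      ⟨E.hasValueAt_of_mul_aeval_eq hx hxd (div_mul_cancel₀ _ hxd),
        E.hasValueAt_of_mul_aeval_eq hη hxs (div_mul_cancel₀ _ hxs)⟩
    have h1 := E.nonsingular_yOfEta he
    have h2 : (Affine.baseChange E.toAffine ℂ).Nonsingular x
        ((Affine.baseChange E.toAffine ℂ).negY x (E.yOfEta x e)) :=
      (Affine.nonsingular_neg _ _).mpr h1
    have e1 := φ.toHom_some_eq h1 (val _ h1).1 (val _ h1).2
    have e2 := φ.toHom_some_eq h2 (val _ h2).1 (val _ h2).2
    have e3 : φ.toHom (.some _ _ h2) = -φ.toHom (.some _ _ h1) := by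
      rw [← map_neg, Affine.Point.neg_some]
    rw [e1, e2, Affine.Point.neg_some, Affine.Point.some.injEq] at e3
    obtain ⟨e4, e5⟩ := e3
    rw [e4] at e5
    have e6 := congrArg (E'.etaAt ((aeval x p + aeval x q * E.etaAt x (E.yOfEta x e)) / aeval x d)) e5
    simp only [etaAt_negY, etaAt_yOfEta] at e4 e6
    rw [div_left_inj' hxd] at e4
    rw [← neg_div, div_left_inj' hxs] at e6
    constructor
    · have h3 : aeval x q * e = 0 := by linear_combination -e4 / 2
      rw [map_mul, ← he, sq, ← mul_assoc, h3, zero_mul]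
    · linear_combination e6 / 2
  have hq : q = 0 := by
    have : q * E.Ψ₂Sq * d * s = 0 := by
      refine eq_zero_of_forall_aeval_complex fun x => ?_
      by_cases h1 : aeval x d = 0
      · simp [h1]
      by_cases h2 : aeval x s = 0
      · simp [h2]
      rw [map_mul, map_mul, (key x h1 h2).1]; simp
    simpa [hd, hs, E.Ψ₂Sq_ne_zero'] using this
  have hr : r = 0 := by
    have : r * d * s = 0 := by
      refine eq_zero_of_forall_aeval_complex fun x => ?_
      by_cases h1 : aeval x d = 0
      · simp [h1]
      by_cases h2 : aeval x s = 0
      · simp [h2]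
      rw [map_mul, map_mul, (key x h1 h2).2]; simp
    simpa [hd, hs] using this
  subst hq hr
  exact ⟨p, d, t, s, hd, hs, by simpa using hx, by simpa using hη⟩

/-- Squaring φ^*η = (q/s)η gives s² B Ψ₂'(A, B) = Ψ₂ (qB²)². As Ψ₂ is squarefree, s divides qB², and
the quotient is w; the Wronskian lemma then supplies β. -/
lemma exists_hasRationalForm [CharZero K] [E.IsElliptic] :
    ∃ (A B w : K[X]) (β : K), φ.HasRationalForm A B w β := by
  obtain ⟨p, d, q, s, hd, hs, hx, hη⟩ := φ.exists_even_odd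
  obtain ⟨g, A, B, hg, hAB, rfl, rfl⟩ := exists_coprime_mul (p := p) hd
  have hB : B ≠ 0 := right_ne_zero_of_mul hd
  have hB' := E.aeval_xFun_ne_zero hB
  have hs' := E.aeval_xFun_ne_zero hs
  have hx' : φ.comap E'.xFun * aeval E.xFun B = aeval E.xFun A := by
    apply mul_left_cancel₀ (E.aeval_xFun_ne_zero hg)
    rw [map_mul, map_mul] at hx
    rw [← hx]; ring
  have h1 : s ^ 2 * (B * E'.Ψ₂Form A B) = E.Ψ₂Sq * (q * B ^ 2) ^ 2 := by
    apply E.aeval_xFun_injective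
    have h2 := E'.aeval_Ψ₂Form A B _ _ hx'
    simp only [map_mul, map_pow]
    rw [h2, ← comap_etaFun_sq, ← etaFun_sq]
    linear_combination (aeval E.xFun B ^ 4 * (φ.comap E'.etaFun * aeval E.xFun s +
      aeval E.xFun q * E.etaFun)) * hη
  obtain ⟨w, hw⟩ := dvd_of_sq_dvd_squarefree_mul_sq E.Ψ₂Sq_separable.squarefree
    (Dvd.intro _ h1)
  have hη0 : φ.comap E'.etaFun ≠ 0 := by
    rw [_root_.map_ne_zero]
    intro h0
    have := (E'.eq_zero_of_aeval_add_mul_etaFun (p := 0) (q := 1) (by simp [h0])).2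
    exact one_ne_zero this
  have hη' : φ.comap E'.etaFun * aeval E.xFun B ^ 2 = aeval E.xFun w * E.etaFun := by
    apply mul_left_cancel₀ hs'
    have := congrArg (aeval E.xFun) hw
    simp only [map_mul, map_pow] at this
    linear_combination aeval E.xFun B ^ 2 * hη + E.etaFun * this
  have hw0 : w ≠ 0 := by
    rintro rfl
    rw [map_zero, zero_mul] at hη'
    exact mul_ne_zero hη0 (pow_ne_zero 2 hB') hη'
  have hΨ : E.Ψ₂Sq * w ^ 2 = B * E'.Ψ₂Form A B := by
    apply mul_left_cancel₀ (pow_ne_zero 2 hs)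
    rw [h1, hw]; ring
  obtain ⟨β, hβ⟩ := exists_wronskian_eq_of_mul_sq_eq (by norm_num) E'.Ψ₂Sq_discr_ne_zero hAB
    E.natDegree_Ψ₂Sq' hw0 hB hΨ
  refine ⟨A, B, w, β, hAB, hB, hw0, ?_, hx', hη', hΨ, hβ⟩
  -- If β = 0 the coprime A and B have vanishing derivatives, so φ^*x would be constant, against
  -- injectivity of φ^*.
  rintro rfl
  rw [C_0, zero_mul, hAB.symm.wronskian_eq_zero_iff] at hβ
  obtain ⟨b, rfl⟩ := natDegree_eq_zero.mp (derivative_eq_zero.mp hβ.1)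
  obtain ⟨a, rfl⟩ := natDegree_eq_zero.mp (derivative_eq_zero.mp hβ.2)
  have hb : b ≠ 0 := fun h => hB (by simp [h])
  have hc : φ.comap E'.xFun = φ.comap (algebraMap K E'.RatFun (a / b)) := by
    rw [aeval_C, aeval_C] at hx'
    rw [AlgHom.commutes, map_div₀, eq_div_iff (by simpa using hb), hx']
  have hc' := φ.comap.injective hc
  have : (X - C (a / b) : K[X]) = 0 := by
    apply E'.aeval_xFun_injective
    simp [hc']
  exact X_sub_C_ne_zero _ this

end Isogeny

end WeierstrassCurve

end

/-! ### The pull-back of the invariant differential, and the degree as max(deg A, deg B). -/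

noncomputable section

namespace Polynomial

variable {K : Type*} [Field K]

/-- Modulo A only c₀ B^N survives, so A divides c₀, which has smaller degree and is zero; then one
factor A is cancelled and the argument repeats. -/
lemma eq_zero_of_sum_mul_pow_mul_pow_eq_zero_of_natDegree_le {A B : K[X]} (hAB : IsCoprime A B)
    (hA : A ≠ 0) (N : ℕ) (c : ℕ → K[X]) (hc : ∀ j, (c j).degree < A.degree)
    (h : ∑ j ∈ Finset.range (N + 1), c j * A ^ j * B ^ (N - j) = 0) : ∀ j ≤ N, c j = 0 := by
  induction N generalizing c with
  | zero =>
    intro j hj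
    obtain rfl : j = 0 := by omega
    simpa using h
  | succ N ih =>
    rw [Finset.sum_range_succ'] at h
    have h1 : ∑ j ∈ Finset.range (N + 1), c (j + 1) * A ^ (j + 1) * B ^ (N + 1 - (j + 1)) =
        A * ∑ j ∈ Finset.range (N + 1), c (j + 1) * A ^ j * B ^ (N - j) := by
      rw [Finset.mul_sum]
      refine Finset.sum_congr rfl fun j _ => ?_
      rw [Nat.add_sub_add_right]; ring
    rw [h1] at h
    have h2 : c 0 = 0 := by
      have h3 : A ∣ c 0 * B ^ (N + 1) :=
        ⟨-∑ j ∈ Finset.range (N + 1), c (j + 1) * A ^ j * B ^ (N - j), by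
          simp only [pow_zero, mul_one, Nat.sub_zero] at h
          linear_combination h⟩
      exact eq_zero_of_dvd_of_degree_lt (hAB.pow_right.dvd_of_dvd_mul_right h3) (hc 0)
    rw [h2] at h
    have h3 := ih (fun j => c (j + 1)) (fun j => hc _) (by simpa [hA] using h)
    rintro (_ | j) hj
    · exact h2
    · exact h3 j (by omega)

lemma eq_zero_of_sum_mul_pow_mul_pow_eq_zero {A B : K[X]} (hAB : IsCoprime A B) {n : ℕ}
    (hn : max A.natDegree B.natDegree = n) (N : ℕ) (c : ℕ → K[X]) (hc : ∀ j, (c j).degree < n)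
    (h : ∑ j ∈ Finset.range (N + 1), c j * A ^ j * B ^ (N - j) = 0) : ∀ j ≤ N, c j = 0 := by
  rcases Nat.eq_zero_or_pos n with rfl | hpos
  · intro j _
    simpa using hc j
  rcases max_choice A.natDegree B.natDegree with h1 | h1
  · have hA : A ≠ 0 := by rintro rfl; rw [natDegree_zero] at h1 hn; omega
    refine eq_zero_of_sum_mul_pow_mul_pow_eq_zero_of_natDegree_le hAB hA N c (fun j => ?_) h
    rw [degree_eq_natDegree hA, ← h1, hn]; exact hc j
  -- When B has the larger degree, A and B change roles and the sum is read backwards.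
  · have hB : B ≠ 0 := by rintro rfl; rw [natDegree_zero] at h1 hn; omega
    have := eq_zero_of_sum_mul_pow_mul_pow_eq_zero_of_natDegree_le hAB.symm hB N
      (fun j => c (N - j)) (fun j => by rw [degree_eq_natDegree hB, ← h1, hn]; exact hc _) (by
        rw [← h, ← Finset.sum_range_reflect]
        refine Finset.sum_congr rfl fun j hj => ?_
        have : j ≤ N := by simpa [Nat.lt_succ_iff] using hj
        rw [Nat.add_sub_cancel, Nat.sub_sub_self this]; ring)
    intro j hj
    simpa [Nat.sub_sub_self hj] using this (N - j) (by omega)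

/-- The form `∑ pⱼ AʲB^(N-j)` of degree `N` obtained from a polynomial `p` of degree at most `N`. -/
def homogEval (A B : K[X]) (N : ℕ) (p : K[X]) : K[X] :=
  ∑ j ∈ Finset.range (N + 1), C (p.coeff j) * A ^ j * B ^ (N - j)

lemma aeval_homogEval {R : Type*} [CommRing R] [Algebra K R] {A B : K[X]} {N : ℕ} {p : K[X]}
    (hp : p.natDegree ≤ N) {x t : R} (h : t * aeval x B = aeval x A) :
    aeval x (homogEval A B N p) = aeval t p * aeval x B ^ N := by
  rw [homogEval, aeval_eq_sum_range' (p := p) (n := N + 1) (by omega), map_sum, Finset.sum_mul]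
  refine Finset.sum_congr rfl fun j hj => ?_
  have : j ≤ N := by simpa [Nat.lt_succ_iff] using hj
  simp only [map_mul, map_pow, aeval_C, ← h, Algebra.smul_def]
  conv_rhs => rw [← Nat.add_sub_cancel' this, pow_add]
  ring

end Polynomial

namespace WeierstrassCurve

variable {K : Type*} [Field K] [Algebra K ℂ] {E E' : WeierstrassCurve K}

namespace Isogeny

lemma pullback_smul (φ : Isogeny E E') (f : E'.RatFun) (s : E'.Differentials) :
    φ.pullback (f • s) = φ.comap f • φ.pullback s := by
  let _ : Algebra E'.RatFun E.RatFun := φ.comap.toRingHom.toAlgebra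
  have : IsScalarTower K E'.RatFun E.RatFun :=
    IsScalarTower.of_algebraMap_eq fun c => (φ.comap.commutes c).symm
  change KaehlerDifferential.map K K E'.RatFun E.RatFun (f • s) = _
  rw [map_smul, ← algebraMap_smul E.RatFun f]
  rfl

lemma pullback_D (φ : Isogeny E E') (f : E'.RatFun) :
    φ.pullback (KaehlerDifferential.D K E'.RatFun f) =
      KaehlerDifferential.D K E.RatFun (φ.comap f) := by
  let _ : Algebra E'.RatFun E.RatFun := φ.comap.toRingHom.toAlgebra
  have : IsScalarTower K E'.RatFun E.RatFun :=
    IsScalarTower.of_algebraMap_eq fun c => (φ.comap.commutes c).symm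
  exact KaehlerDifferential.map_D K K E'.RatFun E.RatFun f

namespace HasRationalForm

variable {φ : Isogeny E E'} {A B w : K[X]} {β : K}

lemma aeval_B_ne_zero [CharZero K] (h : φ.HasRationalForm A B w β) : aeval E.xFun B ≠ 0 :=
  E.aeval_xFun_ne_zero h.B_ne_zero

/-- By the quotient rule d(A/B) = (βw/B²) dx, and division by φ^*η = (w/B²)η leaves β dx/η. -/
lemma pullback_stdDifferential [CharZero K] (h : φ.HasRationalForm A B w β) :
    φ.pullback E'.stdDifferential = algebraMap K E.RatFun β • E.stdDifferential := by
  have hB := h.aeval_B_ne_zero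
  have hw := E.aeval_xFun_ne_zero h.w_ne_zero
  have hη : E.etaFun ≠ 0 := by
    intro h0
    exact one_ne_zero (E.eq_zero_of_aeval_add_mul_etaFun (p := 0) (q := 1) (by simp [h0])).2
  have h1 : φ.comap E'.xFun = aeval E.xFun A / aeval E.xFun B := by
    rw [eq_div_iff hB, h.comap_xFun]
  have h2 : φ.comap E'.etaFun = aeval E.xFun w * E.etaFun / aeval E.xFun B ^ 2 := by
    rw [eq_div_iff (pow_ne_zero 2 hB), h.comap_etaFun]
  have h3 : aeval E.xFun B * aeval E.xFun (derivative A) -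
      aeval E.xFun A * aeval E.xFun (derivative B) = algebraMap K E.RatFun β * aeval E.xFun w := by
    have := congrArg (aeval E.xFun) h.wronskian_eq
    simp only [wronskian, map_sub, map_mul, aeval_C] at this
    rw [← this]; ring
  rw [stdDifferential, stdDifferential, pullback_smul, pullback_D, h1, Derivation.leibniz_div,
    Derivation.map_aeval, Derivation.map_aeval, map_inv₀]
  change (φ.comap E'.etaFun)⁻¹ • _ = _ • (E.etaFun)⁻¹ • _
  rw [h2]
  simp only [smul_smul, ← sub_smul, h3]
  congr 1
  field_simp

/-- The pull-back of an invariant differential is invariant. -/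
lemma toKaehler_eq [CharZero K] (h : φ.HasRationalForm A B w β) (ω : E.InvariantDifferential)
    (ω' : E'.InvariantDifferential) :
    ω.toKaehler = algebraMap K E.RatFun (ω.coeff / (ω'.coeff * β)) •
      φ.pullback ω'.toKaehler := by
  rw [InvariantDifferential.toKaehler, InvariantDifferential.toKaehler, pullback_smul,
    AlgHom.commutes, h.pullback_stdDifferential, smul_smul, smul_smul, ← map_mul, ← map_mul]
  have h1 : (ω'.coeff : K) ≠ 0 := ω'.coeff.ne_zero
  have h2 := h.β_ne_zero
  congr 2
  field_simp

lemma toHom_some_eq [CharZero K] [E'.IsElliptic] (h : φ.HasRationalForm A B w β) {x y : ℂ}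
    (hn : (Affine.baseChange E.toAffine ℂ).Nonsingular x y) {x' y' : ℂ}
    (hB : aeval x B ≠ 0) (hx : x' * aeval x B = aeval x A)
    (hy : E'.etaAt x' y' * aeval x B ^ 2 = aeval x w * E.etaAt x y) :
    ∃ hn', φ.toHom (.some x y hn) = .some x' y' hn' := by
  have e1 := φ.toHom_some_eq hn (c := x') (e := E'.etaAt x' y')
    (E.hasValueAt_of_mul_aeval_eq (p := A) (q := 0) (by simpa using h.comap_xFun) hB
      (by simpa using hx))
    (E.hasValueAt_of_mul_aeval_eq (p := 0) (q := w) (d := B ^ 2) (by simpa using h.comap_etaFun)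
      (by simpa using hB) (by simpa using hy))
  refine ⟨?_, ?_⟩
  · have := E'.nonsingular_yOfEta (φ.etaAt_sq_of_hasValueAt hn
      (E.hasValueAt_of_mul_aeval_eq (p := A) (q := 0) (by simpa using h.comap_xFun) hB
      (by simpa using hx))
      (E.hasValueAt_of_mul_aeval_eq (p := 0) (q := w) (d := B ^ 2) (by simpa using h.comap_etaFun)
      (by simpa using hB) (by simpa using hy)))
    rwa [yOfEta_etaAt] at this
  · rw [e1]; congr 1; exact E'.yOfEta_etaAt _ _

lemma aeval_ne_zero_of_aeval_eq_zero (h : φ.HasRationalForm A B w β) {x : ℂ}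
    (hx : aeval x B = 0) : aeval x A ≠ 0 := by
  intro h0
  obtain ⟨s, t, hst⟩ := h.coprime
  have := congrArg (aeval x) hst
  simp [h0, hx] at this

lemma of_toHom_some_eq [CharZero K] (h : φ.HasRationalForm A B w β)
    {x y x' y' : ℂ} {hn hn'} (he : φ.toHom (.some x y hn) = .some x' y' hn') :
    aeval x B ≠ 0 ∧ x' * aeval x B = aeval x A ∧
      E'.etaAt x' y' * aeval x B ^ 2 = aeval x w * E.etaAt x y := by
  obtain ⟨h1, h2⟩ := hasValueAt_of_toHom_eq he
  have h3 := h1.mul_aeval_eq hn.1 (p := A) (q := 0) (by simpa using h.comap_xFun)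
  have h4 := h2.mul_aeval_eq hn.1 (p := 0) (q := w) (d := B ^ 2) (by simpa using h.comap_etaFun)
  simp only [map_zero, zero_mul, add_zero, zero_add, map_pow] at h3 h4
  refine ⟨fun h0 => ?_, h3, h4⟩
  rw [h0, mul_zero] at h3
  exact h.aeval_ne_zero_of_aeval_eq_zero h0 h3.symm

lemma toHom_some_eq_zero_iff [CharZero K] [E'.IsElliptic] (h : φ.HasRationalForm A B w β)
    {x y : ℂ} (hn : (Affine.baseChange E.toAffine ℂ).Nonsingular x y) :
    φ.toHom (.some x y hn) = 0 ↔ aeval x B = 0 := by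
  constructor
  · intro h0
    by_contra hB
    obtain ⟨hn', he⟩ := h.toHom_some_eq hn hB (x' := aeval x A / aeval x B)
      (y' := E'.yOfEta _ (aeval x w * E.etaAt x y / aeval x B ^ 2))
      (div_mul_cancel₀ _ hB) (by rw [etaAt_yOfEta, div_mul_cancel₀ _ (pow_ne_zero 2 hB)])
    rw [h0] at he
    exact Affine.Point.some_ne_zero _ he.symm
  · intro hB
    rcases he : φ.toHom (.some x y hn) with _ | ⟨x', y', hn'⟩
    · rfl
    · exact absurd hB (h.of_toHom_some_eq he).1

/-- This bounds the degree of φ from below. Cleared of denominators, a relation over φ^*K(E') splits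
into its even and odd parts in η, each of the form Σ c_j(x) A^j B^(N-j) = 0 with deg c_j < max(deg
A, deg B); such c_j vanish. -/
lemma linearIndependent_xFun_pow [CharZero K] (h : φ.HasRationalForm A B w β) :
    LinearIndependent φ.comap.fieldRange
      (fun i : Fin (max A.natDegree B.natDegree) => E.xFun ^ (i : ℕ)) := by
  rw [Fintype.linearIndependent_iff]
  intro g hg
  have hr : ∀ i, ∃ f : E'.RatFun, φ.comap f = (g i : E.RatFun) := fun i => (g i).2
  choose f hf using hr
  choose p q d hd hpq using fun i => E'.exists_mul_aeval_eq (f i)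
  have hc : ∀ i, ∃ e, ∏ j, d j = d i * e := fun i => Finset.dvd_prod_of_mem d (Finset.mem_univ i)
  choose e he using hc
  obtain ⟨N, hN⟩ : ∃ N, ∀ i, (p i * e i).natDegree ≤ N ∧ (q i * e i).natDegree ≤ N :=
    ⟨∑ i, ((p i * e i).natDegree + (q i * e i).natDegree), fun i => by
      have := Finset.single_le_sum (f := fun i => (p i * e i).natDegree + (q i * e i).natDegree)
        (fun _ _ => Nat.zero_le _) (Finset.mem_univ i)
      exact ⟨(Nat.le_add_right _ _).trans this, (Nat.le_add_left _ _).trans this⟩⟩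
  -- The factor B^N homogenises the polynomials in A/B, and B² clears the denominator of φ^*η.
  have key : ∀ i, (g i : E.RatFun) * (φ.comap (aeval E'.xFun (∏ j, d j)) *
      aeval E.xFun B ^ (N + 2)) = aeval E.xFun (B ^ 2 * homogEval A B N (p i * e i)) +
      aeval E.xFun (w * homogEval A B N (q i * e i)) * E.etaFun := by
    intro i
    have h1 := congrArg φ.comap (hpq i)
    simp only [map_mul, map_add, hf, ← aeval_algHom_apply] at h1
    simp only [map_mul, aeval_homogEval (hN i).1 h.comap_xFun,
      aeval_homogEval (hN i).2 h.comap_xFun, he i, ← aeval_algHom_apply, map_pow]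
    linear_combination (aeval (φ.comap E'.xFun) (e i) * aeval E.xFun B ^ (N + 2)) * h1 +
      aeval (φ.comap E'.xFun) (q i) * aeval (φ.comap E'.xFun) (e i) * aeval E.xFun B ^ N *
        h.comap_etaFun
  have hsum : ∑ i, (g i : E.RatFun) * E.xFun ^ (i : ℕ) = 0 := by
    rw [← hg]; rfl
  have h2 : aeval E.xFun (∑ i : Fin (max A.natDegree B.natDegree),
        (B ^ 2 * homogEval A B N (p i * e i)) * X ^ (i : ℕ)) +
      aeval E.xFun (∑ i : Fin (max A.natDegree B.natDegree),
        (w * homogEval A B N (q i * e i)) * X ^ (i : ℕ)) * E.etaFun = 0 := by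
    have := congrArg (· * (φ.comap (aeval E'.xFun (∏ j, d j)) * aeval E.xFun B ^ (N + 2))) hsum
    simp only [zero_mul, Finset.sum_mul] at this
    rw [← this, map_sum, map_sum, Finset.sum_mul, ← Finset.sum_add_distrib]
    refine Finset.sum_congr rfl fun i _ => ?_
    have h3 := key i
    rw [map_mul _ _ (X ^ (i : ℕ)), map_mul _ _ (X ^ (i : ℕ)), map_pow, aeval_X]
    linear_combination (-E.xFun ^ (i : ℕ)) * h3
  obtain ⟨h3, h4⟩ := E.eq_zero_of_aeval_add_mul_etaFun h2
  have indep : ∀ (r : Fin (max A.natDegree B.natDegree) → K[X]), (∀ i, (r i).natDegree ≤ N) →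
      ∑ i, homogEval A B N (r i) * X ^ (i : ℕ) = 0 → ∀ i, r i = 0 := by
    intro r hr h0
    have h5 := eq_zero_of_sum_mul_pow_mul_pow_eq_zero h.coprime rfl N
      (fun j => ∑ i, C ((r i).coeff j) * X ^ (i : ℕ)) (fun j => by
        refine (degree_sum_le _ _).trans_lt ?_
        rw [Finset.sup_lt_iff (by exact WithBot.bot_lt_coe _)]
        intro i _
        refine (degree_C_mul_X_pow_le _ _).trans_lt ?_
        exact_mod_cast i.2) (by
        rw [← h0]
        simp only [homogEval, Finset.sum_mul]
        rw [Finset.sum_comm]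
        refine Finset.sum_congr rfl fun i _ => Finset.sum_congr rfl fun j _ => ?_
        ring)
    intro i
    ext j
    rcases le_or_gt j N with hj | hj
    · have h6 := congrArg (fun s => coeff s (i : ℕ)) (h5 j hj)
      simp only [finsetSum_coeff, coeff_C_mul, coeff_X_pow, coeff_zero, Fin.val_inj,
        mul_ite, mul_one, mul_zero, Finset.sum_ite_eq, Finset.mem_univ, if_true] at h6
      simpa using h6
    · rw [coeff_eq_zero_of_natDegree_lt ((hr i).trans_lt hj), coeff_zero]
  have hD : ∏ j, d j ≠ 0 := Finset.prod_ne_zero_iff.mpr fun i _ => hd i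
  have hp0 : ∀ i, p i * e i = 0 := indep _ (fun i => (hN i).1) (by
    simp only [mul_assoc, ← Finset.mul_sum] at h3
    simpa [h.B_ne_zero] using h3)
  have hq0 : ∀ i, q i * e i = 0 := indep _ (fun i => (hN i).2) (by
    simp only [mul_assoc, ← Finset.mul_sum] at h4
    simpa [h.w_ne_zero] using h4)
  intro i
  have hei : e i ≠ 0 := fun h0 => hD (by rw [he i, h0, mul_zero])
  have h6 := hpq i
  rw [(mul_eq_zero.mp (hp0 i)).resolve_right hei, (mul_eq_zero.mp (hq0 i)).resolve_right hei] at h6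
  have h7 : f i = 0 := by simpa [E'.aeval_xFun_ne_zero (hd i)] using h6
  have h8 := hf i
  rw [h7, map_zero] at h8
  exact Subtype.ext h8.symm

/-- The function η is recovered from x and φ^*η as φ^*η · B(x)²/w(x). -/
lemma adjoin_xFun_eq_top [CharZero K] (h : φ.HasRationalForm A B w β) :
    IntermediateField.adjoin φ.comap.fieldRange {E.xFun} = ⊤ := by
  rw [eq_top_iff]
  intro f _
  set M := IntermediateField.adjoin φ.comap.fieldRange {E.xFun} with hM
  have hx : E.xFun ∈ M := IntermediateField.mem_adjoin_simple_self _ _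
  have hK : ∀ f' : E'.RatFun, φ.comap f' ∈ M := fun f' =>
    M.algebraMap_mem (⟨φ.comap f', f', rfl⟩ : φ.comap.fieldRange)
  have hpoly : ∀ p : K[X], aeval E.xFun p ∈ M := by
    intro p
    rw [aeval_eq_sum_range]
    refine sum_mem fun i _ => ?_
    rw [Algebra.smul_def]
    refine mul_mem ?_ (pow_mem hx i)
    have := hK (algebraMap K E'.RatFun (p.coeff i))
    rwa [AlgHom.commutes] at this
  have hη : E.etaFun ∈ M := by
    have : E.etaFun = φ.comap E'.etaFun * aeval E.xFun B ^ 2 / aeval E.xFun w := by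
      rw [eq_div_iff (E.aeval_xFun_ne_zero h.w_ne_zero), h.comap_etaFun]; ring
    rw [this]
    exact div_mem (mul_mem (hK _) (pow_mem (hpoly _) 2)) (hpoly _)
  obtain ⟨p, q, d, hd, hpq⟩ := E.exists_mul_aeval_eq f
  rw [← eq_div_iff (E.aeval_xFun_ne_zero hd)] at hpq
  rw [hpq]
  exact div_mem (add_mem (hpoly _) (mul_mem (hpoly _) hη)) (hpoly _)

/-- The degree of an isogeny is the degree of the rational function `φ^* x`. -/
lemma max_natDegree_eq_degree [CharZero K] (h : φ.HasRationalForm A B w β)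
    (hφ : φ.degree ≠ 0) : max A.natDegree B.natDegree = φ.degree := by
  -- `finrank` is 0 for an infinite extension, so a non-zero degree yields finiteness.
  have hfin : FiniteDimensional φ.comap.fieldRange E.RatFun :=
    FiniteDimensional.of_finrank_pos (Nat.pos_of_ne_zero hφ)
  apply le_antisymm
  · simpa [degree] using h.linearIndependent_xFun_pow.fintype_card_le_finrank
  · have h1 : φ.degree = (minpoly φ.comap.fieldRange E.xFun).natDegree := by
      rw [← IntermediateField.adjoin.finrank (IsIntegral.of_finite _ _), h.adjoin_xFun_eq_top,
        IntermediateField.finrank_top', degree]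
    rw [h1]
    set r : φ.comap.fieldRange := ⟨φ.comap E'.xFun, _, rfl⟩ with hr
    -- The function x is a root of A(T) − φ^*x · B(T). This polynomial is non-zero, for otherwise A
    -- would be a constant multiple of B and the Wronskian would vanish.
    set Q : φ.comap.fieldRange[X] := A.map (algebraMap K _) - C r * B.map (algebraMap K _) with hQ
    have hroot : aeval E.xFun Q = 0 := by
      rw [hQ, map_sub, map_mul, aeval_map_algebraMap, aeval_map_algebraMap, aeval_C,
        ← h.comap_xFun]
      exact sub_self _
    have hQ0 : Q ≠ 0 := by
      intro h0
      have h2 := congrArg (fun s => coeff s B.natDegree) h0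
      simp only [hQ, coeff_sub, coeff_C_mul, coeff_map, coeff_natDegree, coeff_zero] at h2
      set a := A.coeff B.natDegree
      have hb : B.leadingCoeff ≠ 0 := leadingCoeff_ne_zero.mpr h.B_ne_zero
      have h3 : algebraMap K E.RatFun a - φ.comap E'.xFun * algebraMap K E.RatFun B.leadingCoeff =
          0 := congrArg (fun s : φ.comap.fieldRange => (s : E.RatFun)) h2
      have h4 : φ.comap E'.xFun = algebraMap K E.RatFun (a / B.leadingCoeff) := by
        rw [map_div₀, eq_div_iff (by simpa using hb)]
        linear_combination -h3
      have h5 : C (a / B.leadingCoeff) * B = A := by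
        apply E.aeval_xFun_injective
        rw [map_mul, aeval_C, ← h4, h.comap_xFun]
      have h6 := h.wronskian_eq
      rw [← h5] at h6
      simp only [wronskian, derivative_mul, derivative_C] at h6
      have h7 : C β * w = 0 := by rw [← h6]; ring
      exact mul_ne_zero (C_ne_zero.mpr h.β_ne_zero) h.w_ne_zero h7
    have h2 := natDegree_le_natDegree (minpoly.degree_le_of_ne_zero _ E.xFun hQ0 hroot)
    refine h2.trans ((natDegree_sub_le _ _).trans (max_le_max (natDegree_map_le) ?_))
    exact (natDegree_C_mul_le _ _).trans natDegree_map_le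

end HasRationalForm

end Isogeny

end WeierstrassCurve

end

/-! ### Fibres of A/B over complex points, and the order of the kernel. -/

noncomputable section

namespace WeierstrassCurve

namespace Isogeny.HasRationalForm

section

variable {K : Type*} [Field K] [Algebra K ℂ] {E E' : WeierstrassCurve K}
  {φ : Isogeny E E'} {A B w : K[X]} {β : K}

lemma Ψ₂Sq_mul_sq_eq {L : Type*} [Field L] [Algebra K L] (h : φ.HasRationalForm A B w β) {x t : L}
    (hx : t * aeval x B = aeval x A) :
    aeval x E.Ψ₂Sq * aeval x w ^ 2 = aeval x B ^ 4 * aeval t E'.Ψ₂Sq := by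
  have h1 := congrArg (aeval x) h.Ψ₂Sq_mul_sq
  rw [map_mul, map_mul, map_pow, E'.aeval_Ψ₂Form A B x t hx] at h1
  rw [h1]; ring

lemma aeval_B_ne_zero_of_eq {L : Type*} [Field L] [Algebra K L] (h : φ.HasRationalForm A B w β)
    {x t : L} (hx : t * aeval x B = aeval x A) : aeval x B ≠ 0 := by
  intro h0
  rw [h0, mul_zero] at hx
  obtain ⟨u, v, huv⟩ := h.coprime
  have := congrArg (aeval x) huv
  simp [h0, ← hx] at this

lemma ne_zero_of_eq {L : Type*} [Field L] [Algebra K L] (h : φ.HasRationalForm A B w β)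
    {x t : L} (hx : t * aeval x B = aeval x A) (ht : aeval t E'.Ψ₂Sq ≠ 0) :
    aeval x w ≠ 0 ∧ aeval x E.Ψ₂Sq ≠ 0 := by
  have h1 := h.Ψ₂Sq_mul_sq_eq hx
  have h2 : aeval x B ^ 4 * aeval t E'.Ψ₂Sq ≠ 0 :=
    mul_ne_zero (pow_ne_zero 4 (h.aeval_B_ne_zero_of_eq hx)) ht
  rw [← h1] at h2
  exact ⟨fun h0 => h2 (by simp [h0]), fun h0 => h2 (by simp [h0])⟩

/-- The only value of t at which the degree of A − tB can drop is that of A/B at infinity. If that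
value is ∞, the degree never drops, and the quotient by zero in the witness is harmless. -/
lemma exists_natDegree_sub_eq (h : φ.HasRationalForm A B w β) (L : Type*) [Field L] [Algebra K L] :
    ∃ t₀ : L, ∀ t ≠ t₀, (A.map (algebraMap K L) - C t * B.map (algebraMap K L)).natDegree =
      max A.natDegree B.natDegree := by
  set n := max A.natDegree B.natDegree with hn
  refine ⟨algebraMap K L (A.coeff n / B.coeff n), fun t ht => ?_⟩
  have hle : (A.map (algebraMap K L) - C t * B.map (algebraMap K L)).natDegree ≤ n :=
    (natDegree_sub_le _ _).trans (max_le_max natDegree_map_le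
      ((natDegree_C_mul_le _ _).trans natDegree_map_le))
  refine natDegree_eq_of_le_of_coeff_ne_zero hle ?_
  rw [coeff_sub, coeff_C_mul, coeff_map, coeff_map]
  intro h0
  by_cases hb : B.coeff n = 0
  · rw [hb, map_zero, mul_zero, sub_zero, _root_.map_eq_zero] at h0
    rcases max_choice A.natDegree B.natDegree with h1 | h1
    · rw [hn, h1, coeff_natDegree, leadingCoeff_eq_zero] at h0
      rw [h0, natDegree_zero] at h1
      have : B.natDegree = 0 := by omega
      rw [hn, h0, natDegree_zero, this, max_self] at hb
      have hB : B = 0 := by rw [eq_C_of_natDegree_eq_zero this, hb, C_0]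
      exact h.B_ne_zero hB
    · rw [hn, h1, coeff_natDegree, leadingCoeff_eq_zero] at hb
      exact h.B_ne_zero hb
  · apply ht
    rw [map_div₀, eq_div_iff (by simpa using hb)]
    linear_combination -h0

/-- The fibre over `t` of the rational function `A / B`. -/
lemma ncard_fiber [CharZero K] (h : φ.HasRationalForm A B w β) {t : ℂ}
    (ht : aeval t E'.Ψ₂Sq ≠ 0)
    (hdeg : (A.map (algebraMap K ℂ) - C t * B.map (algebraMap K ℂ)).natDegree =
      max A.natDegree B.natDegree) (h0 : max A.natDegree B.natDegree ≠ 0) :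
    {x : ℂ | t * aeval x B = aeval x A}.ncard = max A.natDegree B.natDegree := by
  set Q := A.map (algebraMap K ℂ) - C t * B.map (algebraMap K ℂ) with hQ
  have heval : ∀ x, Q.eval x = aeval x A - t * aeval x B := fun x => by
    simp [hQ, eval_map_algebraMap]
  have hQ0 : Q ≠ 0 := by
    intro h1; rw [h1, natDegree_zero] at hdeg; exact h0 hdeg.symm
  -- At a double root x of A − tB the Wronskian βw vanishes, but w(x) ≠ 0 because Ψ₂'(t) ≠ 0.
  have hsep : Q.Separable := by
    rw [Polynomial.Separable, Polynomial.isCoprime_iff_aeval_ne_zero_of_isAlgClosed ℂ ℂ]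
    intro x
    by_contra! hx
    obtain ⟨h1, h2⟩ := hx
    rw [coe_aeval_eq_eval, heval, sub_eq_zero] at h1
    have hB := h.aeval_B_ne_zero_of_eq h1.symm
    have hw := (h.ne_zero_of_eq h1.symm ht).1
    have h3 : aeval x (derivative A) - t * aeval x (derivative B) = 0 := by
      rw [← h2, coe_aeval_eq_eval, hQ]
      simp [derivative_map, eval_map_algebraMap]
    have h4 := congrArg (aeval x) h.wronskian_eq
    simp only [wronskian, map_sub, map_mul, aeval_C] at h4
    have h5 : algebraMap K ℂ β * aeval x w = 0 := by
      rw [← h4]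
      linear_combination aeval x B * h3 - aeval x (derivative B) * h1
    have h6 : algebraMap K ℂ β ≠ 0 := by simpa using h.β_ne_zero
    exact mul_ne_zero h6 hw h5
  have hset : {x : ℂ | t * aeval x B = aeval x A} = Q.rootSet ℂ := by
    ext x
    rw [mem_rootSet, coe_aeval_eq_eval, heval, Set.mem_ofPred_eq, sub_eq_zero]
    exact ⟨fun h1 => ⟨hQ0, h1.symm⟩, fun h1 => h1.2.symm⟩
  rw [hset, ← hdeg, ← card_rootSet_eq_natDegree (K := ℂ) hsep (IsAlgClosed.splits _),
    ← Nat.card_eq_fintype_card]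
  rfl

/-- The fibre of `φ` over the point `(t, s)` of `E'` in the coordinates `x` and `η`. -/
def fiberPoint [CharZero K] [E.IsElliptic] (h : φ.HasRationalForm A B w β) {t s : ℂ}
    (hs : s ^ 2 = aeval t E'.Ψ₂Sq) (hs0 : s ≠ 0) (x : {x : ℂ // t * aeval x B = aeval x A}) :
    E.ComplexPoints :=
  .some x.1 (E.yOfEta x.1 (s * aeval x.1 B ^ 2 / aeval x.1 w)) (E.nonsingular_yOfEta (by
    have hw := (h.ne_zero_of_eq x.2 (by rw [← hs]; exact pow_ne_zero 2 hs0)).1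
    rw [div_pow, div_eq_iff (pow_ne_zero 2 hw), h.Ψ₂Sq_mul_sq_eq x.2, ← hs]
    ring))

lemma fiberPoint_injective [CharZero K] [E.IsElliptic] (h : φ.HasRationalForm A B w β) {t s : ℂ}
    (hs : s ^ 2 = aeval t E'.Ψ₂Sq) (hs0 : s ≠ 0) : Function.Injective (h.fiberPoint hs hs0) := by
  intro x₁ x₂ he
  exact Subtype.ext (Affine.Point.some.inj he).1

/-- As s ≠ 0 forces w(x) ≠ 0, a point of the fibre is determined by x, with η = sB(x)²/w(x). -/
lemma range_fiberPoint [CharZero K] [E.IsElliptic] [E'.IsElliptic]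
    (h : φ.HasRationalForm A B w β) {t s : ℂ} (hs : s ^ 2 = aeval t E'.Ψ₂Sq) (hs0 : s ≠ 0) :
    Set.range (h.fiberPoint hs hs0) =
      {P | φ.toHom P = .some t (E'.yOfEta t s) (E'.nonsingular_yOfEta hs)} := by
  have ht : aeval t E'.Ψ₂Sq ≠ 0 := by rw [← hs]; exact pow_ne_zero 2 hs0
  ext P
  constructor
  · rintro ⟨x, rfl⟩
    have hw := (h.ne_zero_of_eq x.2 ht).1
    obtain ⟨_, he⟩ := h.toHom_some_eq (x := x.1)
      (y := E.yOfEta x.1 (s * aeval x.1 B ^ 2 / aeval x.1 w)) (E.nonsingular_yOfEta (by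
        rw [div_pow, div_eq_iff (pow_ne_zero 2 hw), h.Ψ₂Sq_mul_sq_eq x.2, ← hs]
        ring)) (x' := t) (y' := E'.yOfEta t s) (h.aeval_B_ne_zero_of_eq x.2) x.2 (by
        rw [etaAt_yOfEta, etaAt_yOfEta]; field_simp)
    exact he
  · intro hP
    rcases P with _ | ⟨x, y, hn⟩
    · have : φ.toHom 0 = .some t (E'.yOfEta t s) (E'.nonsingular_yOfEta hs) := hP
      rw [map_zero] at this
      exact absurd this.symm (Affine.Point.some_ne_zero _)
    · obtain ⟨_, hx, hy⟩ := h.of_toHom_some_eq hP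
      refine ⟨⟨x, hx⟩, ?_⟩
      have hw := (h.ne_zero_of_eq hx ht).1
      rw [fiberPoint]
      congr 1
      rw [etaAt_yOfEta] at hy
      apply E.etaAt_injective x
      rw [etaAt_yOfEta, hy, mul_div_cancel_left₀ _ hw]

lemma exists_generic [CharZero K] [E.IsElliptic] [E'.IsElliptic]
    (h : φ.HasRationalForm A B w β) : ∃ t s : ℂ, s ^ 2 = aeval t E'.Ψ₂Sq ∧ s ≠ 0 ∧
      (A.map (algebraMap K ℂ) - C t * B.map (algebraMap K ℂ)).natDegree =
      max A.natDegree B.natDegree := by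
  obtain ⟨t₀, ht₀⟩ := h.exists_natDegree_sub_eq ℂ
  have hfin : ((E'.Ψ₂Sq.map (algebraMap K ℂ)).rootSet ℂ ∪ {t₀}).Finite :=
    (rootSet_finite _ _).union (Set.finite_singleton _)
  obtain ⟨t, ht⟩ := hfin.exists_notMem
  simp only [Set.mem_union, Set.mem_singleton_iff, not_or, mem_rootSet, not_and] at ht
  obtain ⟨s, hs⟩ := IsAlgClosed.exists_pow_nat_eq (aeval t E'.Ψ₂Sq) (n := 2) two_pos
  refine ⟨t, s, hs, ?_, ht₀ t ht.2⟩
  rintro rfl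
  apply ht.1 ((Polynomial.map_ne_zero_iff (algebraMap K ℂ).injective).mpr E'.Ψ₂Sq_ne_zero')
  rw [aeval_map_algebraMap, ← hs]; simp

/-- Translation by P₀ ∈ S carries the kernel in S onto the fibre in S. It is used with S the whole
group and with S the real points. -/
lemma card_fiber_eq_card_ker (φ : Isogeny E E') {P₀ : E.ComplexPoints} {Q : E'.ComplexPoints}
    (hP : φ.toHom P₀ = Q) (S : AddSubgroup E.ComplexPoints) (hS : P₀ ∈ S) :
    ({P | φ.toHom P = Q} ∩ (S : Set E.ComplexPoints)).ncard =
      ((φ.toHom.ker ⊓ S : AddSubgroup E.ComplexPoints) : Set E.ComplexPoints).ncard := by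
  have : {P | φ.toHom P = Q} ∩ (S : Set E.ComplexPoints) = (fun P => P₀ + P) ''
      ((φ.toHom.ker ⊓ S : AddSubgroup E.ComplexPoints) : Set E.ComplexPoints) := by
    ext P
    simp only [Set.mem_inter_iff, Set.mem_ofPred_eq, SetLike.mem_coe, Set.mem_image,
      AddSubgroup.mem_inf, AddMonoidHom.mem_ker]
    constructor
    · rintro ⟨h1, h2⟩
      exact ⟨-P₀ + P, ⟨by rw [map_add, map_neg, h1, hP]; simp, S.add_mem (S.neg_mem hS) h2⟩,
        by simp⟩
    · rintro ⟨P', ⟨h1, h2⟩, rfl⟩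
      exact ⟨by rw [map_add, h1, hP, add_zero], S.add_mem hS h2⟩
  rw [this, Set.ncard_image_of_injective _ (add_right_injective P₀)]

/-- The kernel of `φ` on complex points has as many elements as the degree. -/
lemma ncard_ker [CharZero K] [E.IsElliptic] [E'.IsElliptic]
    (h : φ.HasRationalForm A B w β) (h0 : max A.natDegree B.natDegree ≠ 0) :
    (φ.toHom.ker : Set E.ComplexPoints).ncard = max A.natDegree B.natDegree := by
  obtain ⟨t, s, hs, hs0, hdeg⟩ := h.exists_generic
  have hn := h.ncard_fiber (by rw [← hs]; exact pow_ne_zero 2 hs0) hdeg h0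
  have hr : {P | φ.toHom P = .some t (E'.yOfEta t s) (E'.nonsingular_yOfEta hs)}.ncard =
      max A.natDegree B.natDegree := by
    rw [← h.range_fiberPoint hs hs0, ← Set.image_univ,
      Set.ncard_image_of_injective _ (h.fiberPoint_injective hs hs0), Set.ncard_univ, ← hn]
    rfl
  obtain ⟨P₀, hP₀⟩ := Set.nonempty_of_ncard_ne_zero (by rw [hr]; exact h0)
  have := card_fiber_eq_card_ker φ hP₀ ⊤ (AddSubgroup.mem_top _)
  simp only [AddSubgroup.coe_top, Set.inter_univ, inf_top_eq] at this
  rw [← this, hr]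

end

/-! ### Real points in the fibres. -/

section Real

variable {E E' : WeierstrassCurve ℝ} {φ : Isogeny E E'} {A B w : ℝ[X]} {β : ℝ}

lemma aeval_ofReal_eq (p : ℝ[X]) (x : ℝ) : aeval (x : ℂ) p = ((aeval x p : ℝ) : ℂ) :=
  aeval_algebraMap_apply ℂ x p

/-- Complex conjugation is an involution of the complex fibre, a set of odd cardinality, so it has a
fixed point. -/
lemma exists_real_fiber (h : φ.HasRationalForm A B w β) {t : ℝ}
    (ht : aeval t E'.Ψ₂Sq ≠ 0)
    (hdeg : (A.map (algebraMap ℝ ℂ) - C (t : ℂ) * B.map (algebraMap ℝ ℂ)).natDegree =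
      max A.natDegree B.natDegree) (hodd : Odd (max A.natDegree B.natDegree)) :
    ∃ x : ℝ, t * aeval x B = aeval x A := by
  classical
  have h0 : max A.natDegree B.natDegree ≠ 0 := by
    intro h1; rw [h1] at hodd; simp at hodd
  have hc := h.ncard_fiber (t := (t : ℂ)) (by rw [aeval_ofReal_eq]; exact_mod_cast ht) hdeg h0
  set S := {x : ℂ | (t : ℂ) * aeval x B = aeval x A} with hS
  have hfin : S.Finite := Set.finite_of_ncard_ne_zero (by rw [hc]; exact h0)
  have hconj : ∀ x ∈ S, (starRingEnd ℂ) x ∈ S := by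
    intro x hx
    have h1 := congrArg (starRingEnd ℂ) (show (t : ℂ) * aeval x B = aeval x A from hx)
    rw [map_mul, Complex.conj_ofReal] at h1
    have h2 : ∀ p : ℝ[X], (starRingEnd ℂ) (aeval x p) = aeval ((starRingEnd ℂ) x) p := fun p =>
      (aeval_algHom_apply Complex.conjAe.toAlgHom x p).symm
    rw [h2, h2] at h1
    exact h1
  let _ : Fintype S := hfin.fintype
  let σ : Equiv.Perm S :=
    { toFun := fun x => ⟨(starRingEnd ℂ) x, hconj x x.2⟩
      invFun := fun x => ⟨(starRingEnd ℂ) x, hconj x x.2⟩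
      left_inv := fun x => by simp
      right_inv := fun x => by simp }
  have hσ : σ ^ 2 ^ 1 = 1 := by
    ext x
    simp [σ, pow_two]
  have hcard : ¬ 2 ∣ Fintype.card S := by
    rw [← Nat.card_eq_fintype_card]
    have : Nat.card S = max A.natDegree B.natDegree := hc
    rw [this]
    exact hodd.not_two_dvd_nat
  obtain ⟨x, hx⟩ := Equiv.Perm.exists_fixed_point_of_prime (p := 2) (n := 1) hcard hσ
  have hx' : (starRingEnd ℂ) x.1 = x.1 := congrArg Subtype.val hx
  obtain ⟨r, hr⟩ := Complex.conj_eq_iff_real.mp hx'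
  refine ⟨r, ?_⟩
  have h3 : (t : ℂ) * aeval x.1 B = aeval x.1 A := x.2
  rw [hr, aeval_ofReal_eq, aeval_ofReal_eq] at h3
  exact_mod_cast h3

/-- The real points of `E`. -/
abbrev realPoints (E : WeierstrassCurve ℝ) : AddSubgroup E.ComplexPoints :=
  (Affine.Point.baseChange (W' := E.toAffine) ℝ ℂ).range

lemma some_mem_realPoints (E : WeierstrassCurve ℝ) {x y : ℂ}
    (hn : (Affine.baseChange E.toAffine ℂ).Nonsingular x y) :
    (.some x y hn : E.ComplexPoints) ∈ realPoints E ↔ (∃ r : ℝ, x = r) ∧ ∃ r : ℝ, y = r := by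
  constructor
  · rintro ⟨_ | ⟨a, b, hab⟩, hP⟩
    · exact absurd hP.symm (Affine.Point.some_ne_zero hn)
    · obtain ⟨h1, h2⟩ := Affine.Point.some.inj hP
      exact ⟨⟨a, h1.symm⟩, ⟨b, h2.symm⟩⟩
  · rintro ⟨⟨a, rfl⟩, ⟨b, rfl⟩⟩
    have hab : (Affine.baseChange E.toAffine ℝ).Nonsingular a b :=
      (E.toAffine.baseChange_nonsingular (f := Algebra.ofId ℝ ℂ) (Algebra.ofId ℝ ℂ).injective
        a b).mp hn
    exact ⟨.some a b hab, rfl⟩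

/-- The number of real solutions of `A(x) = t B(x)` is the number of real points in the kernel,
if there is any solution. -/
lemma ncard_real_fiber [E.IsElliptic] [E'.IsElliptic] (h : φ.HasRationalForm A B w β) {t : ℝ}
    (ht : 0 < aeval t E'.Ψ₂Sq) (hex : ∃ x : ℝ, t * aeval x B = aeval x A) :
    {x : ℝ | t * aeval x B = aeval x A}.ncard =
      ((φ.toHom.ker ⊓ realPoints E : AddSubgroup E.ComplexPoints) :
        Set E.ComplexPoints).ncard := by
  -- With Ψ₂'(t) > 0 the point (t, s) is real, and a point of its fibre is real as soon as its x is,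
  -- because its η is given by a real formula in x.
  set s : ℝ := √(aeval t E'.Ψ₂Sq) with hs
  have hs1 : (s : ℂ) ^ 2 = aeval (t : ℂ) E'.Ψ₂Sq := by
    rw [aeval_ofReal_eq, ← Complex.ofReal_pow, Real.sq_sqrt ht.le]
  have hs0 : (s : ℂ) ≠ 0 := by exact_mod_cast (Real.sqrt_pos.mpr ht).ne'
  have hcast : ∀ x : ℝ, t * aeval x B = aeval x A ↔
      (t : ℂ) * aeval (x : ℂ) B = aeval (x : ℂ) A := fun x => by
    rw [aeval_ofReal_eq, aeval_ofReal_eq]; exact_mod_cast Iff.rfl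
  let f : {x : ℝ | t * aeval x B = aeval x A} → E.ComplexPoints := fun x =>
    h.fiberPoint hs1 hs0 ⟨(x.1 : ℂ), (hcast _).mp x.2⟩
  have hf : Function.Injective f := by
    intro x₁ x₂ he
    have h1 := h.fiberPoint_injective hs1 hs0 he
    have h2 : ((x₁.1 : ℝ) : ℂ) = ((x₂.1 : ℝ) : ℂ) := congrArg Subtype.val h1
    exact Subtype.ext (by exact_mod_cast h2)
  have hmem : ∀ x, f x ∈ realPoints E := by
    intro x
    refine (some_mem_realPoints E _).mpr ⟨⟨x.1, rfl⟩, ?_⟩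
    refine ⟨E.yOfEta x.1 (s * aeval x.1 B ^ 2 / aeval x.1 w), ?_⟩
    simp only [yOfEta, aeval_ofReal_eq]
    push_cast
    rfl
  have hrange : Set.range f = {P | φ.toHom P = .some (t : ℂ) (E'.yOfEta (t : ℂ) (s : ℂ))
      (E'.nonsingular_yOfEta hs1)} ∩ (realPoints E : Set E.ComplexPoints) := by
    rw [← h.range_fiberPoint hs1 hs0]
    ext P
    constructor
    · rintro ⟨x, rfl⟩
      exact ⟨⟨_, rfl⟩, hmem x⟩
    · rintro ⟨⟨x, rfl⟩, hP⟩
      obtain ⟨⟨r, hr⟩, -⟩ := (some_mem_realPoints E _).mp hP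
      obtain ⟨x, hx⟩ := x
      have hr' : x = (r : ℂ) := hr
      subst hr'
      exact ⟨⟨r, (hcast _).mpr hx⟩, rfl⟩
  obtain ⟨x₀, hx₀⟩ := hex
  have hP₀ : f ⟨x₀, hx₀⟩ ∈ Set.range f := ⟨_, rfl⟩
  rw [hrange] at hP₀
  rw [← card_fiber_eq_card_ker φ hP₀.1 (realPoints E) hP₀.2, ← hrange, ← Set.image_univ,
    Set.ncard_image_of_injective _ hf, Set.ncard_univ]
  rfl

-- The kernel has prime order, so its real points are all of it or only 0; odd p makes the fibre
-- non-empty.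
open scoped Classical in
lemma ncard_real_fiber_of_odd [E.IsElliptic] [E'.IsElliptic] (h : φ.HasRationalForm A B w β)
    {p : ℕ} (hp : p.Prime) (hp2 : p ≠ 2) (hdeg : max A.natDegree B.natDegree = p) :
    ∃ t₀ : ℝ, ∀ t ≠ t₀, 0 < aeval t E'.Ψ₂Sq →
      {x : ℝ | t * aeval x B = aeval x A}.ncard =
        if φ.toHom.ker ≤ realPoints E then p else 1 := by
  obtain ⟨t₀, ht₀⟩ := h.exists_natDegree_sub_eq ℂ
  refine ⟨t₀.re, fun t ht hpos => ?_⟩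
  have hne : (t : ℂ) ≠ t₀ := by rintro rfl; exact ht (Complex.ofReal_re t).symm
  rw [h.ncard_real_fiber hpos (h.exists_real_fiber hpos.ne' (ht₀ _ hne)
    (by rw [hdeg]; exact hp.odd_of_ne_two hp2))]
  have hker := h.ncard_ker (by rw [hdeg]; exact hp.ne_zero)
  rw [hdeg] at hker
  split_ifs with hle
  · rw [inf_eq_left.mpr hle, hker]
  · have hfin : Finite φ.toHom.ker := Nat.finite_of_card_ne_zero (by
      have : Nat.card φ.toHom.ker = p := hker
      rw [this]; exact hp.ne_zero)
    have hdvd : Nat.card (φ.toHom.ker ⊓ realPoints E : AddSubgroup E.ComplexPoints) ∣ p := by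
      have := AddSubgroup.card_dvd_of_le (inf_le_left : φ.toHom.ker ⊓ realPoints E ≤ φ.toHom.ker)
      rwa [show Nat.card φ.toHom.ker = p from hker] at this
    rcases (Nat.dvd_prime hp).mp hdvd with h1 | h1
    · exact h1
    · exfalso
      apply hle
      have hfin' : (φ.toHom.ker : Set E.ComplexPoints).Finite := Set.toFinite _
      have := Set.eq_of_subset_of_ncard_le
        (show ((φ.toHom.ker ⊓ realPoints E : AddSubgroup E.ComplexPoints) :
          Set E.ComplexPoints) ⊆ φ.toHom.ker from fun P hP => hP.1)
        (by rw [hker]; exact h1.symm.le) hfin'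
      intro P hP
      have hP' : P ∈ (φ.toHom.ker : Set E.ComplexPoints) := hP
      rw [← this] at hP'
      exact hP'.2

end Real

end Isogeny.HasRationalForm

end WeierstrassCurve

end

/-! ### Change of variables for finite-to-one maps, and the two components of a real cubic. -/

noncomputable section

namespace MeasureTheory

open Set Filter Topology
open scoped ENNReal

/-- The change of variables formula for a local diffeomorphism `f : U → S` all of whose fibres
have `k` elements. -/
theorem setLIntegral_abs_det_fderiv_mul_comp_eq {E : Type*} [NormedAddCommGroup E]
    [NormedSpace ℝ E] [FiniteDimensional ℝ E] [MeasurableSpace E] [BorelSpace E] (μ : Measure E)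
    [μ.IsAddHaarMeasure] {U S : Set E} (hU : MeasurableSet U) (hS : MeasurableSet S) {f : E → E}
    {f' : E → E →L[ℝ] E} (hf' : ∀ x ∈ U, HasFDerivAt f (f' x) x)
    (hinj : ∀ x ∈ U, ∃ V ∈ 𝓝 x, InjOn f V) (hmaps : MapsTo f U S) {k : ℕ}
    (hk : ∀ᵐ y ∂μ, y ∈ S → {x ∈ U | f x = y}.encard = k) {g : E → ℝ≥0∞} (hg : Measurable g) :
    ∫⁻ x in U, ENNReal.ofReal |(f' x).det| * g (f x) ∂μ = k * ∫⁻ y in S, g y ∂μ := by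
  -- By the Lindelöf property countably many open sets of injectivity cover U; made disjoint, they
  -- reduce the formula to the injective case.
  have hcov : ∃ V : ℕ → Set E, (∀ n, MeasurableSet (V n)) ∧ (∀ n, InjOn f (V n)) ∧
      U ⊆ ⋃ n, V n := by
    have h1 : ∀ x : E, ∃ V : Set E, IsOpen V ∧ InjOn f V ∧ (x ∈ U → x ∈ V) := by
      intro x
      by_cases hx : x ∈ U
      · obtain ⟨V, hV, hi⟩ := hinj x hx
        obtain ⟨W, hWV, hW, hxW⟩ := mem_nhds_iff.mp hV
        exact ⟨W, hW, hi.mono hWV, fun _ => hxW⟩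
      · exact ⟨∅, isOpen_empty, injOn_empty _, fun h => absurd h hx⟩
    choose V hV hVi hVx using h1
    obtain ⟨T, hT, hTU⟩ := TopologicalSpace.isOpen_iUnion_countable V hV
    have hUT : U ⊆ ⋃ x ∈ T, V x := by
      rw [hTU]; exact fun x hx => mem_iUnion.mpr ⟨x, hVx x hx⟩
    rcases T.eq_empty_or_nonempty with rfl | hne
    · refine ⟨fun _ => ∅, fun _ => MeasurableSet.empty, fun _ => injOn_empty _, ?_⟩
      simpa using hUT
    · obtain ⟨e, he⟩ := hT.exists_eq_range hne
      refine ⟨fun n => V (e n), fun n => (hV _).measurableSet, fun n => hVi _, ?_⟩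
      rw [he, biUnion_range] at hUT
      exact hUT
  obtain ⟨V, hVm, hVi, hUV⟩ := hcov
  set W : ℕ → Set E := fun n => U ∩ disjointed V n with hW
  have hWm : ∀ n, MeasurableSet (W n) := fun n => hU.inter (MeasurableSet.disjointed hVm n)
  have hWi : ∀ n, InjOn f (W n) := fun n =>
    (hVi n).mono (inter_subset_right.trans (disjointed_subset V n))
  have hWd : Pairwise (Function.onFun Disjoint W) := fun m n hmn =>
    ((disjoint_disjointed V) hmn).mono inter_subset_right inter_subset_right
  have hWU : ⋃ n, W n = U := by
    rw [hW, ← inter_iUnion, iUnion_disjointed, inter_eq_left]; exact hUV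
  have hWf : ∀ n, ∀ x ∈ W n, HasFDerivWithinAt f (f' x) (W n) x := fun n x hx =>
    (hf' x hx.1).hasFDerivWithinAt
  have hfm : ∀ n, MeasurableSet (f '' W n) := fun n =>
    measurable_image_of_fderivWithin (hWm n) (hWf n) (hWi n)
  calc ∫⁻ x in U, ENNReal.ofReal |(f' x).det| * g (f x) ∂μ
      = ∑' n, ∫⁻ x in W n, ENNReal.ofReal |(f' x).det| * g (f x) ∂μ := by
        rw [← hWU, lintegral_iUnion hWm hWd]
    _ = ∑' n, ∫⁻ y, (f '' W n).indicator g y ∂μ := by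
        refine tsum_congr fun n => ?_
        rw [← lintegral_image_eq_lintegral_abs_det_fderiv_mul μ (hWm n) (hWf n) (hWi n) g,
          lintegral_indicator (hfm n)]
    _ = ∫⁻ y, ∑' n, (f '' W n).indicator g y ∂μ :=
        (lintegral_tsum fun n => (hg.indicator (hfm n)).aemeasurable).symm
    _ = ∫⁻ y, k * S.indicator g y ∂μ := by
        refine lintegral_congr_ae ?_
        filter_upwards [hk] with y hy
        have h1 : ∑' n, (f '' W n).indicator g y = {n | y ∈ f '' W n}.encard * g y := by
          rw [← ENNReal.tsum_set_const, tsum_subtype {n | y ∈ f '' W n} (fun _ => g y)]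
          rfl
        -- Each preimage of y lies in exactly one piece, and a piece contains at most one, so
        -- counting pieces counts preimages.
        have h2 : {n | y ∈ f '' W n}.encard = {x ∈ U | f x = y}.encard := by
          have hex : ∀ x : E, ∃ n, x ∈ U → x ∈ W n := by
            intro x
            by_cases hx : x ∈ U
            · rw [← hWU] at hx
              obtain ⟨n, hn⟩ := mem_iUnion.mp hx
              exact ⟨n, fun _ => hn⟩
            · exact ⟨0, fun h => absurd h hx⟩
          choose idx hidx using hex
          have himg : {n | y ∈ f '' W n} = idx '' {x ∈ U | f x = y} := by
            ext n
            constructor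
            · rintro ⟨x, hx, rfl⟩
              refine ⟨x, ⟨hx.1, rfl⟩, ?_⟩
              by_contra hne
              exact (hWd hne).le_bot ⟨hidx x hx.1, hx⟩
            · rintro ⟨x, ⟨hx, rfl⟩, rfl⟩
              exact ⟨x, hidx x hx, rfl⟩
          rw [himg, InjOn.encard_image]
          rintro x₁ ⟨h1, h1'⟩ x₂ ⟨h2, h2'⟩ he
          exact hWi (idx x₁) (hidx x₁ h1) (he ▸ hidx x₂ h2) (h1'.trans h2'.symm)
        rw [h1, h2]
        by_cases hyS : y ∈ S
        · rw [hy hyS, indicator_of_mem hyS]; simp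
        · rw [indicator_of_notMem hyS, mul_zero]
          have : {x ∈ U | f x = y} = ∅ := by
            ext x
            simp only [mem_ofPred_eq, mem_empty_iff_false, iff_false, not_and]
            rintro hx rfl
            exact hyS (hmaps hx)
          rw [this]; simp
    _ = k * ∫⁻ y in S, g y ∂μ := by
        rw [lintegral_const_mul _ (hg.indicator hS), lintegral_indicator hS]

lemma exists_injOn_of_hasStrictDerivAt {𝕜 : Type*} [RCLike 𝕜] {f : 𝕜 → 𝕜} {f' a : 𝕜}
    (hf : HasStrictDerivAt f f' a) (h : f' ≠ 0) : ∃ V ∈ 𝓝 a, InjOn f V := by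
  have h1 := hf.hasStrictFDerivAt_equiv h
  exact ⟨(h1.toOpenPartialHomeomorph f).source,
    (h1.toOpenPartialHomeomorph f).open_source.mem_nhds h1.mem_toOpenPartialHomeomorph_source,
    (h1.toOpenPartialHomeomorph f).injOn⟩

theorem setLIntegral_abs_deriv_mul_comp_eq {U S : Set ℝ} (hU : MeasurableSet U)
    (hS : MeasurableSet S) {f f' : ℝ → ℝ} (hf' : ∀ x ∈ U, HasStrictDerivAt f (f' x) x)
    (h0 : ∀ x ∈ U, f' x ≠ 0) (hmaps : MapsTo f U S) {k : ℕ}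
    (hk : ∀ᵐ y, y ∈ S → {x ∈ U | f x = y}.encard = k) {g : ℝ → ℝ≥0∞} (hg : Measurable g) :
    ∫⁻ x in U, ENNReal.ofReal |f' x| * g (f x) = k * ∫⁻ y in S, g y := by
  rw [← setLIntegral_abs_det_fderiv_mul_comp_eq volume hU hS
    (fun x hx => (hf' x hx).hasDerivAt.hasFDerivAt)
    (fun x hx => exists_injOn_of_hasStrictDerivAt (hf' x hx) (h0 x hx)) hmaps hk hg]
  simp only [ContinuousLinearMap.det_toSpanSingleton]

theorem setLIntegral_norm_deriv_sq_mul_comp_eq {U S : Set ℂ} (hU : MeasurableSet U)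
    (hS : MeasurableSet S) {f f' : ℂ → ℂ} (hf' : ∀ x ∈ U, HasStrictDerivAt f (f' x) x)
    (h0 : ∀ x ∈ U, f' x ≠ 0) (hmaps : MapsTo f U S) {k : ℕ}
    (hk : ∀ᵐ y, y ∈ S → {x ∈ U | f x = y}.encard = k) {g : ℂ → ℝ≥0∞} (hg : Measurable g) :
    ∫⁻ x in U, ENNReal.ofReal (‖f' x‖ ^ 2) * g (f x) = k * ∫⁻ y in S, g y := by
  rw [← setLIntegral_abs_det_fderiv_mul_comp_eq volume hU hS
    (fun x hx => (hf' x hx).hasDerivAt.hasFDerivAt.restrictScalars ℝ)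
    (fun x hx => exists_injOn_of_hasStrictDerivAt (hf' x hx) (h0 x hx)) hmaps hk hg]
  have : ∀ z : ℂ, ((ContinuousLinearMap.toSpanSingleton ℂ z).restrictScalars ℝ).det = ‖z‖ ^ 2 := by
    intro z
    simp [ContinuousLinearMap.det, LinearMap.det_restrictScalars,
      Algebra.norm_complex_eq, Complex.normSq_eq_norm_sq]
  simp only [this, abs_pow, abs_norm]

/-- The periods of the two components of `y² = c(x - e₁)(x - e₂)(x - e₃)` agree. -/
theorem lintegral_Ioo_eq_lintegral_Ioi_of_cubic {e₁ e₂ e₃ c : ℝ} (h₁₂ : e₁ < e₂) (h₂₃ : e₂ ≤ e₃)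
    (hc : 0 < c) :
    ∫⁻ x in Ioo e₁ e₂, (ENNReal.ofReal √(c * ((x - e₁) * (x - e₂) * (x - e₃))))⁻¹ =
      ∫⁻ x in Ioi e₃, (ENNReal.ofReal √(c * ((x - e₁) * (x - e₂) * (x - e₃))))⁻¹ := by
  have h₁₃ : e₁ < e₃ := h₁₂.trans_le h₂₃
  set D := (e₂ - e₁) * (e₃ - e₁) with hD
  have hD0 : 0 < D := mul_pos (by linarith) (by linarith)
  -- The Möbius involution that exchanges e₁ with ∞ and e₂ with e₃. For distinct roots it is the
  -- effect on x of translation by the 2-torsion point (e₁, 0), which explains why it preserves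
  -- |dx|/√(cubic).
  set m : ℝ → ℝ := fun x => e₁ + D / (x - e₁) with hm
  have himg : m '' Ioi e₃ = Ioo e₁ e₂ := by
    ext t
    constructor
    · rintro ⟨x, hx, rfl⟩
      have hx' : e₃ < x := hx
      have hx1 : 0 < x - e₁ := by linarith
      refine ⟨by simp only [hm]; linarith [div_pos hD0 hx1], ?_⟩
      have : D / (x - e₁) < e₂ - e₁ := by
        rw [div_lt_iff₀ hx1, hD]
        exact mul_lt_mul_of_pos_left (by linarith) (by linarith)
      simp only [hm]; linarith
    · rintro ⟨h1, h2⟩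
      have ht : 0 < t - e₁ := by linarith
      refine ⟨e₁ + D / (t - e₁), ?_, ?_⟩
      · have : e₃ - e₁ < D / (t - e₁) := by
          rw [lt_div_iff₀ ht, hD, mul_comm]
          exact mul_lt_mul_of_pos_right (by linarith) (by linarith)
        simp only [mem_Ioi]; linarith
      · simp only [hm, add_sub_cancel_left]
        rw [div_div_cancel₀ hD0.ne']; ring
  have hder : ∀ x ∈ Ioi e₃, HasDerivWithinAt m (-D / (x - e₁) ^ 2) (Ioi e₃) x := by
    intro x hx
    have hx1 : x - e₁ ≠ 0 := by have : e₃ < x := hx; linarith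
    have h1 : HasDerivAt (fun x => x - e₁) 1 x := (hasDerivAt_id x).sub_const e₁
    have h2 := (((hasDerivAt_const x D).div h1 hx1).const_add e₁).hasDerivWithinAt (s := Ioi e₃)
    exact h2.congr_deriv (by ring)
  have hinj : InjOn m (Ioi e₃) := by
    intro x hx y hy hxy
    have hx1 : x - e₁ ≠ 0 := by have : e₃ < x := hx; linarith
    have hy1 : y - e₁ ≠ 0 := by have : e₃ < y := hy; linarith
    simp only [hm, add_right_inj] at hxy
    rw [div_eq_div_iff hx1 hy1] at hxy
    have := mul_left_cancel₀ hD0.ne' hxy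
    linarith
  rw [← himg, lintegral_image_eq_lintegral_abs_deriv_mul measurableSet_Ioi hder hinj]
  refine setLIntegral_congr_fun measurableSet_Ioi fun x hx => ?_
  have hx' : e₃ < x := hx
  have hx1 : 0 < x - e₁ := by linarith
  have hx2 : 0 < x - e₂ := by linarith
  have hx3 : 0 < x - e₃ := by linarith
  have hpos : 0 < c * ((x - e₁) * (x - e₂) * (x - e₃)) := by positivity
  have hq : 0 < D / (x - e₁) ^ 2 := by positivity
  have h1 : c * ((m x - e₁) * (m x - e₂) * (m x - e₃)) =
      (D / (x - e₁) ^ 2) ^ 2 * (c * ((x - e₁) * (x - e₂) * (x - e₃))) := by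
    simp only [hm, hD]
    field_simp
    ring
  have h2 : |-D / (x - e₁) ^ 2| = D / (x - e₁) ^ 2 := by
    rw [neg_div, abs_neg, abs_of_pos hq]
  rw [h1, h2, Real.sqrt_mul (sq_nonneg _), Real.sqrt_sq hq.le, ENNReal.ofReal_mul hq.le,
    ENNReal.mul_inv (by simp) (by simp), ← mul_assoc,
    ENNReal.mul_inv_cancel (by simpa using hq) ENNReal.ofReal_ne_top, one_mul]

end MeasureTheory

end

/-! ### The period integrals are finite and non-zero. -/

noncomputable section

namespace MeasureTheory

open Set Filter Topology
open scoped ENNReal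

/-- The weight `(|u|^(1/2) max(δ, |u|))⁻¹` is integrable on the line. -/
lemma lintegral_inv_sqrt_abs_mul_max_lt_top {δ : ℝ} (hδ : 0 < δ) :
    ∫⁻ u : ℝ, (ENNReal.ofReal (√|u| * max δ |u|))⁻¹ < ∞ := by
  have hpos : ∫⁻ u in Ioi (0 : ℝ), (ENNReal.ofReal (√|u| * max δ |u|))⁻¹ < ∞ := by
    -- The weight is bounded by a multiple of u^(-1/2) near 0 and by u^(-3/2) at infinity.
    have hsplit : Ioi (0 : ℝ) = Ioc 0 δ ∪ Ioi δ := (Ioc_union_Ioi_eq_Ioi hδ.le).symm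
    rw [hsplit]
    refine (lintegral_union_le _ _ _).trans_lt (ENNReal.add_lt_top.mpr ⟨?_, ?_⟩)
    · have h1 : IntegrableOn (fun u : ℝ => δ⁻¹ * u ^ (-(1 / 2) : ℝ)) (Ioc 0 δ) := by
        have := (intervalIntegral.intervalIntegrable_rpow' (a := 0) (b := δ)
          (r := -(1 / 2)) (by norm_num)).const_mul δ⁻¹
        rwa [intervalIntegrable_iff_integrableOn_Ioc_of_le hδ.le] at this
      refine lt_of_le_of_lt (setLIntegral_mono_ae' measurableSet_Ioc ?_) h1.lintegral_lt_top
      refine Eventually.of_forall fun u hu => ?_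
      have hu0 : 0 < u := hu.1
      have hs : 0 < √u := Real.sqrt_pos.mpr hu0
      rw [abs_of_pos hu0, ← ENNReal.ofReal_inv_of_pos (by positivity)]
      apply ENNReal.ofReal_le_ofReal
      rw [Real.rpow_neg hu0.le, ← Real.sqrt_eq_rpow, mul_inv, mul_comm]
      gcongr
      exact le_max_left _ _
    · have h1 : IntegrableOn (fun u : ℝ => u ^ (-(3 / 2) : ℝ)) (Ioi δ) :=
        integrableOn_Ioi_rpow_of_lt (by norm_num) hδ
      refine lt_of_le_of_lt (setLIntegral_mono_ae' measurableSet_Ioi ?_) h1.lintegral_lt_top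
      refine Eventually.of_forall fun u hu => ?_
      have hu0 : 0 < u := hδ.trans hu
      have hs : 0 < √u := Real.sqrt_pos.mpr hu0
      rw [abs_of_pos hu0, ← ENNReal.ofReal_inv_of_pos (by positivity)]
      apply ENNReal.ofReal_le_ofReal
      have h3 : u ^ (3 / 2 : ℝ) = √u * u := by
        rw [Real.sqrt_eq_rpow, ← Real.rpow_add_one hu0.ne']; norm_num
      rw [Real.rpow_neg hu0.le, h3]
      gcongr
      exact le_max_right _ _
  have hneg : ∫⁻ u in Iio (0 : ℝ), (ENNReal.ofReal (√|u| * max δ |u|))⁻¹ =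
      ∫⁻ u in Ioi (0 : ℝ), (ENNReal.ofReal (√|u| * max δ |u|))⁻¹ := by
    have h1 := (Measure.measurePreserving_neg (volume : Measure ℝ)).setLIntegral_comp_preimage
      (s := Ioi 0) measurableSet_Ioi
      (f := fun u => (ENNReal.ofReal (√|u| * max δ |u|))⁻¹) (by fun_prop)
    rw [← h1]
    simp
  have hae : ∫⁻ u : ℝ, (ENNReal.ofReal (√|u| * max δ |u|))⁻¹ =
      ∫⁻ u in Iio (0 : ℝ) ∪ Ioi 0, (ENNReal.ofReal (√|u| * max δ |u|))⁻¹ := by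
    rw [Iio_union_Ioi, restrict_compl_singleton]
  rw [hae]
  refine (lintegral_union_le _ _ _).trans_lt ?_
  rw [hneg]
  exact ENNReal.add_lt_top.mpr ⟨hpos, hpos⟩

/-- The weight `(‖z‖ max(δ, ‖z‖)²)⁻¹` is integrable on the plane. -/
lemma lintegral_inv_norm_mul_max_sq_lt_top {δ : ℝ} (hδ : 0 < δ) :
    ∫⁻ z : ℂ, (ENNReal.ofReal (‖z‖ * max δ ‖z‖ ^ 2))⁻¹ < ∞ := by
  set g : ℝ → ℝ≥0∞ := fun u => (ENNReal.ofReal (√|u| * max δ |u|))⁻¹ with hg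
  have hgm : Measurable g := by fun_prop
  -- Both |Re z| and |Im z| are at most |z|, so the plane weight is dominated by a product of line
  -- weights, and Tonelli applies.
  have hle : ∀ z : ℂ, (ENNReal.ofReal (‖z‖ * max δ ‖z‖ ^ 2))⁻¹ ≤ g z.re * g z.im := by
    intro z
    rw [hg, ← ENNReal.mul_inv (.inr ENNReal.ofReal_ne_top) (.inl ENNReal.ofReal_ne_top),
      ENNReal.inv_le_inv,
      ← ENNReal.ofReal_mul (by positivity)]
    apply ENNReal.ofReal_le_ofReal
    have h1 := Complex.abs_re_le_norm z
    have h2 := Complex.abs_im_le_norm z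
    calc √|z.re| * max δ |z.re| * (√|z.im| * max δ |z.im|)
        ≤ √‖z‖ * max δ ‖z‖ * (√‖z‖ * max δ ‖z‖) := by gcongr
      _ = (√‖z‖ * √‖z‖) * max δ ‖z‖ ^ 2 := by ring
      _ = ‖z‖ * max δ ‖z‖ ^ 2 := by rw [Real.mul_self_sqrt (norm_nonneg z)]
  refine (lintegral_mono hle).trans_lt ?_
  have h3 := Complex.volume_preserving_equiv_real_prod.lintegral_comp
    (f := fun p : ℝ × ℝ => g p.1 * g p.2) (by fun_prop)
  have h4 : ∫⁻ z : ℂ, g z.re * g z.im = ∫⁻ p : ℝ × ℝ, g p.1 * g p.2 := h3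
  rw [h4, Measure.volume_eq_prod, lintegral_prod_mul hgm.aemeasurable hgm.aemeasurable]
  exact ENNReal.mul_lt_top (lintegral_inv_sqrt_abs_mul_max_lt_top hδ)
    (lintegral_inv_sqrt_abs_mul_max_lt_top hδ)

/-- A cubic polynomial with distinct roots is bounded below by the distance to the nearest root. -/
lemma exists_norm_mul_max_sq_le {e : Fin 3 → ℂ} (he : Function.Injective e) :
    ∃ δ > 0, ∀ z : ℂ, ∃ i, ‖z - e i‖ * max δ ‖z - e i‖ ^ 2 ≤ ∏ j, ‖z - e j‖ := by
  -- Half the least distance between roots: every root other than the nearest one is then at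
  -- distance at least δ from z.
  obtain ⟨δ, hδ, hsep⟩ : ∃ δ > 0, ∀ i j, i ≠ j → 2 * δ ≤ ‖e i - e j‖ := by
    have h1 : ∀ i j, i ≠ j → 0 < ‖e i - e j‖ := fun i j hij =>
      norm_pos_iff.mpr (sub_ne_zero.mpr (he.ne hij))
    refine ⟨min (min ‖e 0 - e 1‖ ‖e 0 - e 2‖) ‖e 1 - e 2‖ / 2, ?_, ?_⟩
    · have := h1 0 1 (by decide); have := h1 0 2 (by decide); have := h1 1 2 (by decide)
      positivity
    · intro i j hij
      rw [mul_div_cancel₀ _ two_ne_zero]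
      have h10 := norm_sub_rev (e 1) (e 0)
      have h20 := norm_sub_rev (e 2) (e 0)
      have h21 := norm_sub_rev (e 2) (e 1)
      fin_cases i <;> fin_cases j <;> simp [h10, h20, h21] at hij ⊢
  refine ⟨δ, hδ, fun z => ?_⟩
  obtain ⟨i, hi⟩ := Finite.exists_min (fun i => ‖z - e i‖)
  have hfar : ∀ j, j ≠ i → max δ ‖z - e i‖ ≤ ‖z - e j‖ := by
    intro j hj
    refine max_le ?_ (hi j)
    have h1 := hsep j i hj
    have h2 : ‖e j - e i‖ ≤ ‖z - e j‖ + ‖z - e i‖ := by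
      have := norm_sub_le (z - e i) (z - e j)
      rw [sub_sub_sub_cancel_left] at this
      linarith
    have := hi j
    linarith
  refine ⟨i, ?_⟩
  have hm : 0 ≤ max δ ‖z - e i‖ := hδ.le.trans (le_max_left _ _)
  have key : ∀ a b : ℝ, max δ ‖z - e i‖ ≤ a → max δ ‖z - e i‖ ≤ b →
      ‖z - e i‖ * max δ ‖z - e i‖ ^ 2 ≤ ‖z - e i‖ * (a * b) := by
    intro a b ha hb
    rw [sq]
    gcongr
    exact hm.trans ha
  rw [Fin.prod_univ_three]
  fin_cases i
  · exact (key _ _ (hfar 1 (by decide)) (hfar 2 (by decide))).trans_eq (by simp; ring)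
  · exact (key _ _ (hfar 0 (by decide)) (hfar 2 (by decide))).trans_eq (by simp; ring)
  · exact (key _ _ (hfar 0 (by decide)) (hfar 1 (by decide))).trans_eq (by simp; ring)

end MeasureTheory

namespace WeierstrassCurve

open Set MeasureTheory
open scoped ENNReal

lemma exists_norm_aeval_Ψ₂Sq_eq {K : Type*} [Field K] [Algebra K ℂ] (E : WeierstrassCurve K)
    [E.IsElliptic] : ∃ e : Fin 3 → ℂ, Function.Injective e ∧
      ∀ z : ℂ, ‖aeval z E.Ψ₂Sq‖ = 4 * ∏ j, ‖z - e j‖ := by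
  have : CharZero K := (algebraMap K ℂ).charZero
  set Q := E.Ψ₂Sq.map (algebraMap K ℂ) with hQ
  have hsep : Q.Separable := E.Ψ₂Sq_separable.map
  have hdeg : Q.natDegree = 3 := by rw [hQ, natDegree_map, E.natDegree_Ψ₂Sq']
  have hlead : Q.leadingCoeff = 4 := by
    rw [leadingCoeff, hdeg, hQ, coeff_map, Ψ₂Sq]
    simp [map_ofNat]
  have hspl : Q.Splits := IsAlgClosed.splits Q
  have hcard : Q.roots.card = 3 := by rw [← hspl.natDegree_eq_card_roots, hdeg]
  obtain ⟨x, y, z, hxyz⟩ := Multiset.card_eq_three.mp hcard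
  have hnd : Q.roots.Nodup := nodup_roots hsep
  refine ⟨![x, y, z], ?_, fun t => ?_⟩
  · rw [hxyz] at hnd
    simp at hnd
    obtain ⟨⟨h1, h2⟩, h3⟩ := hnd
    intro i j hij
    fin_cases i <;> fin_cases j <;> simp_all
  · have h1 := hspl.eq_prod_roots
    rw [hxyz, hlead] at h1
    rw [← eval_map_algebraMap, ← hQ, h1, Fin.prod_univ_three]
    simp [mul_assoc]

/-- The integral of `dx / √(4 x³ + b₂x² + 2 b₄x + b₆)` over the real points. -/
def realIntegral (E : WeierstrassCurve ℝ) : ℝ≥0∞ :=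
  ∫⁻ x in {x : ℝ | 0 < aeval x E.Ψ₂Sq}, (ENNReal.ofReal √(aeval x E.Ψ₂Sq))⁻¹

/-- The integral of `|4 x³ + b₂x² + 2 b₄x + b₆|⁻¹` over the complex plane. -/
def complexIntegral (E : WeierstrassCurve ℂ) : ℝ≥0∞ :=
  ∫⁻ x : ℂ, (ENNReal.ofReal ‖aeval x E.Ψ₂Sq‖)⁻¹

/-- At each z the integrand is bounded by the weight centred at the nearest root. Finiteness matters
because `toReal` would turn an infinite period into 0. -/
lemma complexIntegral_lt_top (E : WeierstrassCurve ℂ) [E.IsElliptic] : E.complexIntegral < ∞ := by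
  obtain ⟨e, he, hE⟩ := E.exists_norm_aeval_Ψ₂Sq_eq
  obtain ⟨δ, hδ, h⟩ := exists_norm_mul_max_sq_le he
  have hle : ∀ z : ℂ, (ENNReal.ofReal ‖aeval z E.Ψ₂Sq‖)⁻¹ ≤
      ∑ i, (ENNReal.ofReal (‖z - e i‖ * max δ ‖z - e i‖ ^ 2))⁻¹ := by
    intro z
    obtain ⟨i, hi⟩ := h z
    refine le_trans ?_ (Finset.single_le_sum (f := fun i =>
      (ENNReal.ofReal (‖z - e i‖ * max δ ‖z - e i‖ ^ 2))⁻¹) (fun _ _ => zero_le)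
      (Finset.mem_univ i))
    rw [ENNReal.inv_le_inv]
    apply ENNReal.ofReal_le_ofReal
    rw [hE]
    have : 0 ≤ ∏ j, ‖z - e j‖ := Finset.prod_nonneg fun _ _ => norm_nonneg _
    linarith
  refine (lintegral_mono hle).trans_lt ?_
  rw [lintegral_finsetSum _ (fun i _ => by fun_prop), ENNReal.sum_lt_top]
  intro i _
  rw [lintegral_sub_right_eq_self (fun z : ℂ => (ENNReal.ofReal (‖z‖ * max δ ‖z‖ ^ 2))⁻¹)]
  exact lintegral_inv_norm_mul_max_sq_lt_top hδ

lemma realIntegral_lt_top (E : WeierstrassCurve ℝ) [E.IsElliptic] : E.realIntegral < ∞ := by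
  obtain ⟨e, he, hE⟩ := E.exists_norm_aeval_Ψ₂Sq_eq
  obtain ⟨δ, hδ, h⟩ := exists_norm_mul_max_sq_le he
  -- Non-real roots need no separate treatment: for real x the distance to a root is at least the
  -- distance to its real part.
  have hle : ∀ x : ℝ, 0 < aeval x E.Ψ₂Sq → (ENNReal.ofReal √(aeval x E.Ψ₂Sq))⁻¹ ≤
      ∑ i, (ENNReal.ofReal (√|x - (e i).re| * max δ |x - (e i).re|))⁻¹ := by
    intro x hx
    obtain ⟨i, hi⟩ := h x
    refine le_trans ?_ (Finset.single_le_sum (f := fun i =>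
      (ENNReal.ofReal (√|x - (e i).re| * max δ |x - (e i).re|))⁻¹) (fun _ _ => zero_le)
      (Finset.mem_univ i))
    rw [ENNReal.inv_le_inv]
    apply ENNReal.ofReal_le_ofReal
    have hm : 0 ≤ max δ |x - (e i).re| := hδ.le.trans (le_max_left _ _)
    apply Real.le_sqrt_of_sq_le
    rw [mul_pow, Real.sq_sqrt (abs_nonneg _)]
    have h1 : |x - (e i).re| ≤ ‖(x : ℂ) - e i‖ := by
      simpa using Complex.abs_re_le_norm ((x : ℂ) - e i)
    have h2 : aeval x E.Ψ₂Sq = ‖aeval (x : ℂ) E.Ψ₂Sq‖ := by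
      rw [Isogeny.HasRationalForm.aeval_ofReal_eq, Complex.norm_real, Real.norm_of_nonneg hx.le]
    have h3 : 0 ≤ ∏ j, ‖(x : ℂ) - e j‖ := Finset.prod_nonneg fun _ _ => norm_nonneg _
    calc |x - (e i).re| * max δ |x - (e i).re| ^ 2
        ≤ ‖(x : ℂ) - e i‖ * max δ ‖(x : ℂ) - e i‖ ^ 2 := by gcongr
      _ ≤ ∏ j, ‖(x : ℂ) - e j‖ := hi
      _ ≤ aeval x E.Ψ₂Sq := by rw [h2, hE]; linarith
  refine (setLIntegral_mono' ?_ hle).trans_lt ?_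
  · exact (isOpen_lt continuous_const (Polynomial.continuous_aeval _)).measurableSet
  refine (setLIntegral_le_lintegral _ _).trans_lt ?_
  rw [lintegral_finsetSum _ (fun i _ => by fun_prop), ENNReal.sum_lt_top]
  intro i _
  rw [lintegral_sub_right_eq_self (fun x : ℝ => (ENNReal.ofReal (√|x| * max δ |x|))⁻¹)]
  exact lintegral_inv_sqrt_abs_mul_max_lt_top hδ

lemma complexIntegral_ne_zero (E : WeierstrassCurve ℂ) : E.complexIntegral ≠ 0 := by
  rw [complexIntegral, Ne, lintegral_eq_zero_iff (by fun_prop)]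
  intro h0
  have : ∀ᵐ x : ℂ, False := by
    filter_upwards [h0] with x hx
    simp at hx
  rw [Filter.eventually_false_iff_eq_bot, ae_eq_bot] at this
  exact NeZero.ne _ this

lemma realIntegral_ne_zero (E : WeierstrassCurve ℝ) : E.realIntegral ≠ 0 := by
  have hopen : IsOpen {x : ℝ | 0 < aeval x E.Ψ₂Sq} :=
    isOpen_lt continuous_const (Polynomial.continuous_aeval _)
  rw [realIntegral, Ne, lintegral_eq_zero_iff (by fun_prop)]
  intro h0
  have h1 : ∀ᵐ x ∂(volume.restrict {x : ℝ | 0 < aeval x E.Ψ₂Sq}), False := by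
    filter_upwards [h0] with x hx
    simp at hx
  simp only [Filter.eventually_false_iff_eq_bot, ae_eq_bot, Measure.restrict_eq_zero] at h1
  rw [hopen.measure_eq_zero_iff volume] at h1
  have h2 : Filter.Tendsto (fun x : ℝ => eval x E.Ψ₂Sq) Filter.atTop Filter.atTop := by
    have hdeg := E.natDegree_Ψ₂Sq'
    refine Polynomial.tendsto_atTop_of_leadingCoeff_nonneg _ ?_ ?_
    · rw [degree_eq_natDegree E.Ψ₂Sq_ne_zero', hdeg]; norm_num
    · rw [leadingCoeff, hdeg, Ψ₂Sq]
      simp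
  obtain ⟨x, hx⟩ := (h2.eventually_gt_atTop 0).exists
  have : x ∈ {x : ℝ | 0 < aeval x E.Ψ₂Sq} := by simpa [coe_aeval_eq_eval] using hx
  rw [h1] at this
  exact this

end WeierstrassCurve

end

/-! ### The periods as integrals in x. -/

noncomputable section

namespace WeierstrassCurve

open Set MeasureTheory
open scoped ENNReal

section Periods

lemma equation_iff_sq_eq {K : Type*} [Field K] [CharZero K] (E : WeierstrassCurve K) (x y : K) :
    E.toAffine.Equation x y ↔ (2 * y + E.a₁ * x + E.a₃) ^ 2 = aeval x E.Ψ₂Sq := by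
  rw [Affine.equation_iff', aeval_Ψ₂Sq]
  simp only [Algebra.algebraMap_self, RingHom.id_apply, b₂, b₄, b₆]
  constructor
  · intro h; linear_combination 4 * h
  · intro h; linear_combination h / 4

lemma tsum_equation {K : Type*} [Field K] [CharZero K] (E : WeierstrassCurve K) {x e : K}
    (he : e ^ 2 = aeval x E.Ψ₂Sq) (he0 : e ≠ 0) (f : K → ℝ≥0∞) :
    ∑' y : {y // E.toAffine.Equation x y}, f y = f (E.yOfEta x e) + f (E.yOfEta x (-e)) := by
  classical
  have h1 : ∀ y, E.toAffine.Equation x y ↔ y ∈ ({E.yOfEta x e, E.yOfEta x (-e)} : Finset K) := by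
    intro y
    rw [equation_iff_sq_eq, ← he, sq_eq_sq_iff_eq_or_eq_neg, Finset.mem_insert,
      Finset.mem_singleton]
    have h2 : ∀ c, 2 * y + E.a₁ * x + E.a₃ = c ↔ y = E.yOfEta x c := by
      intro c
      rw [yOfEta, eq_div_iff two_ne_zero]
      simp only [Algebra.algebraMap_self, RingHom.id_apply]
      constructor
      · intro h; linear_combination h
      · intro h; linear_combination h
    rw [h2, h2]
  have hne : E.yOfEta x e ≠ E.yOfEta x (-e) := by
    intro h
    have := congrArg (E.etaAt x) h
    rw [etaAt_yOfEta, etaAt_yOfEta] at this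
    exact he0 (self_eq_neg.mp this)
  rw [← Finset.sum_pair hne, ← Finset.tsum_subtype]
  exact (Equiv.subtypeEquivRight h1).tsum_eq (fun y => f y)

lemma density_yOfEta {K : Type*} [Field K] [CharZero K] {E : WeierstrassCurve K}
    (ω : E.InvariantDifferential) (x e : K) : ω.density x (E.yOfEta x e) = ω.coeff / e := by
  have := E.etaAt_yOfEta x e
  rw [etaAt] at this
  simp only [Algebra.algebraMap_self, RingHom.id_apply] at this
  rw [InvariantDifferential.density, this]

/-- The factor 2 comes from the two points ±η above x. Where Ψ₂(x) < 0 there are no points, and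
where Ψ₂(x) = 0 the density is a quotient by zero, which is 0 by convention. -/
lemma realPeriod_eq (E : WeierstrassCurve ℝ) (ω : E.InvariantDifferential) :
    E.realPeriod ω = 2 * |(ω.coeff : ℝ)| * E.realIntegral.toReal := by
  have hm : MeasurableSet {x : ℝ | 0 < aeval x E.Ψ₂Sq} :=
    (isOpen_lt continuous_const (Polynomial.continuous_aeval _)).measurableSet
  have h1 : ∀ x : ℝ, ∑' y : {y : ℝ // E.toAffine.Equation x y}, ENNReal.ofReal |ω.density x y| =
      {x : ℝ | 0 < aeval x E.Ψ₂Sq}.indicator (fun x => ENNReal.ofReal (2 * |(ω.coeff : ℝ)|) *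
        (ENNReal.ofReal √(aeval x E.Ψ₂Sq))⁻¹) x := by
    intro x
    by_cases hx : 0 < aeval x E.Ψ₂Sq
    · have hs := Real.sqrt_pos.mpr hx
      rw [indicator_of_mem (by exact hx), E.tsum_equation (Real.sq_sqrt hx.le) hs.ne'
        (fun y => ENNReal.ofReal |ω.density x y|), density_yOfEta, density_yOfEta, div_neg, abs_neg,
        ← ENNReal.ofReal_add (abs_nonneg _) (abs_nonneg _), ← ENNReal.ofReal_inv_of_pos hs,
        ← ENNReal.ofReal_mul (by positivity), abs_div, abs_of_pos hs]
      congr 1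
      rw [div_eq_mul_inv]; ring
    · rw [indicator_of_notMem (by exact hx), ENNReal.tsum_eq_zero]
      rintro ⟨y, hy⟩
      rw [equation_iff_sq_eq] at hy
      have h2 : 2 * y + E.a₁ * x + E.a₃ = 0 := by
        have := sq_nonneg (2 * y + E.a₁ * x + E.a₃)
        have h3 : (2 * y + E.a₁ * x + E.a₃) ^ 2 = 0 := by linarith
        exact pow_eq_zero_iff two_ne_zero |>.mp h3
      simp [InvariantDifferential.density, h2]
  rw [realPeriod]
  simp only [h1]
  rw [lintegral_indicator hm, lintegral_const_mul _ (by fun_prop), ENNReal.toReal_mul,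
    ENNReal.toReal_ofReal (by positivity)]
  rfl

lemma finite_setOf_aeval_eq_zero {K : Type*} [Field K] {p : K[X]} (hp : p ≠ 0) :
    {x : K | aeval x p = 0}.Finite := by
  refine (p.rootSet_finite K).subset fun x hx => ?_
  rw [mem_rootSet]
  exact ⟨hp, hx⟩

/-- The constant 8 is a product of three factors 2: from the definition of the period, from |dx ∧
dx̄|, and from the two points ±η. -/
lemma complexPeriod_eq (E : WeierstrassCurve ℂ) (ω : E.InvariantDifferential) :
    E.complexPeriod ω = 8 * ‖(ω.coeff : ℂ)‖ ^ 2 * E.complexIntegral.toReal := by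
  have h1 : ∀ x : ℂ, aeval x E.Ψ₂Sq ≠ 0 →
      ∑' y : {y : ℂ // E.toAffine.Equation x y}, ENNReal.ofReal (2 * ‖ω.density x y‖ ^ 2) =
        ENNReal.ofReal (4 * ‖(ω.coeff : ℂ)‖ ^ 2) * (ENNReal.ofReal ‖aeval x E.Ψ₂Sq‖)⁻¹ := by
    intro x hx
    obtain ⟨e, he⟩ := IsAlgClosed.exists_pow_nat_eq (aeval x E.Ψ₂Sq) (n := 2) two_pos
    have he0 : e ≠ 0 := by rintro rfl; apply hx; rw [← he]; simp
    have hp : 0 < ‖aeval x E.Ψ₂Sq‖ := norm_pos_iff.mpr hx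
    rw [E.tsum_equation he he0 (fun y => ENNReal.ofReal (2 * ‖ω.density x y‖ ^ 2)), density_yOfEta,
      density_yOfEta, div_neg, norm_neg, ← ENNReal.ofReal_add (by positivity) (by positivity),
      ← ENNReal.ofReal_inv_of_pos hp, ← ENNReal.ofReal_mul (by positivity), norm_div, div_pow,
      ← norm_pow, ← norm_pow, he]
    congr 1
    rw [norm_pow, div_eq_mul_inv]; ring
  have h2 : ∫⁻ x : ℂ, ∑' y : {y : ℂ // E.toAffine.Equation x y},
      ENNReal.ofReal (2 * ‖ω.density x y‖ ^ 2) =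
      ∫⁻ x : ℂ, ENNReal.ofReal (4 * ‖(ω.coeff : ℂ)‖ ^ 2) *
        (ENNReal.ofReal ‖aeval x E.Ψ₂Sq‖)⁻¹ := by
    refine lintegral_congr_ae ?_
    have h0 : ∀ᵐ x : ℂ, x ∉ {x : ℂ | aeval x E.Ψ₂Sq = 0} :=
      measure_eq_zero_iff_ae_notMem.mp
        ((finite_setOf_aeval_eq_zero E.Ψ₂Sq_ne_zero').measure_zero volume)
    filter_upwards [h0] with x hx
    exact h1 x hx
  rw [complexPeriod, h2, lintegral_const_mul _ (by fun_prop), ENNReal.toReal_mul,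
    ENNReal.toReal_ofReal (by positivity), complexIntegral]
  ring

end Periods

/-! ### Comparison of the periods by the substitution t = A(x)/B(x). -/

namespace Isogeny.HasRationalForm

lemma hasStrictDerivAt_div {𝕜 : Type*} [RCLike 𝕜] [Algebra 𝕜 ℂ] {E E' : WeierstrassCurve 𝕜}
    {φ : Isogeny E E'} {A B w : 𝕜[X]} {β : 𝕜} (h : φ.HasRationalForm A B w β) {x : 𝕜}
    (hB : aeval x B ≠ 0) : HasStrictDerivAt (fun x => aeval x A / aeval x B)
      (β * aeval x w / aeval x B ^ 2) x := by
  have h1 := (A.hasStrictDerivAt_aeval x).div (B.hasStrictDerivAt_aeval x) hB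
  refine h1.congr_deriv ?_
  have h2 := congrArg (aeval x) h.wronskian_eq
  simp only [wronskian, map_sub, map_mul, aeval_C, Algebra.algebraMap_self, RingHom.id_apply] at h2
  rw [← h2]
  ring

lemma Ψ₂Sq_div_eq {K : Type*} [Field K] [Algebra K ℂ] {E E' : WeierstrassCurve K}
    {φ : Isogeny E E'} {A B w : K[X]} {β : K} (h : φ.HasRationalForm A B w β) {x : K}
    (hB : aeval x B ≠ 0) : aeval (aeval x A / aeval x B) E'.Ψ₂Sq =
      aeval x E.Ψ₂Sq * (aeval x w / aeval x B ^ 2) ^ 2 := by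
  have h1 := h.Ψ₂Sq_mul_sq_eq (x := x) (t := aeval x A / aeval x B) (div_mul_cancel₀ _ hB)
  rw [div_pow, ← mul_div_assoc, h1]
  field_simp

/-- Off the zeros of B w Ψ₂, a finite set, the map A/B is a local diffeomorphism. The factors
|w/B²|² in |dt/dx|² and in |Ψ₂'(t)| cancel, leaving |β|². -/
lemma mul_complexIntegral_eq {E E' : WeierstrassCurve ℂ} {φ : Isogeny E E'} {A B w : ℂ[X]} {β : ℂ}
    (h : φ.HasRationalForm A B w β) (h0 : max A.natDegree B.natDegree ≠ 0) :
    ENNReal.ofReal (‖β‖ ^ 2) * E.complexIntegral =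
      (max A.natDegree B.natDegree : ℕ) * E'.complexIntegral := by
  set U : Set ℂ := {x | aeval x (B * w * E.Ψ₂Sq) ≠ 0} with hU
  set S : Set ℂ := {t | aeval t E'.Ψ₂Sq ≠ 0} with hS
  have hUm : MeasurableSet U :=
    (isOpen_ne_fun (Polynomial.continuous_aeval _) continuous_const).measurableSet
  have hSm : MeasurableSet S :=
    (isOpen_ne_fun (Polynomial.continuous_aeval _) continuous_const).measurableSet
  have hU' : ∀ {x}, x ∈ U ↔ aeval x B ≠ 0 ∧ aeval x w ≠ 0 ∧ aeval x E.Ψ₂Sq ≠ 0 := by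
    intro x
    simp [hU, and_assoc]
  have hUc : volume Uᶜ = 0 := by
    refine Set.Finite.measure_zero ?_ _
    have hne : B * w * E.Ψ₂Sq ≠ 0 :=
      mul_ne_zero (mul_ne_zero h.B_ne_zero h.w_ne_zero) E.Ψ₂Sq_ne_zero'
    refine (finite_setOf_aeval_eq_zero hne).subset fun x hx => ?_
    by_contra h0
    exact hx h0
  have hSc : volume Sᶜ = 0 := by
    refine Set.Finite.measure_zero ?_ _
    refine (finite_setOf_aeval_eq_zero E'.Ψ₂Sq_ne_zero').subset fun x hx => ?_
    simpa [hS] using hx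
  have hmaps : MapsTo (fun x => aeval x A / aeval x B) U S := by
    intro x hx
    obtain ⟨h1, h2, h3⟩ := hU'.mp hx
    rw [hS, mem_ofPred_eq, h.Ψ₂Sq_div_eq h1]
    exact mul_ne_zero h3 (pow_ne_zero 2 (div_ne_zero h2 (pow_ne_zero 2 h1)))
  obtain ⟨t₀, ht₀⟩ := h.exists_natDegree_sub_eq ℂ
  have hfib : ∀ᵐ t : ℂ, t ∈ S → {x ∈ U | aeval x A / aeval x B = t}.encard =
      (max A.natDegree B.natDegree : ℕ) := by
    have hae : ∀ᵐ t : ℂ, t ∉ ({t₀} : Set ℂ) := measure_eq_zero_iff_ae_notMem.mp (by simp)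
    filter_upwards [hae] with t ht htS
    have h1 : {x ∈ U | aeval x A / aeval x B = t} = {x | t * aeval x B = aeval x A} := by
      ext x
      constructor
      · rintro ⟨hx, rfl⟩
        exact div_mul_cancel₀ _ (hU'.mp hx).1
      · intro hx
        have hB := h.aeval_B_ne_zero_of_eq hx
        obtain ⟨h2, h3⟩ := h.ne_zero_of_eq hx htS
        exact ⟨hU'.mpr ⟨hB, h2, h3⟩, by rw [div_eq_iff hB]; exact hx.symm⟩
    have h2 := h.ncard_fiber htS (ht₀ t ht) h0
    rw [h1, ← h2, Set.Finite.cast_ncard_eq (Set.finite_of_ncard_ne_zero (by rw [h2]; exact h0))]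
  have key := setLIntegral_norm_deriv_sq_mul_comp_eq hUm hSm
    (fun x hx => h.hasStrictDerivAt_div (hU'.mp hx).1)
    (fun x hx => div_ne_zero (mul_ne_zero h.β_ne_zero (hU'.mp hx).2.1)
      (pow_ne_zero 2 (hU'.mp hx).1)) hmaps hfib
    (g := fun t => (ENNReal.ofReal ‖aeval t E'.Ψ₂Sq‖)⁻¹) (by fun_prop)
  have hL : ∀ x ∈ U, ENNReal.ofReal (‖β * aeval x w / aeval x B ^ 2‖ ^ 2) *
      (ENNReal.ofReal ‖aeval (aeval x A / aeval x B) E'.Ψ₂Sq‖)⁻¹ =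
      ENNReal.ofReal (‖β‖ ^ 2) * (ENNReal.ofReal ‖aeval x E.Ψ₂Sq‖)⁻¹ := by
    intro x hx
    obtain ⟨h1, h2, h3⟩ := hU'.mp hx
    have hq : aeval x w / aeval x B ^ 2 ≠ 0 := div_ne_zero h2 (pow_ne_zero 2 h1)
    have hq' := norm_pos_iff.mpr hq
    rw [h.Ψ₂Sq_div_eq h1, mul_div_assoc]
    set q := aeval x w / aeval x B ^ 2
    have h3' := norm_pos_iff.mpr h3
    rw [norm_mul, norm_mul, norm_pow, ← ENNReal.ofReal_inv_of_pos (by positivity),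
      ← ENNReal.ofReal_inv_of_pos h3', ← ENNReal.ofReal_mul (by positivity),
      ← ENNReal.ofReal_mul (by positivity)]
    congr 1
    field_simp
  rw [setLIntegral_congr_fun hUm hL, lintegral_const_mul _ (by fun_prop)] at key
  have e1 : U =ᵐ[volume] univ := ae_eq_univ.mpr hUc
  have e2 : S =ᵐ[volume] univ := ae_eq_univ.mpr hSc
  rw [setLIntegral_congr e1, setLIntegral_congr e2, setLIntegral_univ, setLIntegral_univ] at key
  exact key

/-- The set S plays the part of the image: it contains every attained t with Ψ₂'(t) > 0, and almost
all of its fibres have k points. It is kept general because in degree 2 the image can miss a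
component. -/
lemma mul_realIntegral_eq {E E' : WeierstrassCurve ℝ} {φ : Isogeny E E'} {A B w : ℝ[X]} {β : ℝ}
    (h : φ.HasRationalForm A B w β) {S : Set ℝ} (hSm : MeasurableSet S)
    (hS : ∀ t ∈ S, 0 < aeval t E'.Ψ₂Sq)
    (hmaps : ∀ t x : ℝ, t * aeval x B = aeval x A → 0 < aeval t E'.Ψ₂Sq → t ∈ S) {k : ℕ}
    (hk : k ≠ 0) (hfib : ∀ᵐ t : ℝ, t ∈ S → {x : ℝ | t * aeval x B = aeval x A}.ncard = k) :
    ENNReal.ofReal |β| * E.realIntegral =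
      k * ∫⁻ t in S, (ENNReal.ofReal √(aeval t E'.Ψ₂Sq))⁻¹ := by
  set U : Set ℝ := {x | 0 < aeval x E.Ψ₂Sq} ∩ {x | aeval x (B * w) ≠ 0} with hU
  have hUm : MeasurableSet U :=
    (isOpen_lt continuous_const (Polynomial.continuous_aeval _)).measurableSet.inter
    (isOpen_ne_fun (Polynomial.continuous_aeval _) continuous_const).measurableSet
  have hU' : ∀ {x}, x ∈ U ↔ 0 < aeval x E.Ψ₂Sq ∧ aeval x B ≠ 0 ∧ aeval x w ≠ 0 := by
    intro x
    simp [hU]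
  have hUae : U =ᵐ[volume] {x : ℝ | 0 < aeval x E.Ψ₂Sq} := by
    have hz : volume {x : ℝ | aeval x (B * w) ≠ 0}ᶜ = 0 := by
      refine Set.Finite.measure_zero ?_ _
      refine (finite_setOf_aeval_eq_zero
        (mul_ne_zero h.B_ne_zero h.w_ne_zero)).subset fun x hx => ?_
      by_contra h0
      exact hx h0
    have := (ae_eq_refl {x : ℝ | 0 < aeval x E.Ψ₂Sq}).inter (ae_eq_univ.mpr hz)
    rwa [inter_univ] at this
  have hpos : ∀ x ∈ U, 0 < aeval (aeval x A / aeval x B) E'.Ψ₂Sq := by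
    intro x hx
    obtain ⟨h1, h2, h3⟩ := hU'.mp hx
    rw [h.Ψ₂Sq_div_eq h2]
    have : aeval x w / aeval x B ^ 2 ≠ 0 := div_ne_zero h3 (pow_ne_zero 2 h2)
    positivity
  have hfib' : ∀ᵐ t : ℝ, t ∈ S → {x ∈ U | aeval x A / aeval x B = t}.encard = k := by
    filter_upwards [hfib] with t ht htS
    have h1 : {x ∈ U | aeval x A / aeval x B = t} = {x | t * aeval x B = aeval x A} := by
      ext x
      constructor
      · rintro ⟨hx, rfl⟩
        exact div_mul_cancel₀ _ (hU'.mp hx).2.1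
      · intro hx
        have hB := h.aeval_B_ne_zero_of_eq hx
        have ht0 := hS t htS
        obtain ⟨h2, -⟩ := h.ne_zero_of_eq hx ht0.ne'
        refine ⟨hU'.mpr ⟨?_, hB, h2⟩, by rw [div_eq_iff hB]; exact hx.symm⟩
        -- From Ψ₂(x) w(x)² = B(x)⁴ Ψ₂'(t) > 0, every real solution x lies where Ψ₂ > 0.
        have h3 := h.Ψ₂Sq_mul_sq_eq hx
        have h4 : 0 < aeval x E.Ψ₂Sq * aeval x w ^ 2 := by rw [h3]; positivity
        exact pos_of_mul_pos_left h4 (sq_nonneg _)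
    rw [h1, ← ht htS, Set.Finite.cast_ncard_eq (Set.finite_of_ncard_ne_zero (by
      rw [ht htS]; exact hk))]
  have key := setLIntegral_abs_deriv_mul_comp_eq hUm hSm
    (fun x hx => h.hasStrictDerivAt_div (hU'.mp hx).2.1)
    (fun x hx => div_ne_zero (mul_ne_zero h.β_ne_zero (hU'.mp hx).2.2)
      (pow_ne_zero 2 (hU'.mp hx).2.1))
    (fun x hx => hmaps _ x (div_mul_cancel₀ _ (hU'.mp hx).2.1) (hpos x hx)) hfib'
    (g := fun t => (ENNReal.ofReal √(aeval t E'.Ψ₂Sq))⁻¹) (by fun_prop)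
  have hL : ∀ x ∈ U, ENNReal.ofReal |β * aeval x w / aeval x B ^ 2| *
      (ENNReal.ofReal √(aeval (aeval x A / aeval x B) E'.Ψ₂Sq))⁻¹ =
      ENNReal.ofReal |β| * (ENNReal.ofReal √(aeval x E.Ψ₂Sq))⁻¹ := by
    intro x hx
    obtain ⟨h1, h2, h3⟩ := hU'.mp hx
    have hq : aeval x w / aeval x B ^ 2 ≠ 0 := div_ne_zero h3 (pow_ne_zero 2 h2)
    have hq' := abs_pos.mpr hq
    rw [h.Ψ₂Sq_div_eq h2, mul_div_assoc]
    set q := aeval x w / aeval x B ^ 2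
    have h1' := Real.sqrt_pos.mpr h1
    rw [Real.sqrt_mul h1.le, Real.sqrt_sq_eq_abs, abs_mul,
      ← ENNReal.ofReal_inv_of_pos (by positivity), ← ENNReal.ofReal_inv_of_pos h1',
      ← ENNReal.ofReal_mul (by positivity), ← ENNReal.ofReal_mul (by positivity)]
    congr 1
    field_simp
  rw [setLIntegral_congr_fun hUm hL, lintegral_const_mul _ (by fun_prop)] at key
  rw [realIntegral, ← setLIntegral_congr hUae]
  exact key

/-- The comparison of periods over `ℂ`. -/
lemma complexPeriod_div_eq {E E' : WeierstrassCurve ℂ} [E'.IsElliptic] {φ : Isogeny E E'}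
    {A B w : ℂ[X]} {β : ℂ} (h : φ.HasRationalForm A B w β)
    (h0 : max A.natDegree B.natDegree ≠ 0) (ω : E.InvariantDifferential)
    (ω' : E'.InvariantDifferential) : E.complexPeriod ω / E'.complexPeriod ω' =
      (max A.natDegree B.natDegree : ℕ) * ‖(ω.coeff : ℂ) / (ω'.coeff * β)‖ ^ 2 := by
  have h1 := congrArg ENNReal.toReal (h.mul_complexIntegral_eq h0)
  rw [ENNReal.toReal_mul, ENNReal.toReal_mul, ENNReal.toReal_ofReal (by positivity),
    ENNReal.toReal_natCast] at h1
  have h2 : E'.complexIntegral.toReal ≠ 0 :=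
    ENNReal.toReal_ne_zero.mpr ⟨E'.complexIntegral_ne_zero, E'.complexIntegral_lt_top.ne⟩
  have h3 : ‖β‖ ≠ 0 := norm_ne_zero_iff.mpr h.β_ne_zero
  have h4 : ‖(ω'.coeff : ℂ)‖ ≠ 0 := norm_ne_zero_iff.mpr ω'.coeff.ne_zero
  rw [complexPeriod_eq, complexPeriod_eq, norm_div, norm_mul, div_eq_iff (by positivity)]
  field_simp
  linear_combination h1

/-- The comparison of periods over `ℝ`. -/
lemma realPeriod_div_eq {E E' : WeierstrassCurve ℝ} [E'.IsElliptic] {φ : Isogeny E E'}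
    {A B w : ℝ[X]} {β : ℝ} (h : φ.HasRationalForm A B w β) {k : ℕ}
    (hk : ENNReal.ofReal |β| * E.realIntegral = k * E'.realIntegral) (ω : E.InvariantDifferential)
    (ω' : E'.InvariantDifferential) : E.realPeriod ω / E'.realPeriod ω' =
      k * |(ω.coeff : ℝ) / (ω'.coeff * β)| := by
  have h1 := congrArg ENNReal.toReal hk
  rw [ENNReal.toReal_mul, ENNReal.toReal_mul, ENNReal.toReal_ofReal (by positivity),
    ENNReal.toReal_natCast] at h1
  have h2 : E'.realIntegral.toReal ≠ 0 :=
    ENNReal.toReal_ne_zero.mpr ⟨E'.realIntegral_ne_zero, E'.realIntegral_lt_top.ne⟩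
  have h3 : |β| ≠ 0 := abs_ne_zero.mpr h.β_ne_zero
  have h4 : |(ω'.coeff : ℝ)| ≠ 0 := abs_ne_zero.mpr ω'.coeff.ne_zero
  rw [realPeriod_eq, realPeriod_eq, abs_div, abs_mul, div_eq_iff (by positivity)]
  field_simp
  linear_combination h1

end Isogeny.HasRationalForm

end WeierstrassCurve

end

/-! ### Isogenies of degree two over ℝ. -/

noncomputable section

namespace WeierstrassCurve

open Set MeasureTheory
open scoped ENNReal

namespace Isogeny.HasRationalForm

variable {E E' : WeierstrassCurve ℝ} {φ : Isogeny E E'} {A B w : ℝ[X]} {β : ℝ}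

/-- Multiplicities at x in Ψ₂ w² = B Ψ₂'(A, B): Ψ₂ has a simple zero, Ψ₂'(A, B) none, and B has all
its zeros at x, so deg B = 1 + 2 mult(w). -/
lemma odd_natDegree_of_root_unique [E.IsElliptic] (h : φ.HasRationalForm A B w β) {x : ℂ}
    (hF : aeval x E.Ψ₂Sq = 0) (hB : ∀ z : ℂ, aeval z B = 0 ↔ z = x) : Odd B.natDegree := by
  classical
  set f : ℝ[X] →+* ℂ[X] := mapRingHom (algebraMap ℝ ℂ)
  have hf : ∀ p : ℝ[X], f p = p.map (algebraMap ℝ ℂ) := fun p => rfl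
  have hev : ∀ (p : ℝ[X]) (z : ℂ), (f p).eval z = aeval z p := fun p z => by
    rw [hf, eval_map_algebraMap]
  have hne : ∀ {p : ℝ[X]}, p ≠ 0 → f p ≠ 0 := fun {p} hp =>
    (Polynomial.map_ne_zero_iff (algebraMap ℝ ℂ).injective).mpr hp
  have h1 : (f E.Ψ₂Sq).rootMultiplicity x = 1 := by
    apply le_antisymm
    · exact rootMultiplicity_le_one_of_separable (E.Ψ₂Sq_separable.map) x
    · rw [Nat.one_le_iff_ne_zero, ← Nat.pos_iff_ne_zero,
        rootMultiplicity_pos (hne E.Ψ₂Sq_ne_zero'), IsRoot, hev, hF]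
  have hA : aeval x A ≠ 0 := h.aeval_ne_zero_of_aeval_eq_zero ((hB x).mpr rfl)
  have h2 : (f (E'.Ψ₂Form A B)).eval x ≠ 0 := by
    rw [hev, Ψ₂Form, cubicForm]
    simp only [map_add, map_mul, map_pow, aeval_C, (hB x).mpr rfl]
    simpa using hA
  have h3 := congrArg f h.Ψ₂Sq_mul_sq
  rw [map_mul, map_mul, map_pow] at h3
  have h4 := congrArg (rootMultiplicity x) h3
  have hL : f E.Ψ₂Sq * f w ^ 2 ≠ 0 :=
    mul_ne_zero (hne E.Ψ₂Sq_ne_zero') (pow_ne_zero 2 (hne h.w_ne_zero))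
  rw [rootMultiplicity_mul hL, rootMultiplicity_mul (h3 ▸ hL), h1, sq,
    rootMultiplicity_mul (mul_ne_zero (hne h.w_ne_zero) (hne h.w_ne_zero)),
    rootMultiplicity_eq_zero h2] at h4
  have h5 : (f B).rootMultiplicity x = B.natDegree := by
    have h6 : (f B).roots = Multiset.replicate (f B).roots.card x := by
      rw [Multiset.eq_replicate]
      refine ⟨rfl, fun z hz => ?_⟩
      rw [mem_roots (hne h.B_ne_zero), IsRoot, hev] at hz
      exact (hB z).mp hz
    rw [← count_roots, h6, Multiset.count_replicate_self,
      ← (IsAlgClosed.splits (f B)).natDegree_eq_card_roots, hf, natDegree_map]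
  rw [h5] at h4
  exact ⟨rootMultiplicity x (f w), by omega⟩

/-- The kernel of an isogeny of degree two over `ℝ` is generated by a real point of order two. -/
lemma exists_two_torsion [E.IsElliptic] [E'.IsElliptic] (h : φ.HasRationalForm A B w β)
    (hdeg : max A.natDegree B.natDegree = 2) : ∃ x₀ : ℝ, aeval x₀ E.Ψ₂Sq = 0 ∧
      (∀ z : ℂ, aeval z B = 0 ↔ z = x₀) ∧ B.natDegree = 1 ∧ A.natDegree = 2 := by
  have hker := h.ncard_ker (by rw [hdeg]; norm_num)
  rw [hdeg, Set.ncard_eq_two] at hker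
  obtain ⟨P, Q, hPQ, hker⟩ := hker
  obtain ⟨T, hT0, hT⟩ : ∃ T : E.ComplexPoints, T ≠ 0 ∧
      (φ.toHom.ker : Set E.ComplexPoints) = {0, T} := by
    have h0 : (0 : E.ComplexPoints) ∈ (φ.toHom.ker : Set E.ComplexPoints) := φ.toHom.ker.zero_mem
    rw [hker] at h0
    rcases h0 with rfl | h0
    · exact ⟨Q, hPQ.symm, hker⟩
    · rw [Set.mem_singleton_iff] at h0
      subst h0
      exact ⟨P, hPQ, by rw [hker, Set.pair_comm]⟩
  have hmem : ∀ R : E.ComplexPoints, φ.toHom R = 0 ↔ R = 0 ∨ R = T := fun R => by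
    have : R ∈ (φ.toHom.ker : Set E.ComplexPoints) ↔ R ∈ ({0, T} : Set E.ComplexPoints) := by
      rw [hT]
    simpa using this
  rcases T with _ | ⟨x, y, hn⟩
  · exact absurd rfl hT0
  have hBx : aeval x B = 0 := (h.toHom_some_eq_zero_iff hn).mp ((hmem _).mpr (Or.inr rfl))
  -- The point −T is a non-zero element of the kernel {0, T}, so −T = T.
  have hη : E.etaAt x y = 0 := by
    have h1 : φ.toHom (-(.some x y hn : E.ComplexPoints)) = 0 := by
      rw [map_neg, (hmem _).mpr (Or.inr rfl), neg_zero]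
    rcases (hmem _).mp h1 with h2 | h2
    · exact absurd (neg_eq_zero.mp h2) hT0
    · rw [Affine.Point.neg_some] at h2
      have h3 := congrArg (E.etaAt x) (Affine.Point.some.inj h2).2
      rw [etaAt_negY] at h3
      exact neg_eq_self.mp h3
  have hF : aeval x E.Ψ₂Sq = 0 := by
    rw [← (E.nonsingular_iff_etaAt_sq x y).mp hn, hη]; simp
  have hB : ∀ z : ℂ, aeval z B = 0 ↔ z = x := by
    intro z
    refine ⟨fun hz => ?_, fun hz => hz ▸ hBx⟩
    obtain ⟨e, he⟩ := IsAlgClosed.exists_pow_nat_eq (aeval z E.Ψ₂Sq) (n := 2) two_pos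
    have hzn := E.nonsingular_yOfEta he
    rcases (hmem _).mp ((h.toHom_some_eq_zero_iff hzn).mpr hz) with h2 | h2
    · exact absurd h2 (Affine.Point.some_ne_zero _)
    · exact (Affine.Point.some.inj h2).1
  -- B is real, so the conjugate of its only root is again a root.
  have hconj : (starRingEnd ℂ) x = x := by
    rw [← hB]
    have h2 : (starRingEnd ℂ) (aeval x B) = aeval ((starRingEnd ℂ) x) B :=
      (aeval_algHom_apply Complex.conjAe.toAlgHom x B).symm
    rw [← h2, hBx, map_zero]
  obtain ⟨x₀, hx₀⟩ := Complex.conj_eq_iff_real.mp hconj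
  have hodd := h.odd_natDegree_of_root_unique hF hB
  have hle : B.natDegree ≤ 2 := hdeg ▸ le_max_right _ _
  have hB1 : B.natDegree = 1 := by
    obtain ⟨m, hm⟩ := hodd
    omega
  subst hx₀
  refine ⟨x₀, ?_, hB, hB1, ?_⟩
  · rw [aeval_ofReal_eq] at hF
    exact_mod_cast hF
  · rw [hB1] at hdeg
    rcases max_choice A.natDegree 1 with h1 | h1 <;> omega

/-- The two components of the real points contribute equally to the period. -/
lemma lintegral_cubic_pos_eq {G : ℝ → ℝ} {e₁ e₂ e₃ c : ℝ} (h₁₂ : e₁ < e₂) (h₂₃ : e₂ ≤ e₃)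
    (hc : 0 < c) (hG : ∀ t, G t = c * ((t - e₁) * (t - e₂) * (t - e₃))) :
    ∫⁻ t in {t | 0 < G t}, (ENNReal.ofReal √(G t))⁻¹ =
      2 * ∫⁻ t in Ioi e₃, (ENNReal.ofReal √(G t))⁻¹ := by
  have hset : {t | 0 < G t} = Ioo e₁ e₂ ∪ Ioi e₃ := by
    ext t
    rw [mem_ofPred_eq, hG, mul_pos_iff_of_pos_left hc]
    constructor
    · intro ht
      rcases lt_or_ge e₃ t with h3 | h3
      · exact Or.inr h3
      · left
        have h3' : t - e₃ ≤ 0 := by linarith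
        have h4 : (t - e₁) * (t - e₂) < 0 := by
          by_contra h5
          push Not at h5
          exact absurd ht (not_lt.mpr (mul_nonpos_of_nonneg_of_nonpos h5 h3'))
        constructor
        · by_contra h5; push Not at h5
          exact absurd h4 (not_lt.mpr (mul_nonneg_of_nonpos_of_nonpos (by linarith) (by linarith)))
        · by_contra h5; push Not at h5
          exact absurd h4 (not_lt.mpr (mul_nonneg (by linarith) (by linarith)))
    · rintro (⟨h1, h2⟩ | h3)
      · exact mul_pos_of_neg_of_neg (mul_neg_of_pos_of_neg (by linarith) (by linarith))
          (by linarith)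
      · have h3' : e₃ < t := h3
        exact mul_pos (mul_pos (by linarith) (by linarith)) (by linarith)
  have hdisj : Disjoint (Ioo e₁ e₂) (Ioi e₃) := by
    rw [Set.disjoint_left]
    intro t ht ht'
    have h1 : e₃ < t := ht'
    linarith [ht.2]
  rw [hset, lintegral_union measurableSet_Ioi hdisj, two_mul]
  congr 1
  simp only [hG]
  exact lintegral_Ioo_eq_lintegral_Ioi_of_cubic h₁₂ h₂₃ hc

/-- The shape of an isogeny of degree two: `φ^* x = β⁻²(z + b / z) + σ`, where `z = x - x₀`. -/
lemma exists_two_isogeny_form (h : φ.HasRationalForm A B w β) {x₀ a b : ℝ}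
    (hB : ∀ z : ℂ, aeval z B = 0 ↔ z = x₀) (hB1 : B.natDegree = 1) (hA2 : A.natDegree = 2)
    (hF : E.Ψ₂Sq = C 4 * ((X - C x₀) * ((X - C x₀) ^ 2 + C a * (X - C x₀) + C b))) :
    ∃ ρ σ b₁ : ℝ, 0 < ρ ∧ b₁ ≠ 0 ∧ b ≠ 0 ∧ B = C b₁ * (X - C x₀) ∧
      A = C b₁ * (C ρ * ((X - C x₀) ^ 2 + C b) + C σ * (X - C x₀)) ∧
      C β * w = C (b₁ ^ 2 * ρ) * ((X - C x₀) ^ 2 - C b) := by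
  set Z : ℝ[X] := X - C x₀ with hZ
  obtain ⟨b₁, b₀, hb⟩ : ∃ b₁ b₀ : ℝ, B = C b₁ * Z + C b₀ := by
    refine ⟨B.coeff 1, B.coeff 0 + B.coeff 1 * x₀, ?_⟩
    conv_lhs => rw [eq_X_add_C_of_natDegree_le_one hB1.le]
    simp only [hZ, C_add, C_mul]; ring
  have hb₀ : b₀ = 0 := by
    have := (hB x₀).mpr rfl
    rw [hb] at this
    simpa [hZ] using this
  subst hb₀
  rw [C_0, add_zero] at hb
  have hb₁ : b₁ ≠ 0 := by rintro rfl; apply h.B_ne_zero; rw [hb]; simp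
  obtain ⟨a₂, a₁, a₀, ha⟩ : ∃ a₂ a₁ a₀ : ℝ, A = C a₂ * Z ^ 2 + C a₁ * Z + C a₀ := by
    refine ⟨A.coeff 2, A.coeff 1 + 2 * A.coeff 2 * x₀,
      A.coeff 0 + A.coeff 1 * x₀ + A.coeff 2 * x₀ ^ 2, ?_⟩
    conv_lhs => rw [A.as_sum_range_C_mul_X_pow, hA2]
    simp only [hZ, C_add, C_mul, C_pow, Finset.sum_range_succ, Finset.sum_range_zero,
      map_ofNat C]
    ring
  have ha₂ : a₂ ≠ 0 := by
    rintro rfl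
    have : A.natDegree ≤ 1 := by
      rw [ha, C_0, zero_mul, zero_add, hZ]
      compute_degree
    omega
  have ha₀ : a₀ ≠ 0 := by
    rintro rfl
    apply h.aeval_ne_zero_of_aeval_eq_zero ((hB x₀).mpr rfl)
    rw [ha]
    simp [hZ]
  have hw : C β * w = C b₁ * (C a₂ * Z ^ 2 - C a₀) := by
    have hdZ : derivative Z = 1 := by simp [hZ]
    rw [← h.wronskian_eq, hb, ha, sq]
    simp only [wronskian, derivative_add, derivative_mul, derivative_C, hdZ]
    ring
  have key : ∀ z : ℝ, 4 * (z * (z ^ 2 + a * z + b)) * (b₁ * (a₂ * z ^ 2 - a₀)) ^ 2 =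
      β ^ 2 * (b₁ * z * (4 * (a₂ * z ^ 2 + a₁ * z + a₀) ^ 3 + E'.b₂ * (a₂ * z ^ 2 + a₁ * z + a₀) ^ 2
        * (b₁ * z) + 2 * E'.b₄ * (a₂ * z ^ 2 + a₁ * z + a₀) * (b₁ * z) ^ 2 +
        E'.b₆ * (b₁ * z) ^ 3)) := by
    intro z
    have h1 := congrArg (eval (x₀ + z)) h.Ψ₂Sq_mul_sq
    have h2 := congrArg (eval (x₀ + z)) hw
    rw [hF, hb, ha, Ψ₂Form, cubicForm] at h1
    simp only [hZ, eval_mul, eval_add, eval_sub, eval_pow, eval_C, eval_X,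
      add_sub_cancel_left] at h1 h2
    rw [← h2]
    linear_combination β ^ 2 * h1
  -- Comparison of the coefficients of z⁷: the seventh difference of values at 0, …, 7 is 7! times
  -- the coefficient, and 20160 = 4 · 7!.
  have h7 : b₁ ^ 2 * a₂ ^ 2 = β ^ 2 * b₁ * a₂ ^ 3 := by
    linear_combination (key 7 - 7 * key 6 + 21 * key 5 - 35 * key 4 + 35 * key 3 - 21 * key 2 +
      7 * key 1 - key 0) / 20160
  -- Comparison of the coefficients of z, that is, of the derivatives at 0, by interpolation at 0,
  -- …, 7; both sides vanish at 0.
  have h1 : b * b₁ ^ 2 * a₀ ^ 2 = β ^ 2 * b₁ * a₀ ^ 3 := by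
    linear_combination (7 * key 1 - 21 / 2 * key 2 + 35 / 3 * key 3 - 35 / 4 * key 4 +
      21 / 5 * key 5 - 7 / 6 * key 6 + 1 / 7 * key 7) / 4
  have hb₁' : b₁ = β ^ 2 * a₂ := by
    apply mul_left_cancel₀ (mul_ne_zero hb₁ (pow_ne_zero 2 ha₂))
    linear_combination h7
  have ha₀' : a₀ = b * a₂ := by
    apply mul_left_cancel₀ (mul_ne_zero (mul_ne_zero hb₁ (pow_ne_zero 2 ha₀))
      (pow_ne_zero 2 h.β_ne_zero))
    linear_combination -h1 + b * b₁ * a₀ ^ 2 * hb₁'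
  have hβ := h.β_ne_zero
  refine ⟨a₂ / b₁, a₁ / b₁, b₁, ?_, hb₁, ?_, hb, ?_, ?_⟩
  · rw [hb₁', mul_comm, ← div_div, div_self ha₂]; positivity
  · rintro rfl; apply ha₀; rw [ha₀', zero_mul]
  · have e1 : C b₁ * C (a₂ / b₁) = (C a₂ : ℝ[X]) := by rw [← C_mul, mul_div_cancel₀ _ hb₁]
    have e2 : C b₁ * C (a₁ / b₁) = (C a₁ : ℝ[X]) := by rw [← C_mul, mul_div_cancel₀ _ hb₁]
    rw [ha, ha₀', C_mul]
    linear_combination -(Z ^ 2 + C b) * e1 - Z * e2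
  · have e1 : (C (b₁ ^ 2 * (a₂ / b₁)) : ℝ[X]) = C b₁ * C a₂ := by
      rw [← C_mul]; congr 1; field_simp
    rw [hw, e1, ha₀', C_mul]; ring

open scoped Classical in
/-- The comparison of real periods for an isogeny of degree two. -/
lemma mul_realIntegral_eq_of_two (h : φ.HasRationalForm A B w β) {x₀ a b : ℝ}
    (hB : ∀ z : ℂ, aeval z B = 0 ↔ z = x₀) (hB1 : B.natDegree = 1) (hA2 : A.natDegree = 2)
    (hF : E.Ψ₂Sq = C 4 * ((X - C x₀) * ((X - C x₀) ^ 2 + C a * (X - C x₀) + C b))) :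
    ENNReal.ofReal |β| * E.realIntegral =
      ((if 0 < b ∧ (a < 0 ∨ a ^ 2 < 4 * b) then 1 else 2 : ℕ) : ℝ≥0∞) * E'.realIntegral := by
  obtain ⟨ρ, σ, b₁, hρ, hb₁, hb, hBeq, hAeq, hw⟩ := h.exists_two_isogeny_form hB hB1 hA2 hF
  have hβ := h.β_ne_zero
  have hsol : ∀ t x : ℝ, t * aeval x B = aeval x A ↔
      (x - x₀) ^ 2 - (t - σ) / ρ * (x - x₀) + b = 0 := by
    intro t x
    rw [hBeq, hAeq]
    simp only [map_mul, map_add, map_sub, map_pow, aeval_C, aeval_X, Algebra.algebraMap_self,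
      RingHom.id_apply]
    have : b₁ * (ρ * ((x - x₀) ^ 2 + b) + σ * (x - x₀)) - t * (b₁ * (x - x₀)) =
        (b₁ * ρ) * ((x - x₀) ^ 2 - (t - σ) / ρ * (x - x₀) + b) := by
      field_simp; ring
    constructor
    · intro h1
      rw [h1, sub_self] at this
      exact (mul_eq_zero.mp this.symm).resolve_left (mul_ne_zero hb₁ hρ.ne')
    · intro h1
      rw [h1, mul_zero] at this
      linarith
  -- The cubic of E' is computed at a preimage z of t, that is, a root of z² − τz + b = 0. The root
  -- is taken in ℂ since it need not be real.
  have hG : ∀ t : ℝ, aeval t E'.Ψ₂Sq =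
      4 * ρ ^ 2 / β ^ 2 * (((t - σ) / ρ + a) * (((t - σ) / ρ) ^ 2 - 4 * b)) := by
    intro t
    set τ := (t - σ) / ρ with hτ
    have ht : t = ρ * τ + σ := by rw [hτ]; field_simp; ring
    obtain ⟨s, hs⟩ := IsAlgClosed.exists_pow_nat_eq ((τ : ℂ) ^ 2 - 4 * b) (n := 2) two_pos
    set z : ℂ := (τ + s) / 2 with hz
    have hz2 : z ^ 2 + b = τ * z := by rw [hz]; linear_combination hs / 4
    have hz0 : z ≠ 0 := by
      intro h0
      rw [h0] at hz2
      apply hb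
      have : (b : ℂ) = 0 := by linear_combination hz2
      exact_mod_cast this
    have eB : aeval (x₀ + z : ℂ) B = b₁ * z := by
      rw [hBeq]; simp
    have eA : aeval (x₀ + z : ℂ) A = b₁ * (ρ * (z ^ 2 + b) + σ * z) := by
      rw [hAeq]; simp
    have eF : aeval (x₀ + z : ℂ) E.Ψ₂Sq = 4 * (z * (z ^ 2 + a * z + b)) := by
      rw [hF]; simp
    have ew : (β : ℂ) * aeval (x₀ + z : ℂ) w = b₁ ^ 2 * ρ * (z ^ 2 - b) := by
      have := congrArg (aeval (x₀ + z : ℂ)) hw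
      simpa using this
    have h1 := h.Ψ₂Sq_mul_sq_eq (x := (x₀ + z : ℂ)) (t := (t : ℂ)) (by
      rw [eB, eA, hz2, ht]; push_cast; ring)
    rw [eB, eF, aeval_ofReal_eq] at h1
    have hβ' : (β : ℂ) ≠ 0 := by exact_mod_cast hβ
    have hb₁' : (b₁ : ℂ) ≠ 0 := by exact_mod_cast hb₁
    have e3 : (z ^ 2 - b) ^ 2 = z ^ 2 * ((τ : ℂ) ^ 2 - 4 * b) := by
      linear_combination (z ^ 2 + b + τ * z) * hz2
    have e4 : z ^ 2 + a * z + b = z * (τ + a) := by linear_combination hz2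
    have h2 : (b₁ * z) ^ 4 * ((β : ℂ) ^ 2 * ((aeval t E'.Ψ₂Sq : ℝ) : ℂ)) =
        (b₁ * z) ^ 4 * (4 * ρ ^ 2 * ((τ + a) * (τ ^ 2 - 4 * b))) := by
      have h3 : (b₁ * z) ^ 4 * ((β : ℂ) ^ 2 * ((aeval t E'.Ψ₂Sq : ℝ) : ℂ)) =
          4 * (z * (z ^ 2 + a * z + b)) * (β * aeval (x₀ + z : ℂ) w) ^ 2 := by
        linear_combination -(β : ℂ) ^ 2 * h1
      rw [h3, ew, e4, mul_pow, e3]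
      ring
    have h3 := mul_left_cancel₀ (pow_ne_zero 4 (mul_ne_zero hb₁' hz0)) h2
    have h4 : β ^ 2 * aeval t E'.Ψ₂Sq = 4 * ρ ^ 2 * ((τ + a) * (τ ^ 2 - 4 * b)) := by
      exact_mod_cast h3
    field_simp
    linear_combination h4
  have hκ : 0 < 4 * ρ ^ 2 / β ^ 2 := by positivity
  -- The second condition is that z² − τz + b has positive discriminant, hence two real roots.
  set S : Set ℝ := {t | 0 < aeval t E'.Ψ₂Sq} ∩ {t | 4 * b < ((t - σ) / ρ) ^ 2} with hS
  have hSm : MeasurableSet S :=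
    (isOpen_lt continuous_const (Polynomial.continuous_aeval _)).measurableSet.inter
      (measurableSet_lt (by fun_prop) (by fun_prop))
  have key := h.mul_realIntegral_eq hSm (fun t ht => ht.1) (k := 2) (fun t x hx ht => by
    refine ⟨ht, ?_⟩
    rw [hsol] at hx
    have h1 : ((t - σ) / ρ) ^ 2 - 4 * b = (2 * (x - x₀) - (t - σ) / ρ) ^ 2 := by
      linear_combination -4 * hx
    have h2 : ((t - σ) / ρ) ^ 2 - 4 * b ≠ 0 := by
      intro h0
      rw [hG, h0] at ht
      simp at ht
    have h3 : 0 ≤ ((t - σ) / ρ) ^ 2 - 4 * b := by rw [h1]; exact sq_nonneg _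
    have h4 := lt_of_le_of_ne h3 h2.symm
    change 4 * b < _
    linarith) (by norm_num) (Filter.Eventually.of_forall fun t ht => by
    have ht2 : 4 * b < ((t - σ) / ρ) ^ 2 := ht.2
    set τ := (t - σ) / ρ
    set s := √(τ ^ 2 - 4 * b) with hs
    have hs2 : s ^ 2 = τ ^ 2 - 4 * b := Real.sq_sqrt (by linarith)
    have hs0 : 0 < s := Real.sqrt_pos.mpr (by linarith)
    rw [Set.ncard_eq_two]
    refine ⟨x₀ + (τ + s) / 2, x₀ + (τ - s) / 2, by linarith, ?_⟩
    ext x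
    rw [mem_ofPred_eq, hsol, mem_insert_iff, mem_singleton_iff]
    have hfac : (x - x₀) ^ 2 - τ * (x - x₀) + b =
        (x - (x₀ + (τ + s) / 2)) * (x - (x₀ + (τ - s) / 2)) := by
      linear_combination hs2 / 4
    rw [hfac, mul_eq_zero, sub_eq_zero, sub_eq_zero])
  rw [key]
  split_ifs with hcase
  · obtain ⟨hb0, hcase⟩ := hcase
    set s := 2 * √b with hs
    have hs0 : 0 < s := mul_pos two_pos (Real.sqrt_pos.mpr hb0)
    have hs2 : s ^ 2 = 4 * b := by rw [hs, mul_pow, Real.sq_sqrt hb0.le]; norm_num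
    -- The case condition says that b > 0 and a < 2√b: the least root of (τ + a)(τ² − 4b) is then
    -- −2√b, and only the unbounded component has τ² > 4b.
    have has : -s < -a := by
      rcases hcase with h1 | h1
      · linarith
      · have := abs_lt_of_sq_lt_sq (by linarith : a ^ 2 < s ^ 2) hs0.le
        linarith [(abs_lt.mp this).2]
    have hτ : ∀ t u : ℝ, u < (t - σ) / ρ ↔ ρ * u + σ < t := fun t u => by
      rw [lt_div_iff₀ hρ, mul_comm u ρ, lt_sub_iff_add_lt]
    have hSeq : S = Ioi (ρ * max s (-a) + σ) := by
      ext t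
      rw [mem_Ioi, ← hτ, hS, mem_inter_iff, mem_ofPred_eq, mem_ofPred_eq, hG,
        mul_pos_iff_of_pos_left hκ, max_lt_iff]
      set τ := (t - σ) / ρ
      constructor
      · rintro ⟨h1, h2⟩
        have h3 : 0 < τ + a := pos_of_mul_pos_left h1 (by linarith)
        refine ⟨?_, by linarith⟩
        by_contra! h4
        nlinarith
      · rintro ⟨h1, h2⟩
        have h3 : 4 * b < τ ^ 2 := by rw [← hs2]; exact pow_lt_pow_left₀ h1 hs0.le two_ne_zero
        exact ⟨mul_pos (by linarith) (by linarith), h3⟩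
    have hI := lintegral_cubic_pos_eq (G := fun t => aeval t E'.Ψ₂Sq) (e₁ := ρ * (-s) + σ)
      (e₂ := ρ * min s (-a) + σ) (e₃ := ρ * max s (-a) + σ) (c := 4 * ρ ^ 2 / β ^ 2 / ρ ^ 3)
      (by
        have : -s < min s (-a) := lt_min (by linarith) has
        have := mul_lt_mul_of_pos_left this hρ
        linarith)
      (by
        have := mul_le_mul_of_nonneg_left (min_le_max (a := s) (b := -a)) hρ.le
        linarith) (by positivity) (fun t => by
        have h1 : ((t - (ρ * min s (-a) + σ)) * (t - (ρ * max s (-a) + σ))) =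
            (t - (ρ * s + σ)) * (t - (ρ * (-a) + σ)) := by
          linear_combination ρ ^ 2 * min_mul_max s (-a) - ρ * (t - σ) * min_add_max s (-a)
        rw [mul_assoc, h1, hG, ← hs2]
        field_simp
        ring)
    rw [hSeq]
    change _ = _ * ∫⁻ x in {x : ℝ | 0 < aeval x E'.Ψ₂Sq}, (ENNReal.ofReal √(aeval x E'.Ψ₂Sq))⁻¹
    rw [hI]
    simp
  -- If τ² ≤ 4b and the cubic is positive, then τ² < 4b and τ < −a; this gives b > 0 and, if a ≥ 0,
  -- also a² < 4b, which is the excluded case.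
  · have hSeq : S = {t : ℝ | 0 < aeval t E'.Ψ₂Sq} := by
      rw [hS, inter_eq_left]
      intro t ht
      rw [mem_ofPred_eq, hG, mul_pos_iff_of_pos_left hκ] at ht
      change 4 * b < _
      set τ := (t - σ) / ρ
      by_contra hle
      push Not at hle
      have h1 : τ ^ 2 - 4 * b < 0 := by
        refine lt_of_le_of_ne (by linarith) fun h0 => ?_
        rw [h0, mul_zero] at ht
        exact lt_irrefl _ ht
      have h2 : τ + a < 0 := by
        by_contra h3
        push Not at h3
        exact absurd ht (not_lt.mpr (mul_nonpos_of_nonneg_of_nonpos h3 h1.le))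
      have hb0 : 0 < b := by nlinarith [sq_nonneg τ]
      apply hcase
      refine ⟨hb0, ?_⟩
      by_contra h4
      push Not at h4
      nlinarith
    rw [hSeq]
    rfl

/-- Only b₂, b₄ and b₆ enter Ψ₂, so s and t play no part; undoing the scaling by u multiplies a by
u² and b by u⁴. -/
lemma two_torsion_form_eq {V : VariableChange ℝ} {a b : ℝ}
    (hV : V • E = { a₁ := 0, a₂ := a, a₃ := 0, a₄ := b, a₆ := 0 }) :
    E.Ψ₂Sq = C 4 * ((X - C V.r) * ((X - C V.r) ^ 2 + C ((V.u : ℝ) ^ 2 * a) * (X - C V.r) +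
      C ((V.u : ℝ) ^ 4 * b))) := by
  have hu : (V.u : ℝ) ≠ 0 := V.u.ne_zero
  have h2 : (V • E).b₂ = 4 * a := by rw [hV, b₂]; ring
  have h4 : (V • E).b₄ = 2 * b := by rw [hV, b₄]; ring
  have h6 : (V • E).b₆ = 0 := by rw [hV, b₆]; ring
  rw [variableChange_b₂, Units.val_inv_eq_inv_val] at h2
  rw [variableChange_b₄, Units.val_inv_eq_inv_val] at h4
  rw [variableChange_b₆, Units.val_inv_eq_inv_val] at h6
  field_simp at h2 h4 h6
  refine Polynomial.funext fun x => ?_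
  simp only [Ψ₂Sq, eval_add, eval_mul, eval_pow, eval_C, eval_X, eval_sub]
  have h6' : E.b₆ + 2 * V.r * E.b₄ + V.r ^ 2 * E.b₂ + 4 * V.r ^ 3 = 0 := by
    linear_combination h6
  linear_combination (x - V.r) ^ 2 * h2 + 2 * (x - V.r) * h4 + h6'

lemma exists_isTwoTorsionForm [E.IsElliptic] [E'.IsElliptic] (h : φ.HasRationalForm A B w β)
    {x₀ : ℝ} (hF : aeval x₀ E.Ψ₂Sq = 0) (hB : ∀ z : ℂ, aeval z B = 0 ↔ z = x₀) :
    ∃ (V : VariableChange ℝ) (a b : ℝ), φ.IsTwoTorsionForm V a b := by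
  set y₀ := E.yOfEta x₀ 0 with hy₀
  have hy : E.toAffine.Equation x₀ y₀ := by
    rw [equation_iff_sq_eq, hF]
    have := E.etaAt_yOfEta x₀ 0
    rw [etaAt] at this
    simp only [Algebra.algebraMap_self, RingHom.id_apply] at this
    rw [this]; simp
  rw [Affine.equation_iff'] at hy
  have hy2 : 2 * y₀ + E.a₁ * x₀ + E.a₃ = 0 := E.etaAt_yOfEta x₀ 0
  -- The point T moves to the origin and −a₁/2 removes the xy term. Then a₃ vanishes since η(T) = 0,
  -- and a₆ since T lies on E.
  set V : VariableChange ℝ := ⟨1, x₀, -E.a₁ / 2, y₀⟩ with hV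
  refine ⟨V, (V • E).a₂, (V • E).a₄, ?_, ?_⟩
  · ext
    · rw [variableChange_a₁]; simp [hV]; ring
    · rfl
    · rw [variableChange_a₃]
      simp only [hV, inv_one, Units.val_one]
      linear_combination hy2
    · rfl
    · rw [variableChange_a₆]
      simp only [hV, inv_one, Units.val_one]
      linear_combination -hy
  · have hn : (Affine.baseChange E.toAffine ℂ).Nonsingular (x₀ : ℂ) (y₀ : ℂ) := by
      rw [nonsingular_iff_etaAt_sq, aeval_ofReal_eq, hF]
      have : E.etaAt (x₀ : ℂ) (y₀ : ℂ) = ((2 * y₀ + E.a₁ * x₀ + E.a₃ : ℝ) : ℂ) := by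
        rw [etaAt]; push_cast; rfl
      rw [this, hy2]; simp
    exact ⟨hn, (h.toHom_some_eq_zero_iff hn).mpr ((hB _).mpr rfl)⟩

end Isogeny.HasRationalForm

end WeierstrassCurve

end

/-! ### The real factor λ in all cases, and the theorem. -/

noncomputable section

namespace WeierstrassCurve.Isogeny.HasRationalForm

open Set MeasureTheory
open scoped ENNReal

variable {E E' : WeierstrassCurve ℝ} [E.IsElliptic] [E'.IsElliptic] {φ : Isogeny E E'}
  {A B w : ℝ[X]} {β : ℝ}

open scoped Classical in
theorem mul_realIntegral_eq_of_odd (h : φ.HasRationalForm A B w β) {p : ℕ} (hp : p.Prime)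
    (hp2 : p ≠ 2) (hdeg : max A.natDegree B.natDegree = p) :
    ENNReal.ofReal |β| * E.realIntegral =
      ((if φ.toHom.ker ≤ realPoints E then p else 1 : ℕ) : ℝ≥0∞) * E'.realIntegral := by
  obtain ⟨t₀, ht₀⟩ := h.ncard_real_fiber_of_odd hp hp2 hdeg
  refine h.mul_realIntegral_eq (S := {t : ℝ | 0 < aeval t E'.Ψ₂Sq})
    (measurableSet_lt measurable_const (E'.Ψ₂Sq.continuous_aeval.measurable)) (fun t ht => ht)
    (fun t x _ ht => ht) ?_ ?_
  · split_ifs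
    · exact hp.ne_zero
    · exact one_ne_zero
  · filter_upwards [Measure.ae_ne volume t₀] with t ht hpos using ht₀ t ht hpos

-- The kernel determines x₀, hence V.r for every admissible form; the criterion on a and b is
-- unchanged when they are scaled by u² and u⁴.
open scoped Classical in
theorem mul_realIntegral_eq_of_isTwoTorsionForm (h : φ.HasRationalForm A B w β)
    (hdeg : max A.natDegree B.natDegree = 2) {V : VariableChange ℝ} {a b : ℝ}
    (hV : φ.IsTwoTorsionForm V a b) :
    ENNReal.ofReal |β| * E.realIntegral =
      ((if 0 < b ∧ (a < 0 ∨ a ^ 2 < 4 * b) then 1 else 2 : ℕ) : ℝ≥0∞) * E'.realIntegral := by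
  obtain ⟨x₀, -, hB, hB1, hA2⟩ := h.exists_two_torsion hdeg
  obtain ⟨hVE, hn, h0⟩ := hV
  have hr : V.r = x₀ := by
    exact_mod_cast (hB _).mp ((h.toHom_some_eq_zero_iff hn).mp h0)
  have hF := two_torsion_form_eq hVE
  rw [hr] at hF
  have hu : (0 : ℝ) < (V.u : ℝ) ^ 2 := sq_pos_of_ne_zero V.u.ne_zero
  have hb : 0 < (V.u : ℝ) ^ 4 * b ↔ 0 < b := mul_pos_iff_of_pos_left <| by
    simpa [← pow_mul] using pow_pos hu 2
  have ha : (V.u : ℝ) ^ 2 * a < 0 ↔ a < 0 := by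
    simpa using mul_lt_mul_iff_right₀ (b := a) (c := 0) hu
  have hab : ((V.u : ℝ) ^ 2 * a) ^ 2 < 4 * ((V.u : ℝ) ^ 4 * b) ↔ a ^ 2 < 4 * b := by
    rw [← mul_lt_mul_iff_right₀ (b := a ^ 2) (c := 4 * b) (pow_pos hu 2)]
    ring_nf
  have := h.mul_realIntegral_eq_of_two hB hB1 hA2 hF
  simpa only [hb, ha, hab] using this

end WeierstrassCurve.Isogeny.HasRationalForm

end

theorem theorem1p2 (p : ℕ) (hp : p.Prime) :
    (∀ (E E' : WeierstrassCurve ℂ) [E.IsElliptic] [E'.IsElliptic] (φ : WeierstrassCurve.Isogeny E E'),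
      φ.degree = p →
      ∀ (ω : E.InvariantDifferential) (ω' : E'.InvariantDifferential),
      ∃ α : ℂ, ω.toKaehler = algebraMap ℂ E.RatFun α • φ.pullback ω'.toKaehler ∧
        E.complexPeriod ω / E'.complexPeriod ω' = p * ‖α‖ ^ 2) ∧
    (∀ (E E' : WeierstrassCurve ℝ) [E.IsElliptic] [E'.IsElliptic] (φ : WeierstrassCurve.Isogeny E E'),
      φ.degree = p →
      ∀ (ω : E.InvariantDifferential) (ω' : E'.InvariantDifferential),
      ∃ α : ℝ, ω.toKaehler = algebraMap ℝ E.RatFun α • φ.pullback ω'.toKaehler ∧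
        (p ≠ 2 → φ.toHom.ker ≤ (WeierstrassCurve.Affine.Point.baseChange (W' := E.toAffine) ℝ ℂ).range →
          E.realPeriod ω / E'.realPeriod ω' = p * |α|) ∧
        (p ≠ 2 → ¬ φ.toHom.ker ≤ (WeierstrassCurve.Affine.Point.baseChange (W' := E.toAffine) ℝ ℂ).range →
          E.realPeriod ω / E'.realPeriod ω' = 1 * |α|) ∧
        (p = 2 →
          (∃ (V : WeierstrassCurve.VariableChange ℝ) (a b : ℝ), φ.IsTwoTorsionForm V a b) ∧
          ∀ (V : WeierstrassCurve.VariableChange ℝ) (a b : ℝ), φ.IsTwoTorsionForm V a b →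
            ((0 < b ∧ (a < 0 ∨ a ^ 2 < 4 * b)) →
              E.realPeriod ω / E'.realPeriod ω' = 1 * |α|) ∧
            (¬ (0 < b ∧ (a < 0 ∨ a ^ 2 < 4 * b)) →
              E.realPeriod ω / E'.realPeriod ω' = 2 * |α|))) := by
  classical
  refine ⟨fun E E' _ _ φ hφ ω ω' => ?_, fun E E' _ _ φ hφ ω ω' => ?_⟩
  · obtain ⟨A, B, w, β, h⟩ := φ.exists_hasRationalForm
    have hdeg := h.max_natDegree_eq_degree (hφ ▸ hp.ne_zero)
    refine ⟨_, h.toKaehler_eq ω ω', ?_⟩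
    rw [h.complexPeriod_div_eq (by rw [hdeg, hφ]; exact hp.ne_zero) ω ω', hdeg, hφ]
  · obtain ⟨A, B, w, β, h⟩ := φ.exists_hasRationalForm
    have hdeg := (h.max_natDegree_eq_degree (hφ ▸ hp.ne_zero)).trans hφ
    refine ⟨_, h.toKaehler_eq ω ω', fun hp2 hk => ?_, fun hp2 hk => ?_, ?_⟩
    · rw [h.realPeriod_div_eq (h.mul_realIntegral_eq_of_odd hp hp2 hdeg) ω ω', if_pos hk]
    · rw [h.realPeriod_div_eq (h.mul_realIntegral_eq_of_odd hp hp2 hdeg) ω ω', if_neg hk,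
        Nat.cast_one]
    · rintro rfl
      refine ⟨?_, fun V a b hV => ?_⟩
      · obtain ⟨x₀, hF, hB, -⟩ := h.exists_two_torsion hdeg
        exact h.exists_isTwoTorsionForm hF hB
      · have hI := h.realPeriod_div_eq (h.mul_realIntegral_eq_of_isTwoTorsionForm hdeg hV) ω ω'
        refine ⟨fun hc => ?_, fun hc => ?_⟩
        · rw [hI, if_pos hc, Nat.cast_one]
        · rw [hI, if_neg hc, Nat.cast_ofNat]
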